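/- Setting. Let $J\subseteq\mathbb R$ be an open interval with coordinate $x$, let $U\subseteq\mathbb R^p$ be open (even external parameters), and let $\mathcal F=C^\infty(J\times U)\otimes\Lambda(\xi,\theta_1,\dots,\theta_q)$ (real or complex valued) be the superalgebra of functions on the superline with even coordinate $x$ and odd coordinate $\xi$, depending on external parameters $u\in U$ and odd $\theta_1,\dots,\theta_q$. Put $D=\partial_\xi+\xi\partial_x$. Constants are the $c\in\mathcal F$ with $\partial_xc=\partial_\xi c=0$. A non-degenerate operator of order $m$ is $L=a_0D^m+a_1D^{m-1}+\dots+a_m$ with $a_0$ even and invertible and $a_k\in\mathcal F$ of parity $k\bmod 2$; it is monic if $a_0=1$. A Darboux transformation $L_0\to L_1$ of order $r$, where $L_0,L_1$ are non-degenerate of the same order and with the same top coefficient, is a monic operator $M$ of order $r$ with $ML_0=L_1M$. A subspace $V\subseteq\mathcal F$ of dimension $a|b$ is a free right module over the constants with a basis of $a$ even and $b$ odd functions. The Wroński matrix of functions $\varphi_0,\dots,\varphi_{n-1}$ with $\varphi_i$ of parity $i\bmod2$ is $(D^i\varphi_j)_{0\le i,j<n}$, its $i$-th row and column having parity $i\bmod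 2$. With $A_{ab}$ the block of rows of parity $a$ and columns of parity $b$, one sets $\operatorname{Ber}A=\det(A_{00}-A_{01}A_{11}^{-1}A_{10})/\det A_{11}$ and $\operatorname{Ber}^*A=\det(A_{11}-A_{10}A_{00}^{-1}A_{01})/\det A_{00}$, and $W$, $W^*$ denote $\operatorname{Ber}$, $\operatorname{Ber}^*$ of the Wroński matrix. A subspace of dimension $s+1|s$ or $s|s$ is called non-degenerate if the Wroński matrix of a basis with alternating parities (equivalently, of any such basis) is invertible over $\mathcal F$. Theorem. Let $L_0$ be a non-degenerate operator on the superline and let $r=2s+1$ or $r=2s$. The map $(L_0\xrightarrow{M}L_1)\mapsto\operatorname{Ker}M$ is a one-to-one correspondence between the Darboux transformations of $L_0$ of order $r$ and the $L_0$-invariant non-degenerate subspaces of $\mathcal F$ of dimension $s+1|s$ if $r=2s+1$, respectively $s|s$ if $r=2s$. If $\varphi_0,\dots,\varphi_{r-1}$ is a basis of $\operatorname{Ker}M$ with $\varphi_i$ of parity $i\bmod 2$, then its Wroński matrix is invertible and $$M\psi=\frac{W^*(\varphi_0,\dots,\varphi_{r-1},\psi)}{W^*(\varphi_0,\dots,\varphi_{r-1})}\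 \text{ for odd } \psi,\ r=2s+1,\qquad M\varphi=\frac{W(\varphi_0,\dots,\varphi_{r-1},\varphi)}{W(\varphi_0,\dots,\varphi_{r-1})}\ \text{ for even }\varphi,\ r=2s,$$ the denominators being invertible; on functions of the other parity $M$ is given by linear extension, that is, by the same explicit expression (which is left linear in the last column of the matrix). -/

import Mathlib

open scoped ContDiff TensorProduct

noncomputable section

namespace Superline

variable (𝕜 : Type) [RCLike 𝕜] {p : ℕ}

/-! ### Functions on the superline -/

/-- The underlying open set `J × U`: the even coordinate `x` runs through `J ⊆ ℝ`, the even
external parameters run through `U ⊆ ℝᵖ`. -/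
abbrev Body (J : TopologicalSpace.Opens ℝ) (U : TopologicalSpace.Opens (Fin p → ℝ)) :
    Set (ℝ × (Fin p → ℝ)) :=
  (J : Set ℝ) ×ˢ (U : Set (Fin p → ℝ))

theorem isOpen_body (J : TopologicalSpace.Opens ℝ) (U : TopologicalSpace.Opens (Fin p → ℝ)) :
    IsOpen (Body J U) :=
  J.isOpen.prod U.isOpen

variable {𝕜} in
/-- Extension by zero of a function on `J × U` (only its values on `J × U` matter). -/
def ext0 {J : TopologicalSpace.Opens ℝ} {U : TopologicalSpace.Opens (Fin p → ℝ)}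
    (f : Body J U → 𝕜) : ℝ × (Fin p → ℝ) → 𝕜 :=
  Function.extend Subtype.val f 0

variable {𝕜} in
theorem ext0_apply {J : TopologicalSpace.Opens ℝ} {U : TopologicalSpace.Opens (Fin p → ℝ)}
    (f : Body J U → 𝕜) (z : Body J U) : ext0 f z = f z :=
  Subtype.val_injective.extend_apply f 0 z

variable {𝕜} in
theorem contDiffOn_ext0_congr {J : TopologicalSpace.Opens ℝ}
    {U : TopologicalSpace.Opens (Fin p → ℝ)} {f : Body J U → 𝕜} {g : ℝ × (Fin p → ℝ) → 𝕜}
    (hg : ContDiffOn ℝ ∞ g (Body J U)) (h : ∀ z : Body J U, f z = g z) :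
    ContDiffOn ℝ ∞ (ext0 f) (Body J U) :=
  hg.congr fun z hz => (ext0_apply f ⟨z, hz⟩).trans (h ⟨z, hz⟩)

/-- The algebra `C^∞(J × U)` of smooth `𝕜`-valued functions. -/
def Smooth (J : TopologicalSpace.Opens ℝ) (U : TopologicalSpace.Opens (Fin p → ℝ)) :
    Subalgebra 𝕜 (Body J U → 𝕜) where
  carrier := {f | ContDiffOn ℝ ∞ (ext0 f) (Body J U)}
  mul_mem' {f g} hf hg := contDiffOn_ext0_congr (ContDiffOn.mul hf hg)
    fun z => by simp [ext0_apply]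
  add_mem' {f g} hf hg := contDiffOn_ext0_congr (ContDiffOn.add hf hg)
    fun z => by simp [ext0_apply]
  algebraMap_mem' c := contDiffOn_ext0_congr (contDiffOn_const (c := c)) fun z => by simp

/-- `∂/∂x` on `C^∞(J × U)`. -/
def dx (J : TopologicalSpace.Opens ℝ) (U : TopologicalSpace.Opens (Fin p → ℝ)) :
    Smooth 𝕜 J U →ₗ[𝕜] Smooth 𝕜 J U where
  toFun f := ⟨fun z => fderiv ℝ (ext0 f.1) z (1, 0),
    contDiffOn_ext0_congr
      (((show ContDiffOn ℝ ∞ (ext0 f.1) (Body J U) from f.2).fderiv_of_isOpen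
        (isOpen_body J U) (m := ∞) le_rfl).clm_apply contDiffOn_const) fun _ => rfl⟩
  map_add' f g := by
    ext z
    have hd : ∀ h : Smooth 𝕜 J U, DifferentiableAt ℝ (ext0 h.1) z := fun h =>
      ((show ContDiffOn ℝ ∞ (ext0 h.1) (Body J U) from h.2).contDiffAt
        ((isOpen_body J U).mem_nhds z.2)).differentiableAt (by simp)
    have he : ext0 (f + g).1 = ext0 f.1 + ext0 g.1 := by
      funext w
      by_cases hw : w ∈ Body J U
      · simpa using (ext0_apply (f + g).1 ⟨w, hw⟩).trans
          (congrArg₂ (· + ·) (ext0_apply f.1 ⟨w, hw⟩) (ext0_apply g.1 ⟨w, hw⟩)).symm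
      · have hn : ¬ ∃ a : Body J U, a.1 = w := fun ⟨a, ha⟩ => hw (ha ▸ a.2)
        simp [ext0, Function.extend_apply' _ _ _ hn]
    simp only [he, fderiv_add (hd f) (hd g)]
    rfl
  map_smul' c f := by
    ext z
    have hd : DifferentiableAt ℝ (ext0 f.1) z :=
      ((show ContDiffOn ℝ ∞ (ext0 f.1) (Body J U) from f.2).contDiffAt
        ((isOpen_body J U).mem_nhds z.2)).differentiableAt (by simp)
    have he : ext0 (c • f).1 = c • ext0 f.1 := by
      funext w
      by_cases hw : w ∈ Body J U
      · simpa using (ext0_apply (c • f).1 ⟨w, hw⟩).trans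
          (congrArg (c • ·) (ext0_apply f.1 ⟨w, hw⟩)).symm
      · have hn : ¬ ∃ a : Body J U, a.1 = w := fun ⟨a, ha⟩ => hw (ha ▸ a.2)
        simp [ext0, Function.extend_apply' _ _ _ hn]
    simp only [he, fderiv_const_smul hd c]
    rfl

/-- The Grassmann algebra on the odd coordinate `ξ` (generator `0`) and `q` odd external
parameters (generators `1, …, q`). -/
abbrev Grassmann (q : ℕ) : Type := ExteriorAlgebra 𝕜 (Fin (q + 1) → 𝕜)

/-- The superalgebra of functions `C^∞(J × U) ⊗ Λ(ξ, θ₁, …, θ_q)` on the superline with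
coordinates `x, ξ`, over the base `U^{p|q}` of external parameters. -/
abbrev SFun (J : TopologicalSpace.Opens ℝ) (U : TopologicalSpace.Opens (Fin p → ℝ)) (q : ℕ) :
    Type :=
  Smooth 𝕜 J U ⊗[𝕜] Grassmann 𝕜 q

instance (J : TopologicalSpace.Opens ℝ) (U : TopologicalSpace.Opens (Fin p → ℝ)) (q : ℕ) :
    Ring (SFun 𝕜 J U q) :=
  inferInstanceAs (Ring (Smooth 𝕜 J U ⊗[𝕜] Grassmann 𝕜 q))

instance (J : TopologicalSpace.Opens ℝ) (U : TopologicalSpace.Opens (Fin p → ℝ)) (q : ℕ) :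
    Algebra 𝕜 (SFun 𝕜 J U q) :=
  inferInstanceAs (Algebra 𝕜 (Smooth 𝕜 J U ⊗[𝕜] Grassmann 𝕜 q))

variable {𝕜} {J : TopologicalSpace.Opens ℝ} {U : TopologicalSpace.Opens (Fin p → ℝ)} {q : ℕ}

/-- The parity involution of the algebra of functions: `1` on even, `-1` on odd functions. -/
def parityInvolution : SFun 𝕜 J U q →ₐ[𝕜] SFun 𝕜 J U q :=
  (Algebra.TensorProduct.map (AlgHom.id 𝕜 (Smooth 𝕜 J U)) CliffordAlgebra.involute :
    Smooth 𝕜 J U ⊗[𝕜] Grassmann 𝕜 q →ₐ[𝕜] Smooth 𝕜 J U ⊗[𝕜] Grassmann 𝕜 q)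

/-- `f` is homogeneous of parity `k mod 2`. -/
def HasParity (k : ℕ) (f : SFun 𝕜 J U q) : Prop :=
  (parityInvolution : SFun 𝕜 J U q →ₐ[𝕜] SFun 𝕜 J U q) f = (-1 : 𝕜) ^ k • f

/-- The odd coordinate function `ξ`. -/
def xi : SFun 𝕜 J U q :=
  ((1 : Smooth 𝕜 J U) ⊗ₜ ExteriorAlgebra.ι 𝕜 (Pi.single (0 : Fin (q + 1)) (1 : 𝕜)) :
    Smooth 𝕜 J U ⊗[𝕜] Grassmann 𝕜 q)

/-- `∂_x`. -/
def partialX : Module.End 𝕜 (SFun 𝕜 J U q) :=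
  (TensorProduct.map (dx 𝕜 J U) LinearMap.id :
    Smooth 𝕜 J U ⊗[𝕜] Grassmann 𝕜 q →ₗ[𝕜] Smooth 𝕜 J U ⊗[𝕜] Grassmann 𝕜 q)

/-- `∂_ξ`, the left derivative in `ξ`. -/
def partialXi : Module.End 𝕜 (SFun 𝕜 J U q) :=
  (TensorProduct.map LinearMap.id (CliffordAlgebra.contractLeft (LinearMap.proj 0)) :
    Smooth 𝕜 J U ⊗[𝕜] Grassmann 𝕜 q →ₗ[𝕜] Smooth 𝕜 J U ⊗[𝕜] Grassmann 𝕜 q)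

/-- The superderivative `D = ∂_ξ + ξ ∂_x`. -/
def D : Module.End 𝕜 (SFun 𝕜 J U q) :=
  partialXi + LinearMap.mulLeft 𝕜 (xi : SFun 𝕜 J U q) * partialX

/-- Constants: functions of the external parameters only. -/
def IsConst (c : SFun 𝕜 J U q) : Prop := partialX c = 0 ∧ partialXi c = 0

/-! ### Non-degenerate operators and Darboux transformations -/

/-- `L = a₀ D^m + b_{m-1} D^{m-1} + ⋯ + b₀` is a non-degenerate differential operator of order `m`
with top coefficient `a₀` (even and invertible); like `a₀ D^m`, it is homogeneous of parity
`m mod 2`. -/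
def IsNondegenerateOp (a₀ : SFun 𝕜 J U q) (m : ℕ) (L : Module.End 𝕜 (SFun 𝕜 J U q)) : Prop :=
  IsUnit a₀ ∧ HasParity 0 a₀ ∧
    ∃ b : Fin m → SFun 𝕜 J U q, (∀ j : Fin m, HasParity (m + j) (b j)) ∧
      L = LinearMap.mulLeft 𝕜 a₀ * D ^ m + ∑ j, LinearMap.mulLeft 𝕜 (b j) * D ^ (j : ℕ)

/-- Monic differential operators of order `m`. -/
def IsMonicOp (m : ℕ) (L : Module.End 𝕜 (SFun 𝕜 J U q)) : Prop := IsNondegenerateOp 1 m L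

/-- `M` defines a Darboux transformation `L₀ → L₁` of order `r`, where `L₀, L₁` are non-degenerate
of the same order `m` with the same top coefficient `a₀`. -/
def IsDarboux (a₀ : SFun 𝕜 J U q) (m r : ℕ) (L₀ L₁ M : Module.End 𝕜 (SFun 𝕜 J U q)) : Prop :=
  IsNondegenerateOp a₀ m L₀ ∧ IsNondegenerateOp a₀ m L₁ ∧ IsMonicOp r M ∧ M * L₀ = L₁ * M

/-! ### Subspaces, i.e. free right modules over the algebra of constants -/

/-- `φ` is a basis of `V` over the constants: `V` consists of the combinations `∑ φᵢ cᵢ` with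
constant `cᵢ`, and the `φᵢ` are linearly independent over the constants. -/
def IsBasisOver {ι : Type} [Fintype ι] (φ : ι → SFun 𝕜 J U q)
    (V : Submodule 𝕜 (SFun 𝕜 J U q)) : Prop :=
  (∀ f, f ∈ V ↔ ∃ c : ι → SFun 𝕜 J U q, (∀ i, IsConst (c i)) ∧ f = ∑ i, φ i * c i) ∧
    ∀ c : ι → SFun 𝕜 J U q, (∀ i, IsConst (c i)) → ∑ i, φ i * c i = 0 → c = 0

/-- `dim V = a|b`: there is a basis of `a` even and `b` odd functions. -/
def HasSuperdim (V : Submodule 𝕜 (SFun 𝕜 J U q)) (a b : ℕ) : Prop :=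
  ∃ (φ : Fin a → SFun 𝕜 J U q) (ψ : Fin b → SFun 𝕜 J U q),
    (∀ i, HasParity 0 (φ i)) ∧ (∀ i, HasParity 1 (ψ i)) ∧ IsBasisOver (Sum.elim φ ψ) V

/-- A basis `φ₀, …, φ_{n-1}` of `V` with alternating parities, `φᵢ` of parity `i mod 2`. -/
def IsAlternatingBasis {n : ℕ} (φ : Fin n → SFun 𝕜 J U q)
    (V : Submodule 𝕜 (SFun 𝕜 J U q)) : Prop :=
  (∀ i : Fin n, HasParity i (φ i)) ∧ IsBasisOver φ V

/-! ### Berezinians and super Wronskians -/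

/-- The Leibniz determinant, with each product taken in the order of the columns. It is used for
matrices whose entries are even, except possibly in the last column, so that the factors of each
product commute. -/
def ldet {R ι : Type} [Ring R] [Fintype ι] [LinearOrder ι] (A : Matrix ι ι R) : R :=
  ∑ σ : Equiv.Perm ι, Equiv.Perm.sign σ •
    ((Finset.univ.sort (· ≤ ·)).map fun i : ι => A (σ i) i).prod

/-- The block of `A` with rows of parity `a` and columns of parity `b`, in the matrix format
`par`. -/
def block {R ι : Type} (par : ι → ZMod 2) (A : Matrix ι ι R) (a b : ZMod 2) :
    Matrix {i // par i = a} {i // par i = b} R :=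
  A.submatrix Subtype.val Subtype.val

/-- The Berezinian `det(A₀₀ - A₀₁ A₁₁⁻¹ A₁₀) / det A₁₁`, for `A₁₁` invertible. -/
def ber {R ι : Type} [Ring R] [Fintype ι] [LinearOrder ι] (par : ι → ZMod 2)
    (A : Matrix ι ι R) : R :=
  Ring.inverse (ldet (block par A 1 1)) *
    ldet (block par A 0 0 - block par A 0 1 * Ring.inverse (block par A 1 1) * block par A 1 0)

/-- The inverse Berezinian: the Berezinian after reversing the parities of rows and columns. -/
def berStar {R ι : Type} [Ring R] [Fintype ι] [LinearOrder ι] (par : ι → ZMod 2)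
    (A : Matrix ι ι R) : R :=
  ber (fun i => par i + 1) A

/-- The Wroński matrix `(D^i φ_j)`. -/
def wronskiMatrix {n : ℕ} (φ : Fin n → SFun 𝕜 J U q) : Matrix (Fin n) (Fin n) (SFun 𝕜 J U q) :=
  Matrix.of fun i j => (D ^ (i : ℕ)) (φ j)

/-- The format of the Wroński matrix: the `i`-th row and column have parity `i mod 2`. -/
def altFormat (n : ℕ) : Fin n → ZMod 2 := fun i => ((i : ℕ) : ZMod 2)

/-- The super Wronskian `W(φ₀, …, φ_{n-1})`. -/
def W {n : ℕ} (φ : Fin n → SFun 𝕜 J U q) : SFun 𝕜 J U q := ber (altFormat n) (wronskiMatrix φ)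

/-- The inverse super Wronskian `W*(φ₀, …, φ_{n-1})`. -/
def WStar {n : ℕ} (φ : Fin n → SFun 𝕜 J U q) : SFun 𝕜 J U q :=
  berStar (altFormat n) (wronskiMatrix φ)

/-- `V` is non-degenerate of dimension `⌈n/2⌉|⌊n/2⌋`: some basis of `n` functions with alternating
parities has an invertible Wroński matrix (invertibility does not depend on the basis). -/
def IsNondegenerateSpace (n : ℕ) (V : Submodule 𝕜 (SFun 𝕜 J U q)) : Prop :=
  ∃ φ : Fin n → SFun 𝕜 J U q, IsAlternatingBasis φ V ∧ IsUnit (wronskiMatrix φ)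

end Superline

end

/-! ### Superalgebras with an odd derivation -/

noncomputable section

namespace Superline

/-! The algebraic half works over any supercommutative algebra with an odd derivation, parity being
encoded by an involution `P`. An operator of order less than `n` that kills `n` functions with
invertible Wroński matrix is zero, because its coefficient row times that matrix vanishes
(`coeff_eq_zero_of_isUnit_wronski`). Inverting the same matrix yields a monic `M` of order `r` with
`r` prescribed solutions (`exists_isMonic_of_isUnit_wronski`) and shows that the kernel of `M` is
freely spanned by them over the constants (`IsMonic.ker_iff`,
`const_independent_of_isUnit_wronski`).

If moreover `L₀` preserves this kernel, then `M * L₀ - a₀ D^m M` has order less than `m + r`;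
division by `M` leaves a remainder of order less than `r` that kills the kernel basis, hence is
zero, and `L₁` is `a₀ D^m` plus the quotient (`IsMonic.exists_intertwining`). Conversely an
intertwining relation makes the kernel invariant, and `M` determines `L₁` because right
multiplication by a monic operator is injective on differential operators
(`IsMonic.eq_zero_of_mul_eq_zero`).

The analytic half shows that every monic operator has a full system of homogeneous solutions on all
of `J × U` (`exists_solutions`). The companion system has the form `D F = B F`. Writing `B = B₀ + ξ
B₁` with `B₀`, `B₁` free of `ξ`, the substitution `F = (1 + ξ B₀) Φ` turns it into `∂ₓ Φ = (B₁ +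
P(B₀) B₀) Φ` (`exists_D_solution`). In the monomial basis of the Grassmann algebra this is an
ordinary linear system with smooth parameters, solved globally by inverting a Volterra operator that
depends smoothly on the parameters (`exists_linearODE_solution`).

For the formulas, adjoin `ψ` to a kernel basis. The last column of the enlarged Wroński matrix is a
right combination of the other columns plus `M ψ` times the last basis vector. When the last index
counts as even, this survives the passage to the Schur complement, and the Berezinian acquires
exactly the factor `M ψ` (`ber_eq_mul`). Requiring the last index to be even is what selects `W` for
`r = 2s` and `W*` for `r = 2s + 1`. -/

/-- A supercommutative algebra `R` (graded by the involution `P`) with an odd derivation `D`. -/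
structure OddDerivation (𝕜 R : Type) [Field 𝕜] [Ring R] [Algebra 𝕜 R] where
  P : R →ₐ[𝕜] R
  D : Module.End 𝕜 R
  P_P : ∀ a, P (P a) = a
  comm_of_even : ∀ a b, P b = b → a * b = b * a
  comm_of_odd : ∀ a b, P b = -b → a * b = b * P a
  leibniz : ∀ a b, D (a * b) = D a * b + P a * D b
  P_D : ∀ a, P (D a) = -D (P a)

namespace OddDerivation

variable {𝕜 R : Type} [Field 𝕜] [Ring R] [Algebra 𝕜 R] (S : OddDerivation 𝕜 R)

/-- Homogeneity of parity `k mod 2`. -/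
def HasPar (k : ℕ) (a : R) : Prop := S.P a = (-1 : 𝕜) ^ k • a

variable {S}

theorem HasPar.congr {k l : ℕ} {a : R} (h : S.HasPar k a) (hkl : k % 2 = l % 2) :
    S.HasPar l a := by
  unfold HasPar at *
  rw [h, neg_one_pow_eq_pow_mod_two, hkl, ← neg_one_pow_eq_pow_mod_two]

theorem HasPar.add {k : ℕ} {a b : R} (ha : S.HasPar k a) (hb : S.HasPar k b) :
    S.HasPar k (a + b) := by
  unfold HasPar at *
  rw [map_add, ha, hb, smul_add]

theorem HasPar.zero {k : ℕ} : S.HasPar k 0 := by simp [HasPar]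

theorem HasPar.neg {k : ℕ} {a : R} (ha : S.HasPar k a) : S.HasPar k (-a) := by
  unfold HasPar at *
  rw [map_neg, ha, smul_neg]

theorem HasPar.sub {k : ℕ} {a b : R} (ha : S.HasPar k a) (hb : S.HasPar k b) :
    S.HasPar k (a - b) := by
  rw [sub_eq_add_neg]; exact ha.add hb.neg

theorem HasPar.smul {k : ℕ} {a : R} (x : 𝕜) (ha : S.HasPar k a) : S.HasPar k (x • a) := by
  unfold HasPar at *
  rw [map_smul, ha, smul_comm]

theorem HasPar.sum {ι : Type*} {s : Finset ι} {k : ℕ} {a : ι → R}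
    (ha : ∀ i ∈ s, S.HasPar k (a i)) : S.HasPar k (∑ i ∈ s, a i) := by
  unfold HasPar at *
  rw [map_sum, Finset.smul_sum]
  exact Finset.sum_congr rfl ha

theorem HasPar.mul {k l : ℕ} {a b : R} (ha : S.HasPar k a) (hb : S.HasPar l b) :
    S.HasPar (k + l) (a * b) := by
  unfold HasPar at *
  rw [map_mul, ha, hb, smul_mul_smul_comm, pow_add]

theorem HasPar.one : S.HasPar 0 1 := by simp [HasPar]

theorem HasPar.map_P {k : ℕ} {a : R} (ha : S.HasPar k a) : S.HasPar k (S.P a) := by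
  rw [show S.P a = _ from ha]; exact ha.smul _

theorem HasPar.map_D {k : ℕ} {a : R} (ha : S.HasPar k a) : S.HasPar (k + 1) (S.D a) := by
  unfold HasPar at *
  rw [S.P_D, ha, map_smul, pow_succ]
  simp

theorem HasPar.map_D_pow {k : ℕ} {a : R} (ha : S.HasPar k a) (n : ℕ) :
    S.HasPar (k + n) ((S.D ^ n) a) := by
  induction n with
  | zero => simpa using ha
  | succ n ih => rw [pow_succ', Module.End.mul_apply]; exact ih.map_D

theorem HasPar.P_eq {a : R} (ha : S.HasPar 0 a) : S.P a = a := by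
  simpa [HasPar] using ha

theorem HasPar.comm {a : R} (ha : S.HasPar 0 a) (b : R) : b * a = a * b :=
  S.comm_of_even b a ha.P_eq

variable (S)

theorem D_mul_mulLeft (c : R) :
    S.D * LinearMap.mulLeft 𝕜 c
      = LinearMap.mulLeft 𝕜 (S.D c) + LinearMap.mulLeft 𝕜 (S.P c) * S.D := by
  ext f
  simp [S.leibniz]

theorem D_mul_const {c : R} (hc : S.D c = 0) (f : R) : S.D (f * c) = S.D f * c := by
  simp [S.leibniz, hc]

theorem D_pow_mul_const {c : R} (hc : S.D c = 0) (n : ℕ) (f : R) :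
    (S.D ^ n) (f * c) = (S.D ^ n) f * c := by
  induction n with
  | zero => simp
  | succ n ih => rw [pow_succ', Module.End.mul_apply, ih, S.D_mul_const hc]; rfl

/-! ### Differential operators of parity `t` and order less than `n` -/

/-- Operators `∑_{k < n} c_k D^k` with `c_k` of parity `t + k`. -/
def Op (t n : ℕ) : Submodule 𝕜 (Module.End 𝕜 R) where
  carrier := {T | ∃ c : ℕ → R, (∀ k, S.HasPar (t + k) (c k)) ∧
    T = ∑ k ∈ Finset.range n, LinearMap.mulLeft 𝕜 (c k) * S.D ^ k}
  add_mem' := by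
    rintro _ _ ⟨c, hc, rfl⟩ ⟨d, hd, rfl⟩
    refine ⟨c + d, fun k => (hc k).add (hd k), ?_⟩
    rw [← Finset.sum_add_distrib]
    refine Finset.sum_congr rfl fun k _ => ?_
    ext f; simp [add_mul]
  zero_mem' := ⟨0, fun k => HasPar.zero, by
    refine (Finset.sum_eq_zero fun k _ => ?_).symm
    ext f; simp⟩
  smul_mem' := by
    rintro x _ ⟨c, hc, rfl⟩
    refine ⟨x • c, fun k => (hc k).smul x, ?_⟩
    rw [Finset.smul_sum]
    refine Finset.sum_congr rfl fun k _ => ?_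
    ext f; simp

variable {S}

theorem mulLeft_mul_D_pow_mem_Op {t n k : ℕ} {c : R} (hc : S.HasPar (t + k) c) (hk : k < n) :
    LinearMap.mulLeft 𝕜 c * S.D ^ k ∈ S.Op t n := by
  refine ⟨Pi.single k c, fun l => ?_, ?_⟩
  · by_cases h : l = k
    · subst h; simpa using hc
    · simpa [h] using HasPar.zero
  · rw [Finset.sum_eq_single_of_mem k (Finset.mem_range.2 hk)]
    · simp
    · intro l _ hl; ext f; simp [hl]

theorem Op_le {t n : ℕ} {p : Submodule 𝕜 (Module.End 𝕜 R)}
    (h : ∀ k < n, ∀ c, S.HasPar (t + k) c → LinearMap.mulLeft 𝕜 c * S.D ^ k ∈ p) :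
    S.Op t n ≤ p := by
  rintro _ ⟨c, hc, rfl⟩
  exact Submodule.sum_mem _ fun k hk => h k (Finset.mem_range.1 hk) _ (hc k)

theorem Op_mono {t n t' n' : ℕ} (hn : n ≤ n') (ht : t % 2 = t' % 2) : S.Op t n ≤ S.Op t' n' :=
  Op_le fun k hk _ hc =>
    mulLeft_mul_D_pow_mem_Op (hc.congr (by omega)) (lt_of_lt_of_le hk hn)

theorem D_mul_mem_Op {t n : ℕ} {T : Module.End 𝕜 R} (hT : T ∈ S.Op t n) :
    S.D * T ∈ S.Op (t + 1) (n + 1) := by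
  have : S.Op t n ≤ (S.Op (t + 1) (n + 1)).comap (LinearMap.mulLeft 𝕜 S.D) := by
    refine Op_le fun k hk c hc => ?_
    rw [Submodule.mem_comap, LinearMap.mulLeft_apply, ← mul_assoc, D_mul_mulLeft, add_mul,
      mul_assoc, ← pow_succ']
    exact add_mem (mulLeft_mul_D_pow_mem_Op (hc.map_D.congr (by omega)) (by omega))
      (mulLeft_mul_D_pow_mem_Op (hc.map_P.congr (by omega)) (by omega))
  exact this hT

theorem D_pow_mul_mem_Op {t n : ℕ} {T : Module.End 𝕜 R} (hT : T ∈ S.Op t n) (k : ℕ) :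
    S.D ^ k * T ∈ S.Op (t + k) (n + k) := by
  induction k with
  | zero => simpa using hT
  | succ k ih => rw [pow_succ', mul_assoc]; exact D_mul_mem_Op ih

theorem mulLeft_mul_mem_Op {t l n : ℕ} {T : Module.End 𝕜 R} (hT : T ∈ S.Op t n) {a : R}
    (ha : S.HasPar l a) : LinearMap.mulLeft 𝕜 a * T ∈ S.Op (t + l) n := by
  have : S.Op t n ≤ (S.Op (t + l) n).comap (LinearMap.mulLeft 𝕜 (LinearMap.mulLeft 𝕜 a)) := by
    refine Op_le fun k hk c hc => ?_
    rw [Submodule.mem_comap, LinearMap.mulLeft_apply, ← mul_assoc]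
    rw [show LinearMap.mulLeft 𝕜 a * LinearMap.mulLeft 𝕜 c = LinearMap.mulLeft 𝕜 (a * c) by
      ext; simp]
    exact mulLeft_mul_D_pow_mem_Op ((ha.mul hc).congr (by omega)) hk
  exact this hT

theorem mul_mem_Op {t n t' n' : ℕ} {T T' : Module.End 𝕜 R} (hT : T ∈ S.Op t n)
    (hT' : T' ∈ S.Op t' (n' + 1)) : T * T' ∈ S.Op (t + t') (n + n') := by
  have : S.Op t n ≤ (S.Op (t + t') (n + n')).comap (LinearMap.mulRight 𝕜 T') := by
    refine Op_le fun k hk c hc => ?_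
    rw [Submodule.mem_comap, LinearMap.mulRight_apply, mul_assoc]
    exact Op_mono (by omega) (by omega) (mulLeft_mul_mem_Op (D_pow_mul_mem_Op hT' k) hc)
  exact this hT

/-- For even `a` one has `D a = a D + (D a)` as operators, with no sign, so each exchange of `D` and
`a` costs one order. -/
theorem commutator_mem_Op {a : R} (ha : S.HasPar 0 a) (r : ℕ) :
    S.D ^ r * LinearMap.mulLeft 𝕜 a - LinearMap.mulLeft 𝕜 a * S.D ^ r ∈ S.Op r r := by
  induction r with
  | zero => simp
  | succ r ih =>
    have h : S.D ^ (r + 1) * LinearMap.mulLeft 𝕜 a - LinearMap.mulLeft 𝕜 a * S.D ^ (r + 1)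
        = S.D * (S.D ^ r * LinearMap.mulLeft 𝕜 a - LinearMap.mulLeft 𝕜 a * S.D ^ r)
          + LinearMap.mulLeft 𝕜 (S.D a) * S.D ^ r := by
      have := S.D_mul_mulLeft a
      rw [ha.P_eq] at this
      rw [mul_sub, ← mul_assoc S.D (LinearMap.mulLeft 𝕜 a), this, add_mul, pow_succ', mul_assoc,
        mul_assoc (LinearMap.mulLeft 𝕜 a)]
      abel
    rw [h]
    exact add_mem (D_mul_mem_Op ih)
      (mulLeft_mul_D_pow_mem_Op (ha.map_D.congr (by omega)) (by omega))

/-! ### Non-degenerate and monic operators; division with remainder -/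

variable (S)

/-- Non-degenerate operators of order `m` with top coefficient `a`. -/
def IsNondegenerate (a : R) (m : ℕ) (L : Module.End 𝕜 R) : Prop :=
  ∃ L' ∈ S.Op m m, L = LinearMap.mulLeft 𝕜 a * S.D ^ m + L'

/-- Monic operators of order `r`. -/
def IsMonic (r : ℕ) (M : Module.End 𝕜 R) : Prop := ∃ M' ∈ S.Op r r, M = S.D ^ r + M'

variable {S}

theorem IsMonic.D_pow_mul_sub_mem {r : ℕ} {M : Module.End 𝕜 R} (hM : S.IsMonic r M) (k : ℕ) :
    S.D ^ k * M - S.D ^ (r + k) ∈ S.Op (r + k) (r + k) := by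
  obtain ⟨M', hM', rfl⟩ := hM
  rw [mul_add, ← pow_add, add_comm k r, add_sub_cancel_left]
  exact D_pow_mul_mem_Op hM' k

/-- Division with remainder by a monic operator. -/
theorem IsMonic.exists_div {r : ℕ} {M : Module.End 𝕜 R} (hM : S.IsMonic r M) (t n : ℕ)
    {T : Module.End 𝕜 R} (hT : T ∈ S.Op (t + r) (n + r)) :
    ∃ Q ∈ S.Op t n, T - Q * M ∈ S.Op (t + r) r := by
  induction n generalizing T with
  | zero => exact ⟨0, zero_mem _, by simpa using hT⟩
  | succ n ih =>
    obtain ⟨c, hc, rfl⟩ := hT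
    rw [show n + 1 + r = (n + r) + 1 by omega, Finset.sum_range_succ]
    set T' := ∑ k ∈ Finset.range (n + r), LinearMap.mulLeft 𝕜 (c k) * S.D ^ k with hT'
    have hT'm : T' ∈ S.Op (t + r) (n + r) := ⟨c, hc, rfl⟩
    -- The top term `c D^(n+r)` is `c D^n M` up to lower order; the error `hN` is absorbed into the
    -- operator to which induction applies.
    have hN := mulLeft_mul_mem_Op (hM.D_pow_mul_sub_mem n) (hc (n + r))
    obtain ⟨Q, hQ, hR⟩ := ih (sub_mem hT'm (Op_mono (by omega) (by omega) hN))
    refine ⟨Q + LinearMap.mulLeft 𝕜 (c (n + r)) * S.D ^ n,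
      add_mem (Op_mono (by omega) rfl hQ)
        (mulLeft_mul_D_pow_mem_Op ((hc (n + r)).congr (by omega)) (by omega)), ?_⟩
    convert hR using 1
    rw [add_mul, mul_sub, mul_assoc, add_comm r n]
    abel

/-- Both products have leading term `a D^(m+r)`, since the even `a` passes through `D^r` up to lower
order. This is why `L₁` can have the same top coefficient as `L₀`. -/
theorem IsMonic.mul_sub_mem {r m : ℕ} {M L : Module.End 𝕜 R} {a : R} (hM : S.IsMonic r M)
    (ha : S.HasPar 0 a) (hL : S.IsNondegenerate a m L) :
    M * L - LinearMap.mulLeft 𝕜 a * S.D ^ m * M ∈ S.Op (m + r) (m + r) := by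
  have hLm : L ∈ S.Op m (m + 1) := by
    obtain ⟨L', hL', rfl⟩ := hL
    exact add_mem (mulLeft_mul_D_pow_mem_Op (ha.congr (by omega)) (by omega))
      (Op_mono (by omega) rfl hL')
  have h1 := mulLeft_mul_mem_Op (hM.D_pow_mul_sub_mem m) ha
  obtain ⟨M', hM', rfl⟩ := hM
  have h2 := mul_mem_Op hM' hLm
  obtain ⟨L', hL', rfl⟩ := hL
  have h3 := D_pow_mul_mem_Op hL' r
  have h4 := mul_mem_Op (n' := m) (t' := m) (commutator_mem_Op ha r)
    (show S.D ^ m ∈ S.Op m (m + 1) by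
      have := mulLeft_mul_D_pow_mem_Op (S := S) (t := m) (n := m + 1) (k := m) (c := 1)
        (HasPar.one.congr (by omega)) (by omega)
      rwa [LinearMap.mulLeft_one, ← Module.End.one_eq_id, one_mul] at this)
  have key : (S.D ^ r + M') * (LinearMap.mulLeft 𝕜 a * S.D ^ m + L')
      - LinearMap.mulLeft 𝕜 a * S.D ^ m * (S.D ^ r + M')
      = S.D ^ r * L' + M' * (LinearMap.mulLeft 𝕜 a * S.D ^ m + L')
        + (S.D ^ r * LinearMap.mulLeft 𝕜 a - LinearMap.mulLeft 𝕜 a * S.D ^ r) * S.D ^ m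
        - LinearMap.mulLeft 𝕜 a * (S.D ^ m * (S.D ^ r + M') - S.D ^ (r + m)) := by
    rw [pow_add]
    simp only [mul_add, add_mul, mul_sub, sub_mul, mul_assoc]
    abel
  rw [key]
  exact sub_mem (add_mem (add_mem h3 (Op_mono (by omega) (by omega) h2))
    (Op_mono (by omega) (by omega) h4)) (Op_mono (by omega) (by omega) h1)

/-! ### Wroński matrices -/

variable (S)

/-- The Wroński matrix `(D^i φ_j)`. -/
def wronski {n : ℕ} (φ : Fin n → R) : Matrix (Fin n) (Fin n) R :=
  Matrix.of fun i j => (S.D ^ (i : ℕ)) (φ j)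

variable {S}

/-- The hypothesis says that the row of coefficients annihilates the Wroński matrix from the left.
No parity is needed. -/
theorem coeff_eq_zero_of_isUnit_wronski {n : ℕ} {φ : Fin n → R} (hφ : IsUnit (S.wronski φ))
    {c : ℕ → R} (h : ∀ j, (∑ k ∈ Finset.range n, LinearMap.mulLeft 𝕜 (c k) * S.D ^ k) (φ j) = 0) :
    ∀ k < n, c k = 0 := by
  obtain ⟨A, hA⟩ := hφ
  have h1 : Matrix.vecMul (fun i : Fin n => c i) (S.wronski φ) = 0 := by
    funext j
    have := h j
    simpa [Matrix.vecMul, dotProduct, wronski, Finset.sum_range] using this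
  have h2 : (fun i : Fin n => c i) = 0 := by
    have := congrArg (fun v => Matrix.vecMul v (↑A⁻¹ : Matrix (Fin n) (Fin n) R)) h1
    simpa [Matrix.vecMul_vecMul, ← hA] using this
  intro k hk
  exact congrFun h2 ⟨k, hk⟩

theorem eq_zero_of_isUnit_wronski {n t : ℕ} {φ : Fin n → R} (hφ : IsUnit (S.wronski φ))
    {T : Module.End 𝕜 R} (hT : T ∈ S.Op t n) (h : ∀ j, T (φ j) = 0) : T = 0 := by
  obtain ⟨c, hc, rfl⟩ := hT
  refine Finset.sum_eq_zero fun k hk => ?_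
  rw [coeff_eq_zero_of_isUnit_wronski hφ h k (Finset.mem_range.1 hk)]
  simp

theorem IsMonic.eq_of_isUnit_wronski {r : ℕ} {φ : Fin r → R} (hφ : IsUnit (S.wronski φ))
    {M N : Module.End 𝕜 R} (hM : S.IsMonic r M) (hN : S.IsMonic r N) (h : ∀ j, M (φ j) = 0)
    (h' : ∀ j, N (φ j) = 0) : M = N := by
  obtain ⟨M', hM', rfl⟩ := hM
  obtain ⟨N', hN', rfl⟩ := hN
  have := eq_zero_of_isUnit_wronski hφ (sub_mem hM' hN') fun j => by
    have := (h j).trans (h' j).symm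
    simpa [sub_eq_zero] using this
  rw [sub_eq_zero.1 this]

/-- The lower coefficients are the unique row `b` with `b * wronski φ = -(D^r φ)`. -/
theorem exists_isMonic_of_isUnit_wronski {r : ℕ} {φ : Fin r → R} (hφ : IsUnit (S.wronski φ))
    (hpar : ∀ i : Fin r, S.HasPar i (φ i)) :
    ∃ M, S.IsMonic r M ∧ ∀ j, M (φ j) = 0 := by
  obtain ⟨A, hA⟩ := hφ
  set row : Fin r → R := fun j => (S.D ^ r) (φ j) with hrow
  set b : Fin r → R := -(Matrix.vecMul row (↑A⁻¹ : Matrix (Fin r) (Fin r) R)) with hb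
  have hbA : Matrix.vecMul b (S.wronski φ) = -row := by
    rw [hb, Matrix.neg_vecMul, Matrix.vecMul_vecMul, ← hA]
    simp
  have hbp : ∀ i : Fin r, S.HasPar (r + i) (b i) := by
    -- Applying `P` with the expected signs produces another solution of the same linear system, so
    -- uniqueness forces the parities of `b`.
    set b' : Fin r → R := fun i => (-1 : 𝕜) ^ (r + (i : ℕ)) • S.P (b i) with hb'
    have h1 : Matrix.vecMul b' (S.wronski φ) = -row := by
      funext j
      have h2 : S.P (Matrix.vecMul b (S.wronski φ) j) = S.P (-row j) := by rw [hbA]; rfl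
      rw [map_neg, show S.P (row j) = _ from (hpar j).map_D_pow r, Matrix.vecMul, dotProduct,
        map_sum] at h2
      have h3 : ∀ i : Fin r, S.P (b i * S.wronski φ i j)
          = (-1 : 𝕜) ^ ((j : ℕ) + r) • (b' i * S.wronski φ i j) := by
        intro i
        rw [map_mul, show S.P (S.wronski φ i j) = _ from (hpar j).map_D_pow i, hb']
        simp only [mul_smul_comm, smul_mul_assoc, smul_smul]
        congr 1
        rw [← pow_add, neg_one_pow_eq_pow_mod_two, neg_one_pow_eq_pow_mod_two (n := _ + (r + _))]
        congr 1; omega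
      simp_rw [h3] at h2
      rw [← Finset.smul_sum, ← smul_neg] at h2
      have hu : IsUnit ((-1 : 𝕜) ^ ((j : ℕ) + r)) := (isUnit_one.neg).pow _
      exact hu.smul_left_cancel.1 h2
    have h4 : b' = b := by
      have := congrArg (fun v => Matrix.vecMul v (↑A⁻¹ : Matrix (Fin r) (Fin r) R))
        (h1.trans hbA.symm)
      simpa [Matrix.vecMul_vecMul, ← hA] using this
    intro i
    have h5 := congrFun h4 i
    rw [hb'] at h5
    unfold HasPar
    conv_rhs => rw [← h5]
    rw [smul_smul, ← pow_add, ← two_mul, pow_mul]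
    simp
  refine ⟨S.D ^ r + ∑ k : Fin r, LinearMap.mulLeft 𝕜 (b k) * S.D ^ (k : ℕ), ⟨_, ?_, rfl⟩, ?_⟩
  · exact Submodule.sum_mem _ fun k _ => mulLeft_mul_D_pow_mem_Op (hbp k) k.2
  · intro j
    have := congrFun hbA j
    simp only [Matrix.vecMul, dotProduct, wronski, Matrix.of_apply, Pi.neg_apply] at this
    simp [this, hrow]

/-- The kernel of a monic operator is free over the constants, on any family of `r` solutions
with invertible Wroński matrix. -/
theorem IsMonic.ker_iff {r : ℕ} {φ : Fin r → R} (hφ : IsUnit (S.wronski φ))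
    {M : Module.End 𝕜 R} (hM : S.IsMonic r M) (h : ∀ j, M (φ j) = 0) (f : R) :
    M f = 0 ↔ ∃ c : Fin r → R, (∀ i, S.D (c i) = 0) ∧ f = ∑ i, φ i * c i := by
  obtain ⟨M', ⟨b, hb, rfl⟩, rfl⟩ := hM
  have hexp : ∀ g, (S.D ^ r + ∑ k ∈ Finset.range r, LinearMap.mulLeft 𝕜 (b k) * S.D ^ k) g = 0 →
      (S.D ^ r) g = -∑ i : Fin r, b i * (S.D ^ (i : ℕ)) g := by
    intro g hg
    rw [eq_neg_iff_add_eq_zero]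
    simpa [Finset.sum_range] using hg
  constructor
  · intro hf
    obtain ⟨A, hA⟩ := hφ
    -- Variation of constants: `c` matches `f` and its first `r - 1` derivatives with those of the
    -- `φ j`.
    set c : Fin r → R := Matrix.mulVec (↑A⁻¹ : Matrix (Fin r) (Fin r) R)
      fun i => (S.D ^ (i : ℕ)) f with hc
    have h1 : ∀ i < r, (S.D ^ i) f = ∑ j, (S.D ^ i) (φ j) * c j := by
      intro i hi
      have h2 : Matrix.mulVec (S.wronski φ) c = fun i : Fin r => (S.D ^ (i : ℕ)) f := by
        rw [hc, Matrix.mulVec_mulVec, ← hA]; simp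
      exact (congrFun h2 ⟨i, hi⟩).symm
    -- The case `i = r` follows because `M` expresses `D^r` of `f` and of each `φ j` through lower
    -- derivatives in the same way.
    have h2 : ∀ i ≤ r, (S.D ^ i) f = ∑ j, (S.D ^ i) (φ j) * c j := by
      intro i hi
      rcases hi.lt_or_eq with hi | rfl
      · exact h1 i hi
      · rw [hexp f hf]
        simp_rw [fun j => hexp (φ j) (h j), neg_mul, Finset.sum_mul, Finset.sum_neg_distrib]
        rw [Finset.sum_comm]
        congr 1
        refine Finset.sum_congr rfl fun k _ => ?_
        rw [h1 k k.2, Finset.mul_sum]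
        simp_rw [mul_assoc]
    refine ⟨c, fun i => ?_, by simpa using h2 0 (by omega)⟩
    -- Differentiate relation `i` and compare with relation `i + 1`; a final `P` undoes the twist
    -- that the Leibniz rule puts on `D^i φ j`.
    have h3 : Matrix.mulVec (S.wronski φ) (fun j => S.P (S.D (c j))) = 0 := by
      funext i
      have h4 := h2 (i + 1) i.2
      rw [pow_succ', Module.End.mul_apply, h1 i i.2, map_sum] at h4
      simp only [S.leibniz, Finset.sum_add_distrib, Module.End.mul_apply] at h4
      have h5 := congrArg S.P (add_eq_left.1 h4)
      simpa [map_sum, S.P_P, Matrix.mulVec, dotProduct, wronski] using h5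
    have h4 : (fun j => S.P (S.D (c j))) = 0 := by
      have := congrArg (fun v => Matrix.mulVec (↑A⁻¹ : Matrix (Fin r) (Fin r) R) v) h3
      simpa [Matrix.mulVec_mulVec, ← hA] using this
    have h5 := congrArg S.P (congrFun h4 i)
    simpa [S.P_P] using h5
  · rintro ⟨c, hc, rfl⟩
    rw [map_sum]
    refine Finset.sum_eq_zero fun j _ => ?_
    have h6 := h j
    simp only [LinearMap.add_apply, LinearMap.sum_apply, Module.End.mul_apply,
      LinearMap.mulLeft_apply] at h6 ⊢
    simp_rw [S.D_pow_mul_const (hc j), ← mul_assoc]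
    rw [← Finset.sum_mul, ← add_mul, h6, zero_mul]

theorem wronski_sum_mul_const {n : ℕ} (φ : Fin n → R) (C : Matrix (Fin n) (Fin n) R)
    (hC : ∀ i j, S.D (C i j) = 0) :
    S.wronski (fun j => ∑ i, φ i * C i j) = S.wronski φ * C := by
  ext a b
  simp only [wronski, Matrix.of_apply, map_sum, Matrix.mul_apply]
  exact Finset.sum_congr rfl fun i _ => S.D_pow_mul_const (hC i b) _ _

theorem const_independent_of_isUnit_wronski {n : ℕ} {φ : Fin n → R}
    (hφ : IsUnit (S.wronski φ)) {c : Fin n → R} (hc : ∀ i, S.D (c i) = 0)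
    (h : ∑ i, φ i * c i = 0) : c = 0 := by
  obtain ⟨A, hA⟩ := hφ
  have h1 : Matrix.mulVec (S.wronski φ) c = 0 := by
    funext i
    have := congrArg (S.D ^ (i : ℕ)) h
    simpa [map_sum, S.D_pow_mul_const (hc _), Matrix.mulVec, dotProduct, wronski] using this
  have := congrArg (fun v => Matrix.mulVec (↑A⁻¹ : Matrix (Fin n) (Fin n) R) v) h1
  simpa [Matrix.mulVec_mulVec, ← hA] using this

/-- Invertibility of the Wroński matrix passes to every basis of the same space. -/
theorem isUnit_wronski_of_span {n : ℕ} {φ ψ : Fin n → R} (hφ : IsUnit (S.wronski φ))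
    (h : ∀ j, ∃ c : Fin n → R, (∀ i, S.D (c i) = 0) ∧ ψ j = ∑ i, φ i * c i)
    (h' : ∀ j, ∃ c : Fin n → R, (∀ i, S.D (c i) = 0) ∧ φ j = ∑ i, ψ i * c i)
    (hind : ∀ c : Fin n → R, (∀ i, S.D (c i) = 0) → ∑ i, ψ i * c i = 0 → c = 0) :
    IsUnit (S.wronski ψ) := by
  choose c hc hψ using h
  choose d hd hφ' using h'
  set C : Matrix (Fin n) (Fin n) R := Matrix.of fun i j => c j i with hC
  set E : Matrix (Fin n) (Fin n) R := Matrix.of fun i j => d j i with hE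
  have e1 : S.wronski ψ = S.wronski φ * C := by
    rw [← wronski_sum_mul_const φ C fun i j => hc j i]
    exact congrArg S.wronski (funext hψ)
  have e2 : S.wronski φ = S.wronski ψ * E := by
    rw [← wronski_sum_mul_const ψ E fun i j => hd j i]
    exact congrArg S.wronski (funext hφ')
  have e3 : C * E = 1 := by
    have : S.wronski φ * (C * E) = S.wronski φ * 1 := by
      rw [← mul_assoc, ← e1, ← e2, mul_one]
    exact hφ.mul_left_cancel this
  -- Over a noncommutative ring a right inverse need not be a left one. Here the columns of `E * C -
  -- 1` are constant relations between the `ψ i`, hence zero.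
  have e4 : E * C = 1 := by
    have hDEC : ∀ i j, S.D ((E * C) i j) = 0 := by
      intro i j
      rw [Matrix.mul_apply, map_sum]
      refine Finset.sum_eq_zero fun k _ => ?_
      rw [S.leibniz, show S.D (E i k) = 0 from hd k i, show S.D (C k j) = 0 from hc j k]
      simp
    have hD1 : ∀ i j, S.D ((1 : Matrix (Fin n) (Fin n) R) i j) = 0 := by
      intro i j
      have hone : S.D (1 : R) = 0 := by
        have := S.leibniz 1 1
        simpa using this
      rw [Matrix.one_apply]; split_ifs <;> simp [hone]
    ext i j
    have hz := hind (fun i => (E * C) i j - (1 : Matrix (Fin n) (Fin n) R) i j)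
      (fun i => by rw [map_sub, hDEC, hD1, sub_zero]) ?_
    · exact sub_eq_zero.1 (congrFun hz i)
    · simp only [mul_sub, Finset.sum_sub_distrib]
      rw [sub_eq_zero]
      have h1 : ∑ i, ψ i * (E * C) i j = ψ j := by
        rw [hψ j]
        simp_rw [Matrix.mul_apply, Finset.mul_sum, hφ', Finset.sum_mul]
        rw [Finset.sum_comm]
        simp [hC, hE, mul_assoc]
      rw [h1]
      simp [Matrix.one_apply]
  rw [e1]
  exact hφ.mul (isUnit_iff_exists.2 ⟨E, e3, e4⟩)

/-- If invertible Wroński matrices of all sizes exist, a differential operator is determined by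
its product with a monic operator. -/
theorem IsMonic.eq_zero_of_mul_eq_zero
    (hW : ∀ n : ℕ, ∃ φ : Fin n → R, IsUnit (S.wronski φ))
    {r t n : ℕ} {M N : Module.End 𝕜 R} (hM : S.IsMonic r M) (hN : N ∈ S.Op t n)
    (h : N * M = 0) : N = 0 := by
  induction n generalizing N with
  | zero =>
    obtain ⟨c, hc, rfl⟩ := hN
    simp
  | succ n ih =>
    obtain ⟨c, hc, rfl⟩ := hN
    have hN' : ∑ k ∈ Finset.range n, LinearMap.mulLeft 𝕜 (c k) * S.D ^ k ∈ S.Op t n := ⟨c, hc, rfl⟩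
    suffices hcn : c n = 0 by
      have hs : ∑ k ∈ Finset.range (n + 1), LinearMap.mulLeft 𝕜 (c k) * S.D ^ k
          = ∑ k ∈ Finset.range n, LinearMap.mulLeft 𝕜 (c k) * S.D ^ k := by
        rw [Finset.sum_range_succ, hcn]; simp
      rw [hs] at h ⊢
      exact ih hN' h
    have hMm : M ∈ S.Op r (r + 1) := by
      obtain ⟨M', hM', rfl⟩ := hM
      refine add_mem ?_ (Op_mono (by omega) rfl hM')
      have := mulLeft_mul_D_pow_mem_Op (S := S) (t := r) (n := r + 1) (k := r) (c := 1)
        (HasPar.one.congr (by omega)) (by omega)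
      rwa [LinearMap.mulLeft_one, ← Module.End.one_eq_id, one_mul] at this
    have h1 := mul_mem_Op hN' hMm
    have h2 := mulLeft_mul_mem_Op (hM.D_pow_mul_sub_mem n) (hc n)
    -- `e` holds the coefficients of what `N * M` contains besides `c n D^(n+r)`.
    obtain ⟨e, he, heq⟩ := add_mem (Op_mono (t' := t + r) (n' := n + r) le_rfl rfl h1)
      (Op_mono (t' := t + r) (n' := n + r) (by omega) (by omega) h2)
    -- An invertible Wroński matrix of this size lets one read off the top coefficient of the zero
    -- operator `N * M`.
    obtain ⟨φ, hφ⟩ := hW (n + r + 1)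
    have h3 := coeff_eq_zero_of_isUnit_wronski hφ (c := fun k => if k = n + r then c n else e k)
      (fun j => ?_) (n + r) (by omega)
    · simpa using h3
    · have h4 : ∑ k ∈ Finset.range (n + r + 1),
          LinearMap.mulLeft 𝕜 (if k = n + r then c n else e k) * S.D ^ k = 0 := by
        rw [Finset.sum_range_succ, if_pos rfl, ← h, Finset.sum_range_succ, add_mul]
        have h5 : ∑ k ∈ Finset.range (n + r),
            LinearMap.mulLeft 𝕜 (if k = n + r then c n else e k) * S.D ^ k
            = ∑ k ∈ Finset.range (n + r), LinearMap.mulLeft 𝕜 (e k) * S.D ^ k := by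
          refine Finset.sum_congr rfl fun k hk => ?_
          rw [if_neg (Finset.mem_range.1 hk).ne]
        rw [h5, ← heq, mul_sub, add_comm r n, mul_assoc]
        abel
      exact congrArg (fun T : Module.End 𝕜 R => T (φ j)) h4

/-- Intertwining operators from invariance of the kernel. -/
theorem IsMonic.exists_intertwining {r m : ℕ} {φ : Fin r → R} (hφ : IsUnit (S.wronski φ))
    {M L : Module.End 𝕜 R} {a : R} (hM : S.IsMonic r M) (h : ∀ j, M (φ j) = 0)
    (ha : S.HasPar 0 a) (hL : S.IsNondegenerate a m L) (hinv : ∀ j, M (L (φ j)) = 0) :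
    ∃ L₁, S.IsNondegenerate a m L₁ ∧ M * L = L₁ * M := by
  obtain ⟨Q, hQ, hR⟩ := hM.exists_div m m (hM.mul_sub_mem ha hL)
  refine ⟨_, ⟨Q, hQ, rfl⟩, ?_⟩
  have := eq_zero_of_isUnit_wronski hφ hR fun j => by simp [h, hinv]
  rw [sub_sub, sub_eq_zero] at this
  rw [this, add_mul]

end OddDerivation
/-! ### Linear differential equations depending smoothly on parameters -/

section LinearODE

set_option linter.unusedSectionVars false

open Set

variable {Y E F : Type} [NormedAddCommGroup Y] [NormedSpace ℝ Y] [NormedAddCommGroup E]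
  [NormedSpace ℝ E] [NormedAddCommGroup F] [NormedSpace ℝ F]

open Classical in
/-- The path `τ ↦ B (τ, y)`, `0 ≤ τ ≤ 1`, when it is continuous. -/
def slice (B : ℝ × Y → E) (y : Y) : C(Icc (0 : ℝ) 1, E) :=
  if h : Continuous fun τ : Icc (0 : ℝ) 1 => B (τ, y) then ⟨_, h⟩ else 0

theorem slice_apply {B : ℝ × Y → E} {O : Set Y} (hB : ContinuousOn B (Icc (0 : ℝ) 1 ×ˢ O)) {y : Y}
    (hy : y ∈ O) (τ : Icc (0 : ℝ) 1) : slice B y τ = B (τ, y) := by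
  have h : Continuous fun τ : Icc (0 : ℝ) 1 => B (τ, y) :=
    hB.comp_continuous (by fun_prop) fun τ => ⟨τ.2, hy⟩
  simp [slice, h]

theorem continuousOn_slice {B : ℝ × Y → E} {O : Set Y}
    (hB : ContinuousOn B (Icc (0 : ℝ) 1 ×ˢ O)) : ContinuousOn (slice B) O := by
  rw [continuousOn_iff_continuous_domRestrict]
  let g : C(O × Icc (0 : ℝ) 1, E) :=
    ⟨fun z => B (z.2, z.1), hB.comp_continuous (by fun_prop) fun z => ⟨z.2.2, z.1.2⟩⟩
  convert g.curry.continuous using 1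
  funext y
  ext τ
  exact slice_apply hB y.2 τ

/-- Pointwise application of a path of linear maps to a path of vectors. -/
def pathApply : C(Icc (0 : ℝ) 1, E →L[ℝ] F) →L[ℝ] C(Icc (0 : ℝ) 1, E) →L[ℝ] C(Icc (0 : ℝ) 1, F) :=
  LinearMap.mkContinuous₂ (E := C(Icc (0 : ℝ) 1, E →L[ℝ] F)) (F := C(Icc (0 : ℝ) 1, E))
    (G := C(Icc (0 : ℝ) 1, F))
    (LinearMap.mk₂ ℝ (fun K g => (⟨fun τ => K τ (g τ), by fun_prop⟩ : C(Icc (0 : ℝ) 1, F)))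
      (fun _ _ _ => by ext; simp) (fun _ _ _ => by ext; simp) (fun _ _ _ => by ext; simp)
      (fun _ _ _ => by ext; simp)) 1
    fun K g => by
      rw [ContinuousMap.norm_le _ (by positivity)]
      intro τ
      rw [one_mul]
      exact (K τ).le_of_opNorm_le_of_le (K.norm_coe_le_norm τ) (g.norm_coe_le_norm τ)

@[simp] theorem pathApply_apply (K : C(Icc (0 : ℝ) 1, E →L[ℝ] F)) (g : C(Icc (0 : ℝ) 1, E))
    (τ : Icc (0 : ℝ) 1) : pathApply K g τ = K τ (g τ) := rfl

/-- A path of linear maps as a linear map into paths. -/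
def pathFlip : C(Icc (0 : ℝ) 1, E →L[ℝ] F) →L[ℝ] E →L[ℝ] C(Icc (0 : ℝ) 1, F) :=
  LinearMap.mkContinuous₂ (E := C(Icc (0 : ℝ) 1, E →L[ℝ] F)) (F := E) (G := C(Icc (0 : ℝ) 1, F))
    (LinearMap.mk₂ ℝ (fun K v => (⟨fun τ => K τ v, by fun_prop⟩ : C(Icc (0 : ℝ) 1, F)))
      (fun _ _ _ => by ext; simp) (fun _ _ _ => by ext; simp) (fun _ _ _ => by ext; simp)
      (fun _ _ _ => by ext; simp)) 1
    fun K v => by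
      rw [ContinuousMap.norm_le _ (by positivity)]
      intro τ
      rw [one_mul]
      exact (K τ).le_of_opNorm_le (K.norm_coe_le_norm τ) v

@[simp] theorem pathFlip_apply (K : C(Icc (0 : ℝ) 1, E →L[ℝ] F)) (v : E)
    (τ : Icc (0 : ℝ) 1) : pathFlip K v τ = K τ v := rfl

/-- Continuity of `slice B'` in the supremum norm bounds the variation of `B'` near `y` for all `τ`
at once; the mean value inequality then gives an error estimate uniform in `τ`. -/
theorem hasFDerivAt_slice {B : ℝ × Y → E} {B' : ℝ × Y → Y →L[ℝ] E} {O : Set Y} (hO : IsOpen O)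
    (hB : ContinuousOn B (Icc (0 : ℝ) 1 ×ˢ O)) (hB' : ContinuousOn B' (Icc (0 : ℝ) 1 ×ˢ O))
    (hd : ∀ τ ∈ Icc (0 : ℝ) 1, ∀ y ∈ O, HasFDerivAt (fun y => B (τ, y)) (B' (τ, y)) y) {y : Y}
    (hy : y ∈ O) : HasFDerivAt (slice B) (pathFlip (slice B' y)) y := by
  rw [hasFDerivAt_iff_isLittleO, Asymptotics.isLittleO_iff]
  intro ε hε
  have hc : ContinuousAt (slice B') y := (continuousOn_slice hB').continuousAt (hO.mem_nhds hy)
  obtain ⟨δ, hδ, hball⟩ := Metric.eventually_nhds_iff_ball.1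
    ((Metric.continuousAt_iff'.1 hc ε hε).and (hO.mem_nhds hy))
  filter_upwards [Metric.ball_mem_nhds y hδ] with z hz
  rw [ContinuousMap.norm_le _ (by positivity)]
  intro τ
  have h := Convex.norm_image_sub_le_of_norm_hasFDerivWithin_le' (𝕜 := ℝ)
    (f := fun y => B (τ, y)) (f' := fun y => B' (τ, y)) (φ := B' (τ, y)) (C := ε)
    (s := Metric.ball y δ) (x := y) (y := z)
    (fun w hw => (hd τ τ.2 w (hball w hw).2).hasFDerivWithinAt) (fun w hw => ?_)
    (convex_ball y δ) (Metric.mem_ball_self hδ) hz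
  · simpa [slice_apply hB hy, slice_apply hB (hball z hz).2, slice_apply hB' hy] using h
  · have h1 := (ContinuousMap.dist_apply_le_dist (f := slice B' w) (g := slice B' y) τ).trans
      (hball w hw).1.le
    rwa [slice_apply hB' hy, slice_apply hB' (hball w hw).2, dist_eq_norm] at h1

/-- The derivative of a slice is, through `pathFlip`, the slice of the partial derivative. The
induction must vary the target space, since that derivative takes values in linear maps. -/
theorem contDiffOn_slice {B : ℝ × Y → E} {Ω : Set (ℝ × Y)} {O : Set Y} (hΩ : IsOpen Ω)
    (hO : IsOpen O) (hsub : Icc (0 : ℝ) 1 ×ˢ O ⊆ Ω) (hB : ContDiffOn ℝ ∞ B Ω) :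
    ContDiffOn ℝ ∞ (slice B) O := by
  rw [contDiffOn_infty]
  intro n
  induction n generalizing E with
  | zero => exact contDiffOn_zero.2 (continuousOn_slice (hB.continuousOn.mono hsub))
  | succ n ih =>
    let B' : ℝ × Y → Y →L[ℝ] E := fun z => (fderiv ℝ B z).comp (ContinuousLinearMap.inr ℝ ℝ Y)
    have hB' : ContDiffOn ℝ ∞ B' Ω :=
      (hB.fderiv_of_isOpen hΩ (m := ∞) le_rfl).clm_comp contDiffOn_const
    push_cast
    rw [contDiffOn_succ_iff_hasFDerivWithinAt_of_uniqueDiffOn hO.uniqueDiffOn]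
    refine ⟨by simp, fun y => pathFlip (slice B' y), ?_, fun y hy => ?_⟩
    · exact (ContinuousLinearMap.contDiff (F := Y →L[ℝ] C(Icc (0 : ℝ) 1, E)) pathFlip).comp_contDiffOn
        (ih hB')
    · refine (hasFDerivAt_slice hO (hB.continuousOn.mono hsub) (hB'.continuousOn.mono hsub)
        (fun τ hτ y hy => ?_) hy).hasFDerivWithinAt
      have h1 : HasFDerivAt B (fderiv ℝ B (τ, y)) (τ, y) :=
        ((hB.contDiffAt (hΩ.mem_nhds (hsub ⟨hτ, hy⟩))).differentiableAt (by simp)).hasFDerivAt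
      exact h1.comp y (hasFDerivAt_prodMk_right τ y)

variable [CompleteSpace E]

theorem continuous_IccExtend (g : C(Icc (0 : ℝ) 1, E)) :
    Continuous (IccExtend (zero_le_one' ℝ) g) :=
  g.continuous.Icc_extend'

/-- Integration of paths from `0`. -/
def pathIntegral : C(Icc (0 : ℝ) 1, E) →L[ℝ] C(Icc (0 : ℝ) 1, E) :=
  LinearMap.mkContinuous
    { toFun := fun g => ⟨fun τ => ∫ σ in (0 : ℝ)..τ, IccExtend (zero_le_one' ℝ) g σ,
        (intervalIntegral.continuous_primitive
          (fun a b => (continuous_IccExtend g).intervalIntegrable a b) 0).comp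
          continuous_subtype_val⟩
      map_add' := fun g h => by
        ext τ
        exact intervalIntegral.integral_add ((continuous_IccExtend g).intervalIntegrable _ _)
          ((continuous_IccExtend h).intervalIntegrable _ _)
      map_smul' := fun c g => by
        ext τ
        exact intervalIntegral.integral_smul c _ } 1
    fun g => by
      rw [ContinuousMap.norm_le _ (by positivity)]
      intro τ
      refine (intervalIntegral.norm_integral_le_of_norm_le_const (C := ‖g‖)
        fun σ _ => g.norm_coe_le_norm _).trans ?_
      rw [sub_zero, abs_of_nonneg τ.2.1, one_mul]
      exact mul_le_of_le_one_right (norm_nonneg _) τ.2.2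

theorem pathIntegral_apply (g : C(Icc (0 : ℝ) 1, E)) (τ : Icc (0 : ℝ) 1) :
    pathIntegral g τ = ∫ σ in (0 : ℝ)..τ, IccExtend (zero_le_one' ℝ) g σ := rfl

/-- The Volterra operator `g ↦ ∫₀ K g`. -/
def volterra : C(Icc (0 : ℝ) 1, E →L[ℝ] E) →L[ℝ] C(Icc (0 : ℝ) 1, E) →L[ℝ] C(Icc (0 : ℝ) 1, E) :=
  (ContinuousLinearMap.compL ℝ _ _ _ pathIntegral).comp pathApply

theorem volterra_apply (K : C(Icc (0 : ℝ) 1, E →L[ℝ] E)) (g : C(Icc (0 : ℝ) 1, E)) :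
    volterra K g = pathIntegral (pathApply K g) := rfl

/-- Each further integration of `τ^n` contributes a factor `1 / (n + 1)`, which accumulates to the
factorial. -/
theorem norm_volterra_pow_apply_le (K : C(Icc (0 : ℝ) 1, E →L[ℝ] E)) (g : C(Icc (0 : ℝ) 1, E))
    (n : ℕ) (τ : Icc (0 : ℝ) 1) :
    ‖((volterra K) ^ n) g τ‖ ≤ ‖K‖ ^ n * ‖g‖ / n.factorial * (τ : ℝ) ^ n := by
  induction n generalizing τ with
  | zero => simpa using g.norm_coe_le_norm τ
  | succ n ih =>
    rw [pow_succ', mul_apply_eq_comp, volterra_apply, pathIntegral_apply]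
    refine (intervalIntegral.norm_integral_le_of_norm_le τ.2.1
      (g := fun σ => ‖K‖ * (‖K‖ ^ n * ‖g‖ / n.factorial * σ ^ n))
      (Filter.Eventually.of_forall fun σ hσ => ?_)
      ((by fun_prop : Continuous _).intervalIntegrable _ _)).trans (le_of_eq ?_)
    · have hσ' : σ ∈ Icc (0 : ℝ) 1 := ⟨hσ.1.le, hσ.2.trans τ.2.2⟩
      rw [IccExtend_of_mem _ _ hσ', pathApply_apply]
      exact (K ⟨σ, hσ'⟩).le_of_opNorm_le_of_le (K.norm_coe_le_norm _) (ih ⟨σ, hσ'⟩)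
    · simp only [intervalIntegral.integral_const_mul, integral_pow]
      rw [Nat.factorial_succ]
      push_cast
      field_simp
      simp
      ring

/-- Factorials beat powers, so some power `V^n` has norm less than `1`. Then `1 - V^n` is
invertible, and `1 - V` is one of its commuting factors. No smallness of `K` is required, which
makes the solutions global. -/
theorem isUnit_one_sub_volterra (K : C(Icc (0 : ℝ) 1, E →L[ℝ] E)) : IsUnit (1 - volterra K) := by
  have hn : ∀ n : ℕ, ‖(volterra K) ^ n‖ ≤ ‖K‖ ^ n / n.factorial := by
    intro n
    refine ContinuousLinearMap.opNorm_le_bound _ (by positivity) fun g => ?_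
    rw [ContinuousMap.norm_le _ (by positivity)]
    intro τ
    refine (norm_volterra_pow_apply_le K g n τ).trans ?_
    exact (mul_le_of_le_one_right (by positivity) (pow_le_one₀ τ.2.1 τ.2.2)).trans_eq (by ring)
  obtain ⟨n, h⟩ := ((FloorSemiring.tendsto_pow_div_factorial_atTop ‖K‖).eventually
    (gt_mem_nhds zero_lt_one)).exists
  have h1 : IsUnit (1 - (volterra K) ^ n) :=
    isUnit_one_sub_of_norm_lt_one (R := C(Icc (0 : ℝ) 1, E) →L[ℝ] C(Icc (0 : ℝ) 1, E))
      ((hn n).trans_lt h)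
  rw [← mul_neg_geom_sum] at h1
  refine ((Commute.isUnit_mul_iff ?_).1 h1).1
  exact (mul_neg_geom_sum _ n).trans (geom_sum_mul_neg _ n).symm

/-- The solution of `g = v + ∫₀ K g`. -/
def volterraSol (K : C(Icc (0 : ℝ) 1, E →L[ℝ] E)) (v : E) : C(Icc (0 : ℝ) 1, E) :=
  Ring.inverse (1 - volterra K) (ContinuousMap.const _ v)

theorem volterraSol_eq (K : C(Icc (0 : ℝ) 1, E →L[ℝ] E)) (v : E) (τ : Icc (0 : ℝ) 1) :
    volterraSol K v τ = v + ∫ σ in (0 : ℝ)..τ,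
      IccExtend (zero_le_one' ℝ) (pathApply K (volterraSol K v)) σ := by
  have h := Ring.mul_inverse_cancel _ (isUnit_one_sub_volterra K)
  have h1 : (1 - volterra K) (volterraSol K v) = ContinuousMap.const _ v :=
    congrArg (fun T : C(Icc (0 : ℝ) 1, E) →L[ℝ] C(Icc (0 : ℝ) 1, E) =>
      T (ContinuousMap.const _ v)) h
  have h2 : volterraSol K v - volterra K (volterraSol K v) = ContinuousMap.const _ v := h1
  exact congrArg (fun g : C(Icc (0 : ℝ) 1, E) => g τ) (sub_eq_iff_eq_add.1 h2)

theorem eq_volterraSol {K : C(Icc (0 : ℝ) 1, E →L[ℝ] E)} {v : E} {g : C(Icc (0 : ℝ) 1, E)}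
    (hg : ∀ τ : Icc (0 : ℝ) 1, g τ = v + ∫ σ in (0 : ℝ)..τ,
      IccExtend (zero_le_one' ℝ) (pathApply K g) σ) : g = volterraSol K v := by
  have h := Ring.inverse_mul_cancel _ (isUnit_one_sub_volterra K)
  have h1 : (1 - volterra K) g = ContinuousMap.const _ v := by
    change g - volterra K g = _
    rw [sub_eq_iff_eq_add]
    ext τ
    exact hg τ
  have h2 := congrArg (fun T : C(Icc (0 : ℝ) 1, E) →L[ℝ] C(Icc (0 : ℝ) 1, E) => T g) h
  have h3 : Ring.inverse (1 - volterra K) ((1 - volterra K) g) = g := h2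
  rw [← h3, h1]
  rfl

/-- Inversion in a Banach algebra is smooth at units, and `volterra` is linear and continuous. -/
theorem contDiffOn_volterraSol {O : Set Y} {K : Y → C(Icc (0 : ℝ) 1, E →L[ℝ] E)}
    (hK : ContDiffOn ℝ ∞ K O) (v : E) : ContDiffOn ℝ ∞ (fun y => volterraSol (K y) v) O := by
  intro y hy
  obtain ⟨T, hT⟩ := isUnit_one_sub_volterra (K y)
  have hV : ContDiff ℝ ∞ fun K : C(Icc (0 : ℝ) 1, E →L[ℝ] E) => volterra K :=
    by fun_prop
  have h1 : ContDiffWithinAt ℝ ∞ (fun y => 1 - volterra (K y)) O y :=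
    contDiffWithinAt_const.sub (hV.contDiffAt.comp_contDiffWithinAt y (hK y hy))
  have h2 : ContDiffAt ℝ ∞ Ring.inverse (1 - volterra (K y)) :=
    hT ▸ contDiffAt_ringInverse ℝ (R := C(Icc (0 : ℝ) 1, E) →L[ℝ] C(Icc (0 : ℝ) 1, E)) T
  exact (h2.comp_contDiffWithinAt y h1).clm_apply contDiffWithinAt_const

/-- Existence for linear equations `∂F/∂x = A F`, smoothly in the parameters. -/
theorem exists_linearODE_solution {J : Set ℝ} {U : Set Y} (hJ : IsOpen J) (hJc : J.OrdConnected)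
    (hU : IsOpen U) {A : ℝ × Y → E →L[ℝ] E} (hA : ContDiffOn ℝ ∞ A (J ×ˢ U)) {x₀ : ℝ}
    (hx₀ : x₀ ∈ J) (v : E) :
    ∃ F : ℝ × Y → E, ContDiffOn ℝ ∞ F (J ×ˢ U) ∧ (∀ u ∈ U, F (x₀, u) = v) ∧
      ∀ z ∈ J ×ˢ U, fderiv ℝ F z (1, 0) = A z (F z) := by
  have hO : IsOpen (J ×ˢ U) := hJ.prod hU
  -- The segment from `x₀` to `x` is rescaled to `[0, 1]`, so that `x` too becomes a parameter and
  -- all equations live in one Banach space.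
  let γ : ℝ × (ℝ × Y) → ℝ × Y := fun w => (x₀ + w.1 * (w.2.1 - x₀), w.2.2)
  have hγ : ContDiff ℝ ∞ γ := by fun_prop
  let B : ℝ × (ℝ × Y) → E →L[ℝ] E := fun w => (w.2.1 - x₀) • A (γ w)
  have hmem : ∀ τ ∈ Icc (0 : ℝ) 1, ∀ y ∈ J ×ˢ U, γ (τ, y) ∈ J ×ˢ U := fun τ hτ y hy =>
    ⟨hJc.convex.add_smul_sub_mem hx₀ hy.1 hτ, hy.2⟩
  have hsub : Icc (0 : ℝ) 1 ×ˢ (J ×ˢ U) ⊆ γ ⁻¹' (J ×ˢ U) := fun w hw => hmem w.1 hw.1 w.2 hw.2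
  have hB : ContDiffOn ℝ ∞ B (γ ⁻¹' (J ×ˢ U)) :=
    ContDiffOn.smul (f := fun w : ℝ × (ℝ × Y) => w.2.1 - x₀) (by fun_prop)
      (hA.comp hγ.contDiffOn fun w hw => hw)
  have hBc : ContinuousOn B (Icc (0 : ℝ) 1 ×ˢ (J ×ˢ U)) := hB.continuousOn.mono hsub
  let G : ℝ × Y → C(Icc (0 : ℝ) 1, E) := fun y => volterraSol (slice B y) v
  have hG : ContDiffOn ℝ ∞ G (J ×ˢ U) :=
    contDiffOn_volterraSol (contDiffOn_slice (hO.preimage hγ.continuous) hO hsub hB) v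
  let F : ℝ × Y → E := fun y => G y ⟨1, by simp⟩
  have hF : ContDiffOn ℝ ∞ F (J ×ˢ U) :=
    (ContinuousLinearMap.contDiff (E := C(Icc (0 : ℝ) 1, E))
      (ContinuousMap.evalCLM ℝ (⟨1, by simp⟩ : Icc (0 : ℝ) 1))).comp_contDiffOn hG
  -- The path for an intermediate point is a reparametrized initial piece of the path for `y`, by
  -- uniqueness for the Volterra equation.
  have hscale : ∀ y ∈ J ×ˢ U, ∀ τ : Icc (0 : ℝ) 1, F (γ (τ, y)) = G y τ := by
    intro y hy τ
    have hy' := hmem τ τ.2 y hy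
    let m : Icc (0 : ℝ) 1 → Icc (0 : ℝ) 1 := fun σ =>
      ⟨τ * σ, mul_nonneg τ.2.1 σ.2.1, mul_le_one₀ τ.2.2 σ.2.1 σ.2.2⟩
    have hm : Continuous m := by fun_prop
    have hg : (⟨G y ∘ m, (G y).continuous.comp hm⟩ : C(Icc (0 : ℝ) 1, E)) = G (γ (τ, y)) := by
      refine eq_volterraSol fun σ => ?_
      refine (volterraSol_eq (slice B y) v (m σ)).trans ?_
      congr 1
      have h1 := intervalIntegral.smul_integral_comp_mul_left (a := 0) (b := σ)
        (IccExtend (zero_le_one' ℝ) (pathApply (slice B y) (G y))) (τ : ℝ)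
      rw [mul_zero] at h1
      refine h1.symm.trans ?_
      rw [← intervalIntegral.integral_smul]
      refine intervalIntegral.integral_congr fun ρ hρ => ?_
      rw [uIcc_of_le σ.2.1] at hρ
      have hρ' : ρ ∈ Icc (0 : ℝ) 1 := ⟨hρ.1, hρ.2.trans σ.2.2⟩
      have hτρ : (τ : ℝ) * ρ ∈ Icc (0 : ℝ) 1 := (m ⟨ρ, hρ'⟩).2
      rw [IccExtend_of_mem _ _ hρ', IccExtend_of_mem _ _ hτρ, pathApply_apply, pathApply_apply,
        slice_apply hBc hy, slice_apply hBc hy']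
      have h2 : B (ρ, γ (τ, y)) = (τ : ℝ) • B (τ * ρ, y) := by
        simp only [B, γ, smul_smul]
        congr 2
        · ring
        · ext <;> simp; ring
      rw [h2]
      rfl
    have h3 := congrArg (fun g : C(Icc (0 : ℝ) 1, E) => g ⟨1, by simp⟩) hg
    refine h3.symm.trans ?_
    change G y (m _) = G y τ
    congr 1
    ext
    simp [m]
  -- The derivative of `τ ↦ F (γ (τ, z))` at `τ = 1` is computed by the chain rule and by the
  -- integral equation; the common factor `x - x₀` is cancelled.
  have hderiv : ∀ z ∈ J ×ˢ U, z.1 ≠ x₀ → fderiv ℝ F z (1, 0) = A z (F z) := by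
    rintro ⟨x, u⟩ hz hx
    have h1 : HasDerivWithinAt (fun τ : ℝ => F (γ (τ, (x, u))))
        (fderiv ℝ F (x, u) ((x - x₀) • (1, 0))) (Icc 0 1) 1 := by
      have hFd : HasFDerivAt F (fderiv ℝ F (x, u)) (γ (1, (x, u))) := by
        have : γ (1, (x, u)) = (x, u) := by simp [γ]
        rw [this]
        exact ((hF.contDiffAt (hO.mem_nhds hz)).differentiableAt (by simp)).hasFDerivAt
      have hγd : HasDerivAt (fun τ : ℝ => γ (τ, (x, u))) ((x - x₀) • (1, 0)) 1 := by
        have : HasDerivAt (fun τ : ℝ => x₀ + τ * (x - x₀)) (x - x₀) 1 := by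
          simpa using ((hasDerivAt_id (1 : ℝ)).mul_const (x - x₀)).const_add x₀
        simpa using this.prodMk (hasDerivAt_const (1 : ℝ) u)
      exact (hFd.comp_hasDerivAt (1 : ℝ) hγd).hasDerivWithinAt
    have h2 : HasDerivWithinAt (fun τ : ℝ => F (γ (τ, (x, u))))
        ((x - x₀) • A (x, u) (F (x, u))) (Icc 0 1) 1 := by
      have hc := continuous_IccExtend (pathApply (slice B (x, u)) (G (x, u)))
      have h3 := (intervalIntegral.integral_hasDerivAt_right (hc.intervalIntegrable 0 1)
        (hc.stronglyMeasurableAtFilter _ _) hc.continuousAt).const_add v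
      rw [IccExtend_of_mem _ _ (show (1 : ℝ) ∈ Icc (0 : ℝ) 1 by simp), pathApply_apply,
        slice_apply hBc hz] at h3
      have h4 : B (1, (x, u)) = (x - x₀) • A (x, u) := by simp [B, γ]
      rw [h4] at h3
      refine (h3.hasDerivWithinAt (s := Icc 0 1)).congr_of_mem (fun τ hτ => ?_) (by simp)
      exact (hscale _ hz ⟨τ, hτ⟩).trans (volterraSol_eq _ v ⟨τ, hτ⟩)
    have h5 := (uniqueDiffOn_Icc (zero_lt_one' ℝ) 1 (by simp)).eq_deriv _ h1 h2
    rw [map_smul] at h5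
    exact smul_right_injective E (sub_ne_zero.2 hx) h5
  refine ⟨F, hF, fun u hu => ?_, fun z hz => ?_⟩
  · have h1 := hscale (x₀, u) ⟨hx₀, hu⟩ ⟨0, by simp⟩
    have h2 : γ (0, (x₀, u)) = (x₀, u) := by simp [γ]
    refine (congrArg F h2.symm).trans (h1.trans ((volterraSol_eq _ v _).trans ?_))
    simp
  -- At `x = x₀` there is nothing to cancel; the equation follows by continuity from nearby points
  -- with the same parameters.
  · by_cases hx : z.1 = x₀
    · obtain ⟨x, u⟩ := z
      obtain rfl : x = x₀ := hx
      have hzO := hO.mem_nhds hz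
      have c1 : ContinuousAt (fun z => fderiv ℝ F z (1, 0)) (x, u) :=
        (((hF.fderiv_of_isOpen hO (m := ∞) le_rfl).continuousOn.continuousAt hzO).clm_apply
          continuousAt_const)
      have c2 : ContinuousAt (fun z => A z (F z)) (x, u) :=
        (hA.continuousOn.continuousAt hzO).clm_apply (hF.continuousOn.continuousAt hzO)
      have c0 : Filter.Tendsto (fun t : ℝ => (t, u)) (nhdsWithin x {x}ᶜ) (nhds (x, u)) :=
        ((by fun_prop : Continuous fun t : ℝ => (t, u)).tendsto x).mono_left nhdsWithin_le_nhds
      refine tendsto_nhds_unique_of_eventuallyEq (c1.tendsto.comp c0) (c2.tendsto.comp c0) ?_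
      filter_upwards [self_mem_nhdsWithin, nhdsWithin_le_nhds (hJ.mem_nhds hz.1)] with t ht htJ
      exact hderiv (t, u) ⟨htJ, hz.2⟩ ht
    · exact hderiv z hz hx

/-- Uniqueness for linear equations `∂F/∂x = A F`. -/
theorem linearODE_unique {J : Set ℝ} {U : Set Y} (hJ : IsOpen J) (hJc : J.OrdConnected)
    (hU : IsOpen U) {A : ℝ × Y → E →L[ℝ] E} (hA : ContinuousOn A (J ×ˢ U)) {x₀ : ℝ}
    (hx₀ : x₀ ∈ J) {F : ℝ × Y → E} (hF : DifferentiableOn ℝ F (J ×ˢ U))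
    (hFA : ∀ z ∈ J ×ˢ U, fderiv ℝ F z (1, 0) = A z (F z)) (h0 : ∀ u ∈ U, F (x₀, u) = 0) :
    ∀ z ∈ J ×ˢ U, F z = 0 := by
  rintro ⟨x, u⟩ ⟨hx, hu⟩
  have hO : IsOpen (J ×ˢ U) := hJ.prod hU
  have hd : ∀ t ∈ J, HasDerivAt (fun t => F (t, u)) (A (t, u) (F (t, u))) t := by
    intro t ht
    have h1 := (hF.differentiableAt (hO.mem_nhds (show (t, u) ∈ J ×ˢ U from ⟨ht, hu⟩))).hasFDerivAt
    have h2 : HasDerivAt (fun t : ℝ => (t, u)) ((1 : ℝ), (0 : Y)) t :=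
      (hasDerivAt_id t).prodMk (hasDerivAt_const t u)
    have h3 := h1.comp_hasDerivAt t h2
    rwa [hFA (t, u) ⟨ht, hu⟩] at h3
  have hd0 : ∀ t : ℝ, HasDerivAt (fun _ : ℝ => (0 : E)) (A (t, u) 0) t := fun t => by
    simpa using hasDerivAt_const t (0 : E)
  have hLip : ∀ a ∈ J, ∀ b ∈ J, ∃ K : NNReal, ∀ t ∈ Icc a b,
      LipschitzOnWith K (fun w => A (t, u) w) univ := by
    intro a ha b hb
    have hc : ContinuousOn (fun t => A (t, u)) (Icc a b) :=
      hA.comp (by fun_prop) fun t ht => ⟨hJc.out ha hb ht, hu⟩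
    obtain ⟨C, hC⟩ := isCompact_Icc.exists_bound_of_continuousOn hc
    refine ⟨C.toNNReal, fun t ht => LipschitzWith.lipschitzOnWith ?_⟩
    refine (A (t, u)).lipschitz.weaken ?_
    rw [← NNReal.coe_le_coe]
    exact (hC t ht).trans (Real.le_coe_toNNReal C)
  rcases le_total x₀ x with hle | hle
  · obtain ⟨K, hK⟩ := hLip x₀ hx₀ x hx
    exact ODE_solution_unique_of_mem_Icc_right (f := fun t => F (t, u)) (g := fun _ => 0)
      (fun t ht => hK t (Ico_subset_Icc_self ht))
      (fun t ht => (hd t (hJc.out hx₀ hx ht)).continuousAt.continuousWithinAt)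
      (fun t ht => (hd t (hJc.out hx₀ hx (Ico_subset_Icc_self ht))).hasDerivWithinAt)
      (fun _ _ => mem_univ _) continuousOn_const (fun t _ => (hd0 t).hasDerivWithinAt)
      (fun _ _ => mem_univ _) (h0 u hu) ⟨hle, le_rfl⟩
  · obtain ⟨K, hK⟩ := hLip x hx x₀ hx₀
    exact ODE_solution_unique_of_mem_Icc_left (f := fun t => F (t, u)) (g := fun _ => 0)
      (fun t ht => hK t (Ioc_subset_Icc_self ht))
      (fun t ht => (hd t (hJc.out hx hx₀ ht)).continuousAt.continuousWithinAt)
      (fun t ht => (hd t (hJc.out hx hx₀ (Ioc_subset_Icc_self ht))).hasDerivWithinAt)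
      (fun _ _ => mem_univ _) continuousOn_const (fun t _ => (hd0 t).hasDerivWithinAt)
      (fun _ _ => mem_univ _) (h0 u hu) ⟨le_rfl, hle⟩

end LinearODE

/-! ### Leibniz determinants -/

theorem ldet_map {A R ι : Type} [CommRing A] [Ring R] [Fintype ι] [LinearOrder ι] (f : A →+* R)
    (B : Matrix ι ι A) : ldet (B.map f) = f B.det := by
  rw [ldet, Matrix.det_apply, map_sum]
  refine Finset.sum_congr rfl fun σ _ => ?_
  rw [Units.smul_def, Units.smul_def, map_zsmul]
  congr 1
  have h1 : ∏ i, B (σ i) i = ((Finset.univ.sort (· ≤ ·)).map fun i : ι => B (σ i) i).prod := by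
    rw [Finset.prod, ← Finset.sort_eq Finset.univ (· ≤ ·), Multiset.map_coe, Multiset.prod_coe]
  rw [h1, map_list_prod, List.map_map]
  rfl

/-- The factor from the last column thus stands rightmost in each ordered product. This matters
because its entries need not commute with the others. -/
theorem sort_univ_eq_append {ι : Type} [Fintype ι] [LinearOrder ι] {t : ι} (ht : ∀ i, i ≤ t) :
    (Finset.univ : Finset ι).sort (· ≤ ·)
      = (Finset.univ.erase t).sort (· ≤ ·) ++ [t] := by
  refine List.Perm.eq_of_pairwise (le := (· ≤ ·)) (fun a b _ _ h h' => le_antisymm h h')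
    (Finset.pairwise_sort _ _) ?_ ?_
  · rw [List.pairwise_append]
    refine ⟨Finset.pairwise_sort _ _, by simp, fun a _ b hb => ?_⟩
    rw [List.mem_singleton.1 hb]; exact ht a
  · rw [← Multiset.coe_eq_coe, Finset.sort_eq, ← Multiset.coe_add, Finset.sort_eq,
      ← Finset.insert_erase (Finset.mem_univ t), Finset.insert_val_of_notMem (by simp)]
    simp [← Multiset.singleton_add, add_comm]

/-- Expansion of the Leibniz determinant along the last column. -/
theorem ldet_eq_sum_updateCol {R ι : Type} [Ring R] [Fintype ι] [LinearOrder ι] {t : ι}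
    (ht : ∀ i, i ≤ t) (A : Matrix ι ι R) :
    ldet A = ∑ i, ldet (A.updateCol t (Pi.single i 1)) * A i t := by
  simp_rw [ldet, Finset.sum_mul]
  rw [Finset.sum_comm]
  refine Finset.sum_congr rfl fun σ _ => ?_
  rw [sort_univ_eq_append ht]
  have h1 : ∀ v : ι → R, (((Finset.univ.erase t).sort (· ≤ ·) ++ [t]).map
      fun i => (A.updateCol t v) (σ i) i).prod
      = (((Finset.univ.erase t).sort (· ≤ ·)).map fun i => A (σ i) i).prod * v (σ t) := by
    intro v
    rw [List.map_append, List.prod_append]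
    congr 1
    · congr 1
      refine List.map_congr_left fun i hi => ?_
      have : i ≠ t := by simpa using hi
      simp [this]
    · simp
  simp_rw [h1]
  rw [Finset.sum_eq_single (σ t)]
  · simp [Units.smul_def, mul_assoc]
  · intro b _ hb
    simp [hb.symm]
  · simp

/-- If the last column is a combination of the others up to a multiple of the last basis vector,
only that multiple contributes to the Leibniz determinant. -/
theorem ldet_eq_mul_of_lastCol {A R ι : Type} [CommRing A] [Ring R] [Fintype ι] [LinearOrder ι]
    (f : A →+* R) {t : ι} (ht : ∀ i, i ≤ t) (X : Matrix ι ι R) (B : Matrix ι ι A)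
    (hB : ∀ i j, j ≠ t → X i j = f (B i j)) {c : ι → R} (hc : c t = 0) {w : R}
    (h : ∀ i, X i t = (X.mulVec c) i + (Pi.single t w : ι → R) i) :
    ldet X = f (B.updateCol t (Pi.single t 1)).det * w := by
  have hX : ∀ v : ι → A, X.updateCol t (fun i => f (v i)) = (B.updateCol t v).map f := by
    intro v
    ext i j
    by_cases hj : j = t
    · subst hj; simp
    · simp [hj, hB]
  have hs : ∀ i, X.updateCol t (Pi.single i 1) = (B.updateCol t (Pi.single i 1)).map f := by
    intro i
    rw [← hX]
    congr 1
    funext k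
    by_cases hk : k = i
    · subst hk; simp
    · simp [hk]
  -- This sum expands a determinant whose last column repeats column `j`, and all of whose entries
  -- come from the commutative ring.
  have hz : ∀ j, j ≠ t → ∑ i, ldet (X.updateCol t (Pi.single i 1)) * X i j = 0 := by
    intro j hj
    have h1 : ldet (X.updateCol t (fun i => f (B i j))) = 0 := by
      rw [hX, ldet_map, Matrix.det_zero_of_column_eq hj, map_zero]
      intro k
      simp [hj]
    rw [ldet_eq_sum_updateCol ht] at h1
    rw [← h1]
    refine Finset.sum_congr rfl fun i _ => ?_
    simp [hB i j hj, Matrix.updateCol_idem]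
  rw [ldet_eq_sum_updateCol ht]
  simp_rw [h, mul_add, Finset.sum_add_distrib]
  have hw : ∑ i, ldet (X.updateCol t (Pi.single i 1)) * (Pi.single t w : ι → R) i
      = f (B.updateCol t (Pi.single t 1)).det * w := by
    rw [Finset.sum_eq_single t (fun i _ hi => by simp [hi]) (by simp), hs, ldet_map,
      Pi.single_eq_same]
  rw [hw, add_eq_right]
  simp_rw [Matrix.mulVec, dotProduct, Finset.mul_sum]
  rw [Finset.sum_comm]
  refine Finset.sum_eq_zero fun j _ => ?_
  by_cases hj : j = t
  · subst hj; simp [hc]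
  · simp_rw [← mul_assoc]
    rw [← Finset.sum_mul, hz j hj, zero_mul]

/-! ### Even matrices and Schur complements -/

namespace OddDerivation

variable {𝕜 R : Type} [Field 𝕜] [Ring R] [Algebra 𝕜 R] (S : OddDerivation 𝕜 R)

/-- The commutative subalgebra of even elements. -/
def even : Subalgebra 𝕜 R := AlgHom.equalizer S.P (AlgHom.id 𝕜 R)

theorem mem_even {a : R} : a ∈ S.even ↔ S.HasPar 0 a := by
  simp [even, HasPar, AlgHom.mem_equalizer]

instance : CommRing S.even :=
  { (inferInstance : Ring S.even) with
    mul_comm := fun a b => Subtype.ext ((S.mem_even.1 b.2).comm a) }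

/-- The inclusion of the even part. -/
def evenHom : S.even →+* R := S.even.val.toRingHom

@[simp] theorem evenHom_apply (a : S.even) : S.evenHom a = a := rfl

variable {S} in
theorem exists_map_evenHom {m n : Type} {A : Matrix m n R} (hA : ∀ i j, S.HasPar 0 (A i j)) :
    ∃ B : Matrix m n S.even, A = B.map S.evenHom :=
  ⟨Matrix.of fun i j => ⟨A i j, S.mem_even.2 (hA i j)⟩, rfl⟩

theorem map_evenHom_injective {m n : Type} :
    Function.Injective fun B : Matrix m n S.even => B.map S.evenHom :=
  fun _ _ h => Matrix.map_injective Subtype.val_injective h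

variable {S}

theorem HasPar.mul_self_eq_zero [NeZero (2 : 𝕜)] {a : R} (ha : S.HasPar 1 a) : a * a = 0 := by
  have h1 : S.P a = -a := by simpa [HasPar] using ha
  have h2 := S.comm_of_odd a a h1
  rw [h1, mul_neg, eq_neg_iff_add_eq_zero, ← two_smul 𝕜] at h2
  exact (smul_eq_zero_iff_right (NeZero.ne (2 : 𝕜))).1 h2

theorem HasPar.isNilpotent_mul [NeZero (2 : 𝕜)] {a b : R} (ha : S.HasPar 1 a)
    (hb : S.HasPar 1 b) : (a * b) ^ 2 = 0 := by
  have h1 : S.P a = -a := by simpa [HasPar] using ha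
  have h2 : S.P b = -b := by simpa [HasPar] using hb
  have h3 := S.comm_of_odd a b h2
  rw [h1, mul_neg] at h3
  rw [sq, show a * b * (a * b) = a * (b * a) * b by simp only [mul_assoc],
    show b * a = -(a * b) by rw [h3, neg_neg], mul_neg, neg_mul, ← mul_assoc,
    ha.mul_self_eq_zero]
  simp

section Block

set_option linter.unusedSectionVars false

variable {ι : Type} [Fintype ι] [LinearOrder ι]

/-- Applying `P` with the signs `(-1)^(p i + p j)` is multiplicative on matrices and fixes `A`,
hence fixes its inverse. -/
theorem inv_hasPar (p : ι → ℕ) {A : Matrix ι ι R}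
    (hA : ∀ i j, S.HasPar (p i + p j) (A i j)) {A' : Matrix ι ι R} (h : A * A' = 1)
    (h' : A' * A = 1) (i j : ι) : S.HasPar (p i + p j) (A' i j) := by
  have key : (Matrix.of fun i j => (-1 : 𝕜) ^ (p i + p j) • S.P (A' i j)) * A = 1 := by
    ext i j
    have h1 := congrArg S.P (congrFun (congrFun h' i) j)
    rw [Matrix.mul_apply, map_sum] at h1
    rw [Matrix.mul_apply]
    have h2 : ∀ k, S.P (A' i k * A k j) = (-1 : 𝕜) ^ (p i + p j) •
        ((Matrix.of fun i j => (-1 : 𝕜) ^ (p i + p j) • S.P (A' i j)) i k * A k j) := by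
      intro k
      rw [map_mul, show S.P (A k j) = _ from hA k j]
      simp only [Matrix.of_apply, mul_smul_comm, smul_mul_assoc, smul_smul, ← pow_add]
      congr 1
      rw [neg_one_pow_eq_pow_mod_two, neg_one_pow_eq_pow_mod_two (n := _ + (p i + p k))]
      congr 1; omega
    simp_rw [h2] at h1
    rw [← Finset.smul_sum] at h1
    have hu : IsUnit ((-1 : 𝕜) ^ (p i + p j)) := (isUnit_one.neg).pow _
    refine hu.smul_left_cancel.1 (h1.trans ?_)
    rw [Matrix.one_apply]
    split_ifs with hij
    · subst hij; simp [← two_mul, pow_mul]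
    · simp
  have h3 : (Matrix.of fun i j => (-1 : 𝕜) ^ (p i + p j) • S.P (A' i j)) = A' := by
    calc _ = (Matrix.of fun i j => (-1 : 𝕜) ^ (p i + p j) • S.P (A' i j)) * (A * A') := by
          rw [h, mul_one]
      _ = A' := by rw [← mul_assoc, key, one_mul]
  have h4 := congrFun (congrFun h3 i) j
  rw [Matrix.of_apply] at h4
  unfold HasPar
  conv_rhs => rw [← h4]
  rw [smul_smul, ← pow_add, ← two_mul, pow_mul]
  simp

theorem zmod_two_ne_zero_iff (a : ZMod 2) : ¬ a = 0 ↔ a = 1 := by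
  revert a; decide

theorem sum_eq_block {M : Type} [AddCommMonoid M] (par : ι → ZMod 2) (f : ι → M) :
    ∑ i, f i = ∑ i : {i // par i = 0}, f i + ∑ i : {i // par i = 1}, f i := by
  rw [← Fintype.sum_subtype_add_sum_subtype (fun i => par i = 0) f]
  congr 1
  exact Fintype.sum_equiv (Equiv.subtypeEquivRight fun i => zmod_two_ne_zero_iff (par i)) _ _
    fun _ => rfl

theorem block_mul (par : ι → ZMod 2) (A B : Matrix ι ι R) (a b : ZMod 2) :
    block par (A * B) a b
      = block par A a 0 * block par B 0 b + block par A a 1 * block par B 1 b := by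
  ext i j
  simp only [block, Matrix.submatrix_apply, Matrix.mul_apply, Matrix.add_apply]
  exact sum_eq_block par fun k => A i k * B k j

theorem block_one_self (par : ι → ZMod 2) (a : ZMod 2) :
    block par (1 : Matrix ι ι R) a a = 1 := by
  ext i j
  simp [block, Matrix.one_apply, Subtype.ext_iff]

theorem block_one_of_ne (par : ι → ZMod 2) {a b : ZMod 2} (hab : a ≠ b) :
    block par (1 : Matrix ι ι R) a b = 0 := by
  ext i j
  have : (i : ι) ≠ j := fun h => hab (by rw [← i.2, ← j.2, h])
  simp [block, this]

theorem isUnit_map_evenHom {κ : Type} [Fintype κ] [DecidableEq κ] {B : Matrix κ κ S.even}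
    (hB : IsUnit B.det) : IsUnit (B.map S.evenHom) :=
  ((Matrix.isUnit_iff_isUnit_det B).2 hB).map S.evenHom.mapMatrix

theorem block_hasPar {par : ι → ZMod 2} {A : Matrix ι ι R}
    (hA : ∀ i j, S.HasPar ((par i).val + (par j).val) (A i j)) (a b : ZMod 2)
    (i : {i // par i = a}) (j : {i // par i = b}) :
    S.HasPar (a.val + b.val) (block par A a b i j) := by
  have := hA i j
  rwa [i.2, j.2] at this

theorem mul_hasPar {l m n : Type} [Fintype m] {a b c : ℕ} {A : Matrix l m R} {B : Matrix m n R}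
    (hA : ∀ i j, S.HasPar a (A i j)) (hB : ∀ i j, S.HasPar b (B i j)) (hc : (a + b) % 2 = c % 2)
    (i : l) (j : n) : S.HasPar c ((A * B) i j) := by
  rw [Matrix.mul_apply]
  exact HasPar.sum fun k _ => ((hA i k).mul (hB k j)).congr hc

/-- Products of two odd elements square to zero, so `X * X'` vanishes modulo the nilradical of the
even part. There `B * B'` becomes `1`, and a unit modulo nilpotents is a unit. -/
theorem isUnit_det_of_mul_add_eq_one [NeZero (2 : 𝕜)] {κ κ' : Type} [Fintype κ] [DecidableEq κ]
    [Fintype κ'] {B B' : Matrix κ κ S.even} {X : Matrix κ κ' R} {X' : Matrix κ' κ R}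
    (hX : ∀ i j, S.HasPar 1 (X i j)) (hX' : ∀ i j, S.HasPar 1 (X' i j))
    (h : B.map S.evenHom * B'.map S.evenHom + X * X' = 1) : IsUnit B.det := by
  obtain ⟨N, hN⟩ := exists_map_evenHom (mul_hasPar (c := 0) hX hX' rfl)
  have hnil : ∀ i j, N i j ∈ nilradical S.even := by
    intro i j
    have h1 : N i j = ∑ k, (⟨X i k * X' k j, S.mem_even.2 (((hX i k).mul (hX' k j)).congr rfl)⟩ :
        S.even) := by
      refine Subtype.ext ?_
      have := congrFun (congrFun hN i) j
      rw [Matrix.map_apply, evenHom_apply, Matrix.mul_apply] at this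
      rw [← this]
      simp
    rw [mem_nilradical, h1]
    exact isNilpotent_sum fun k _ => ⟨2, Subtype.ext ((hX i k).isNilpotent_mul (hX' k j))⟩
  have h2 : B * B' + N = 1 := by
    apply S.map_evenHom_injective
    change S.evenHom.mapMatrix (B * B' + N) = S.evenHom.mapMatrix 1
    rw [map_add, map_mul, map_one, ← h]
    simp [hN]
  have h3 : Ideal.Quotient.mk (nilradical S.even) (B * B').det = 1 := by
    rw [RingHom.map_det, ← Matrix.det_one (n := κ),
      ← map_one (RingHom.mapMatrix (Ideal.Quotient.mk (nilradical S.even))), ← h2, map_add]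
    congr 1
    symm
    rw [add_eq_left]
    ext i j
    exact Ideal.Quotient.eq_zero_iff_mem.2 (hnil i j)
  have h4 : IsNilpotent ((B * B').det - 1) := by
    rw [← mem_nilradical, ← Ideal.Quotient.eq_zero_iff_mem, map_sub, h3, map_one, sub_self]
  have h5 := h4.isUnit_one_add
  rw [add_sub_cancel, Matrix.det_mul] at h5
  exact isUnit_of_mul_isUnit_left h5

/-- For an invertible even matrix, the odd-odd block and its Schur complement are invertible
matrices over the even subalgebra. -/
theorem exists_schur [NeZero (2 : 𝕜)] {par : ι → ZMod 2} {A : Matrix ι ι R}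
    (hA : ∀ i j, S.HasPar ((par i).val + (par j).val) (A i j)) (hu : IsUnit A) :
    (∃ B : Matrix _ _ S.even, block par A 1 1 = B.map S.evenHom ∧ IsUnit B.det) ∧
    ∃ B : Matrix _ _ S.even, block par A 0 0 -
      block par A 0 1 * Ring.inverse (block par A 1 1) * block par A 1 0 = B.map S.evenHom ∧
      IsUnit B.det := by
  obtain ⟨A', h, h'⟩ := isUnit_iff_exists.1 hu
  have hA' := inv_hasPar (fun i => (par i).val) hA h h'
  have h11 := congrArg (fun Z => block par Z 1 1) h
  have h10 := congrArg (fun Z => block par Z 1 0) h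
  have h00 := congrArg (fun Z => block par Z 0 0) h
  simp only [block_mul, block_one_self] at h11 h00
  simp only [block_mul] at h10
  rw [block_one_of_ne par (by decide)] at h10
  obtain ⟨B, hB⟩ := exists_map_evenHom fun i j => (block_hasPar hA 1 1 i j).congr (l := 0) rfl
  obtain ⟨B', hB'⟩ := exists_map_evenHom fun i j => (block_hasPar hA' 1 1 i j).congr (l := 0) rfl
  obtain ⟨C', hC'⟩ := exists_map_evenHom fun i j => (block_hasPar hA' 0 0 i j).congr (l := 0) rfl
  have hBu : IsUnit B.det := by
    refine isUnit_det_of_mul_add_eq_one (B' := B') (block_hasPar hA 1 0) (block_hasPar hA' 0 1) ?_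
    rw [← hB, ← hB', add_comm]
    exact h11
  have hXu : IsUnit (block par A 1 1) := by rw [hB]; exact isUnit_map_evenHom hBu
  have hY := Ring.inverse_mul_cancel _ hXu
  have hY' := Ring.mul_inverse_cancel _ hXu
  set Y := Ring.inverse (block par A 1 1) with hYdef
  have hYpar : ∀ i j, S.HasPar 0 (Y i j) :=
    inv_hasPar (fun _ => 0) (fun i j => (block_hasPar hA 1 1 i j).congr (l := 0) rfl) hY' hY
  refine ⟨⟨B, hB, hBu⟩, ?_⟩
  obtain ⟨C, hC⟩ := exists_map_evenHom (A := block par A 0 0 - block par A 0 1 * Y * block par A 1 0)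
    fun i j => ((block_hasPar hA 0 0 i j).congr (l := 0) rfl).sub
      (mul_hasPar (c := 0) (mul_hasPar (c := 1) (block_hasPar hA 0 1) hYpar rfl)
        (block_hasPar hA 1 0) rfl i j)
  refine ⟨C, hC, ?_⟩
  -- The even-even block of the inverse is the inverse of the Schur complement: the odd-even block
  -- of `A * A' = 1` is used to eliminate the odd-even block of `A'`. One side suffices over the
  -- commutative even subalgebra.
  have hone : C * C' = 1 := by
    apply S.map_evenHom_injective
    change S.evenHom.mapMatrix (C * C') = S.evenHom.mapMatrix 1
    rw [map_mul, map_one]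
    change C.map S.evenHom * C'.map S.evenHom = 1
    rw [← hC, ← hC', Matrix.sub_mul, Matrix.mul_assoc, Matrix.mul_assoc,
      eq_neg_of_add_eq_zero_left h10, Matrix.mul_neg, ← Matrix.mul_assoc Y, hY, Matrix.one_mul,
      Matrix.mul_neg, sub_neg_eq_add]
    exact h00
  have := congrArg Matrix.det hone
  rw [Matrix.det_mul, Matrix.det_one] at this
  exact IsUnit.of_mul_eq_one _ this

theorem isUnit_ber [NeZero (2 : 𝕜)] {par : ι → ZMod 2} {A : Matrix ι ι R}
    (hA : ∀ i j, S.HasPar ((par i).val + (par j).val) (A i j)) (hu : IsUnit A) :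
    IsUnit (ber par A) := by
  obtain ⟨⟨B, hB, hBu⟩, C, hC, hCu⟩ := exists_schur hA hu
  rw [ber, hC, hB, ldet_map, ldet_map]
  exact ((hBu.map S.evenHom).ringInverse).mul (hCu.map S.evenHom)

theorem ringInverse_eq {A : Type} [Ring A] {a b : A} (h : a * b = 1) (h' : b * a = 1) :
    Ring.inverse a = b :=
  Ring.inverse_unit (⟨a, b, h, h'⟩ : Aˣ)

/-- The Berezinian of a matrix whose last column is a combination of the other ones, up to a
multiple of the last basis vector. -/
theorem ber_eq_mul [NeZero (2 : 𝕜)] {ι' : Type} [Fintype ι'] [LinearOrder ι'] {f : ι' → ι}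
    (hf : Function.Injective f) {t : ι} (ht : ∀ i, i ≤ t) (hft : ∀ i, f i ≠ t)
    (hrange : ∀ i, i ≠ t → ∃ i', f i' = i) {par : ι → ZMod 2} (hpar : par t = 0)
    {X : Matrix ι ι R}
    (hX : ∀ i j, j ≠ t → S.HasPar ((par i).val + (par j).val) (X i j))
    (hu : IsUnit (X.submatrix f f)) {c : ι → R} (hc : c t = 0) {w : R}
    (h : ∀ i, X i t = (X.mulVec c) i + (Pi.single t w : ι → R) i) :
    ber par X = ber (par ∘ f) (X.submatrix f f) * w := by
  have h01 : (0 : ZMod 2) ≠ 1 := by decide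
  obtain ⟨⟨B, hB, hBu⟩, C, hC, hCu⟩ := exists_schur (par := par ∘ f) (A := X.submatrix f f)
    (fun i j => hX (f i) (f j) (hft j)) hu
  have hne1 : ∀ i : {i // par i = 1}, (i : ι) ≠ t := fun i hi => h01 (by rw [← hpar, ← hi, i.2])
  let e1 : {i // (par ∘ f) i = 1} ≃ {i // par i = 1} := Equiv.ofBijective
    (fun i => ⟨f i, i.2⟩) ⟨fun i j hij => Subtype.ext (hf (congrArg Subtype.val hij)), fun i => by
      obtain ⟨i', hi'⟩ := hrange i (hne1 i)
      exact ⟨⟨i', by rw [Function.comp_apply, hi', i.2]⟩, Subtype.ext hi'⟩⟩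
  let t0 : {i // par i = 0} := ⟨t, hpar⟩
  let g0 : {i // (par ∘ f) i = 0} → {i // par i = 0} := fun i => ⟨f i, i.2⟩
  have hg0 : ∀ i, g0 i ≠ t0 := fun i hi => hft i (congrArg Subtype.val hi)
  -- The index `t` enlarges only the even block; the odd blocks of `X` and of its submatrix agree up
  -- to relabelling.
  let e0 : {i // (par ∘ f) i = 0} ⊕ Unit ≃ {i // par i = 0} := Equiv.ofBijective
    (Sum.elim g0 fun _ => t0) (by
      constructor
      · rintro (i | i) (j | j) hij
        · exact congrArg Sum.inl (Subtype.ext (hf (congrArg Subtype.val hij)))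
        · exact absurd hij (hg0 i)
        · exact absurd hij.symm (hg0 j)
        · rfl
      · intro i
        by_cases hi : (i : ι) = t
        · exact ⟨Sum.inr (), Subtype.ext hi.symm⟩
        · obtain ⟨i', hi'⟩ := hrange i hi
          exact ⟨Sum.inl ⟨i', by rw [Function.comp_apply, hi', i.2]⟩, Subtype.ext hi'⟩)
  have hX11 : block par X 1 1 = (B.submatrix e1.symm e1.symm).map S.evenHom := by
    ext i j
    have := congrFun (congrFun hB (e1.symm i)) (e1.symm j)
    refine Eq.trans ?_ this
    change block par X 1 1 i j = block par X 1 1 (e1 (e1.symm i)) (e1 (e1.symm j))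
    simp
  have hX11u : IsUnit (block par X 1 1) := by
    rw [hX11]
    exact isUnit_map_evenHom (by rwa [Matrix.det_submatrix_equiv_self])
  have hY := Ring.inverse_mul_cancel _ hX11u
  have hY' := Ring.mul_inverse_cancel _ hX11u
  rw [ber, ber, hC, hB, ldet_map, ldet_map, hX11, ldet_map, Matrix.det_submatrix_equiv_self,
    ← hX11, mul_assoc]
  congr 1
  set Y := Ring.inverse (block par X 1 1) with hYdef
  have hYsub : Ring.inverse (block (par ∘ f) (X.submatrix f f) 1 1) = Y.submatrix e1 e1 := by
    have hb : block (par ∘ f) (X.submatrix f f) 1 1 = (block par X 1 1).submatrix e1 e1 := rfl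
    rw [hb]
    apply ringInverse_eq
    · rw [Matrix.submatrix_mul_equiv, hY', Matrix.submatrix_one_equiv]
    · rw [Matrix.submatrix_mul_equiv, hY, Matrix.submatrix_one_equiv]
  have hXp1 : ∀ a b : ZMod 2, ∀ i : {i // par i = a}, ∀ j : {i // par i = b}, (j : ι) ≠ t →
      S.HasPar (a.val + b.val) (block par X a b i j) := by
    intro a b i j hj
    have := hX i j hj
    rwa [i.2, j.2] at this
  have hYpar : ∀ i j, S.HasPar 0 (Y i j) := inv_hasPar (fun _ => 0)
    (fun i j => (hXp1 1 1 i j (hne1 j)).congr (l := 0) rfl) hY' hY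
  set Z := block par X 0 0 - block par X 0 1 * Y * block par X 1 0 with hZ
  have hZsub : ∀ i j, Z (g0 i) (g0 j) = (C i j : R) := by
    intro i j
    have h1 := congrFun (congrFun hC i) j
    rw [hYsub] at h1
    refine Eq.trans ?_ h1
    have h2 : block (par ∘ f) (X.submatrix f f) 0 1 * Y.submatrix e1 e1
        * block (par ∘ f) (X.submatrix f f) 1 0
        = (block par X 0 1 * Y * block par X 1 0).submatrix g0 g0 := by
      rw [← Matrix.submatrix_mul_equiv _ _ g0 e1 g0, ← Matrix.submatrix_mul_equiv _ _ g0 e1 e1]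
      rfl
    rw [h2]
    rfl
  have hZpar : ∀ i j, j ≠ t0 → S.HasPar 0 (Z i j) := by
    intro i j hj
    have hj' : (j : ι) ≠ t := fun hh => hj (Subtype.ext hh)
    refine ((hXp1 0 0 i j hj').congr (l := 0) rfl).sub ?_
    rw [Matrix.mul_apply]
    refine HasPar.sum fun k _ => ((mul_hasPar (c := 1) (fun i j => hXp1 0 1 i j (hne1 j)) hYpar rfl
      i k).mul (hXp1 1 0 k j hj')).congr rfl
  have hE : ∀ i j, ∃ b : S.even, j ≠ t0 → Z i j = S.evenHom b := by
    intro i j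
    by_cases hj : j = t0
    · exact ⟨0, fun h => absurd hj h⟩
    · exact ⟨⟨Z i j, S.mem_even.2 (hZpar i j hj)⟩, fun _ => rfl⟩
  choose E hE using hE
  have hcol : ∀ i, X i t = ∑ j : {i // par i = 0}, X i j * c j + ∑ j : {i // par i = 1}, X i j * c j
      + (Pi.single t w : ι → R) i := by
    intro i
    rw [h i, ← sum_eq_block par fun j => X i j * c j]
    rfl
  let c0 : {i // par i = 0} → R := fun i => c i
  let c1 : {i // par i = 1} → R := fun i => c i
  have hcol0 : (fun i : {i // par i = 0} => X i t) = (block par X 0 0).mulVec c0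
      + (block par X 0 1).mulVec c1 + Pi.single t0 w := by
    funext i
    refine (hcol i).trans ?_
    simp only [Pi.add_apply]
    congr 1
    by_cases hi : i = t0
    · subst hi; simp [t0]
    · rw [Pi.single_eq_of_ne hi, Pi.single_eq_of_ne fun hh => hi (Subtype.ext hh)]
  have hcol1 : (fun i : {i // par i = 1} => X i t) = (block par X 1 0).mulVec c0
      + (block par X 1 1).mulVec c1 := by
    funext i
    refine (hcol i).trans ?_
    rw [Pi.single_eq_of_ne (hne1 i), add_zero]
    rfl
  -- Passing to the Schur complement cancels the contribution of the odd columns, `X₀₁ c1 - X₀₁ Y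
  -- X₁₁ c1 = 0`, and leaves the last column in the same shape.
  have hZcol : (fun i => Z i t0) = Z.mulVec c0 + Pi.single t0 w := by
    have h1 : (fun i => Z i t0) = (fun i : {i // par i = 0} => X i t)
        - (block par X 0 1 * Y).mulVec (fun i : {i // par i = 1} => X i t) := rfl
    rw [h1, hcol0, hcol1, hZ, Matrix.sub_mulVec, Matrix.mulVec_add, Matrix.mulVec_mulVec,
      Matrix.mulVec_mulVec, Matrix.mul_assoc (block par X 0 1) Y (block par X 1 1), hY,
      Matrix.mul_one]
    abel
  have hdet := ldet_eq_mul_of_lastCol S.evenHom (t := t0) (fun i => ht i) Z (Matrix.of E)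
    (fun i j hj => hE i j hj) (c := c0) hc (w := w) fun i => congrFun hZcol i
  rw [hdet]
  congr 2
  refine (Matrix.det_submatrix_equiv_self e0 _).symm.trans ?_
  -- With last column a basis vector, the matrix is block triangular with diagonal blocks `C` and
  -- `1`.
  have hfb : ((Matrix.of E).updateCol t0 (Pi.single t0 1)).submatrix e0 e0
      = Matrix.fromBlocks C 0 (Matrix.of fun _ j => E t0 (g0 j)) 1 := by
    ext i j
    rcases i with i | i <;> rcases j with j | j
    · change (((Matrix.of E).updateCol t0 (Pi.single t0 1)) (g0 i) (g0 j) : R) = C i j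
      rw [Matrix.updateCol_ne (hg0 j), ← hZsub, hE _ _ (hg0 j)]
      rfl
    · change (((Matrix.of E).updateCol t0 (Pi.single t0 1)) (g0 i) t0 : R) = (0 : S.even)
      rw [Matrix.updateCol_self, Pi.single_eq_of_ne (hg0 i)]
    · change (((Matrix.of E).updateCol t0 (Pi.single t0 1)) t0 (g0 j) : R) = E t0 (g0 j)
      rw [Matrix.updateCol_ne (hg0 j)]
      rfl
    · change (((Matrix.of E).updateCol t0 (Pi.single t0 1)) t0 t0 : R) = _
      rw [Matrix.updateCol_self, Pi.single_eq_same]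
      simp
  refine (congrArg Matrix.det hfb).trans ((Matrix.det_fromBlocks_zero₁₂ _ _ _).trans ?_)
  rw [Matrix.det_one, mul_one]
  congr!

end Block

end OddDerivation
/-! ### The Grassmann algebra -/

section Grassmann

variable {𝕜 V : Type} [Field 𝕜] [AddCommGroup V] [Module 𝕜 V]

/-- The parity involution of the exterior algebra. -/
abbrev gradeInv : ExteriorAlgebra 𝕜 V →ₐ[𝕜] ExteriorAlgebra 𝕜 V := CliffordAlgebra.involute

theorem ι_mul_eq (v : V) (b : ExteriorAlgebra 𝕜 V) :
    ExteriorAlgebra.ι 𝕜 v * b = gradeInv b * ExteriorAlgebra.ι 𝕜 v := by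
  induction b using ExteriorAlgebra.induction with
  | algebraMap r => rw [AlgHom.commutes]; exact (Algebra.commutes r _).symm
  | ι w =>
    rw [show gradeInv (ExteriorAlgebra.ι 𝕜 w) = -ExteriorAlgebra.ι 𝕜 w from
      CliffordAlgebra.involute_ι w, neg_mul, eq_neg_iff_add_eq_zero]
    exact ExteriorAlgebra.ι_add_mul_swap v w
  | mul a b ha hb => rw [map_mul, ← mul_assoc, ha, mul_assoc, hb, mul_assoc]
  | add a b ha hb => rw [mul_add, ha, hb, map_add, add_mul]

theorem grassmann_comm_of_even {b : ExteriorAlgebra 𝕜 V} (hb : gradeInv b = b)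
    (a : ExteriorAlgebra 𝕜 V) : a * b = b * a := by
  induction a using ExteriorAlgebra.induction with
  | algebraMap r => exact Algebra.commutes r _
  | ι v => rw [ι_mul_eq, hb]
  | mul a c ha hc => rw [mul_assoc, hc, ← mul_assoc, ha, mul_assoc]
  | add a c ha hc => rw [mul_add, add_mul, ha, hc]

theorem grassmann_comm_of_odd {b : ExteriorAlgebra 𝕜 V} (hb : gradeInv b = -b)
    (a : ExteriorAlgebra 𝕜 V) : a * b = b * gradeInv a := by
  induction a using ExteriorAlgebra.induction with
  | algebraMap r => rw [AlgHom.commutes]; exact Algebra.commutes r _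
  | ι v =>
    rw [ι_mul_eq, hb, show gradeInv (ExteriorAlgebra.ι 𝕜 v) = -ExteriorAlgebra.ι 𝕜 v from
      CliffordAlgebra.involute_ι v, neg_mul, mul_neg]
  | mul a c ha hc => rw [map_mul, mul_assoc, hc, ← mul_assoc, ha, mul_assoc]
  | add a c ha hc => rw [map_add, mul_add, add_mul, ha, hc]

/-- The interior product on the exterior algebra. -/
abbrev contr (d : Module.Dual 𝕜 V) : ExteriorAlgebra 𝕜 V →ₗ[𝕜] ExteriorAlgebra 𝕜 V :=
  CliffordAlgebra.contractLeft d

theorem contractLeft_mul (d : Module.Dual 𝕜 V) (a b : ExteriorAlgebra 𝕜 V) :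
    contr d (a * b) = contr d a * b + gradeInv a * contr d b := by
  induction a using ExteriorAlgebra.induction generalizing b with
  | algebraMap r =>
    simp only [AlgHom.commutes]
    erw [CliffordAlgebra.contractLeft_algebraMap_mul, CliffordAlgebra.contractLeft_algebraMap]
    simp
  | ι v =>
    erw [CliffordAlgebra.contractLeft_ι_mul, CliffordAlgebra.contractLeft_ι,
      CliffordAlgebra.involute_ι]
    rw [neg_mul, ← sub_eq_add_neg, Algebra.smul_def]
  | mul a c ha hc =>
    rw [mul_assoc, ha, hc, ha, map_mul]
    simp only [mul_add, add_mul, mul_assoc, add_assoc]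
  | add a c ha hc =>
    rw [add_mul, map_add, ha, hc, map_add, map_add]
    simp only [add_mul]
    abel

theorem involute_contractLeft (d : Module.Dual 𝕜 V) (a : ExteriorAlgebra 𝕜 V) :
    gradeInv (contr d a) = -contr d (gradeInv a) := by
  induction a using ExteriorAlgebra.induction with
  | algebraMap r =>
    simp only [AlgHom.commutes]
    erw [CliffordAlgebra.contractLeft_algebraMap]
    simp
  | ι v =>
    rw [show gradeInv (ExteriorAlgebra.ι 𝕜 v) = -ExteriorAlgebra.ι 𝕜 v from
      CliffordAlgebra.involute_ι v]
    simp only [map_neg, neg_neg]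
    erw [CliffordAlgebra.contractLeft_ι]
    exact AlgHom.commutes _ _
  | mul a c ha hc =>
    have h1 := contractLeft_mul d a c
    have h2 := contractLeft_mul d (gradeInv a) (gradeInv c)
    rw [h1, map_mul, h2, map_add, map_mul, map_mul, ha, hc]
    simp only [neg_mul, mul_neg, neg_add]
  | add a c ha hc =>
    simp only [map_add, ha, hc, neg_add]

end Grassmann

/-! ### The algebra of functions on the superline -/

section SFun

variable {𝕜 : Type} [RCLike 𝕜] {p : ℕ} {J : TopologicalSpace.Opens ℝ}
  {U : TopologicalSpace.Opens (Fin p → ℝ)} {q : ℕ}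

theorem Smooth.contDiffAt (f : Smooth 𝕜 J U) (z : Body J U) : ContDiffAt ℝ ∞ (ext0 f.1) z :=
  ContDiffOn.contDiffAt (show ContDiffOn ℝ ∞ (ext0 f.1) (Body J U) from f.2)
    ((isOpen_body J U).mem_nhds z.2)

theorem dx_apply (f : Smooth 𝕜 J U) (z : Body J U) :
    (dx 𝕜 J U f).1 z = fderiv ℝ (ext0 f.1) z (1, 0) := rfl

theorem dx_mul (f g : Smooth 𝕜 J U) :
    dx 𝕜 J U (f * g) = dx 𝕜 J U f * g + f * dx 𝕜 J U g := by
  ext z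
  have he : ext0 (f * g).1 =ᶠ[nhds (z : ℝ × (Fin p → ℝ))] fun w => ext0 f.1 w * ext0 g.1 w := by
    filter_upwards [(isOpen_body J U).mem_nhds z.2] with w hw
    rw [ext0_apply _ ⟨w, hw⟩, ext0_apply _ ⟨w, hw⟩, ext0_apply _ ⟨w, hw⟩]
    rfl
  change fderiv ℝ (ext0 (f * g).1) z (1, 0) = fderiv ℝ (ext0 f.1) z (1, 0) * g.1 z
    + f.1 z * fderiv ℝ (ext0 g.1) z (1, 0)
  rw [he.fderiv_eq, fderiv_fun_mul' ((Smooth.contDiffAt f z).differentiableAt (by simp))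
    ((Smooth.contDiffAt g z).differentiableAt (by simp)), ext0_apply, ext0_apply]
  simp [mul_comm, add_comm]

theorem dx_one : dx 𝕜 J U 1 = 0 := by
  have := dx_mul (1 : Smooth 𝕜 J U) 1
  simpa using this

variable (𝕜 J U q) in
/-- The parity involution, with explicit arguments. -/
abbrev sInv : SFun 𝕜 J U q →ₐ[𝕜] SFun 𝕜 J U q := parityInvolution

theorem SFun.induction {C : SFun 𝕜 J U q → Prop} (h0 : C 0)
    (ht : ∀ (f : Smooth 𝕜 J U) (a : Grassmann 𝕜 q), C (f ⊗ₜ[𝕜] a))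
    (hadd : ∀ f g, C f → C g → C (f + g)) (f : SFun 𝕜 J U q) : C f :=
  TensorProduct.induction_on f h0 ht hadd

theorem parityInvolution_tmul (f : Smooth 𝕜 J U) (a : Grassmann 𝕜 q) :
    sInv 𝕜 J U q (f ⊗ₜ[𝕜] a : SFun 𝕜 J U q) = f ⊗ₜ[𝕜] gradeInv a := rfl

theorem partialX_tmul (f : Smooth 𝕜 J U) (a : Grassmann 𝕜 q) :
    partialX (f ⊗ₜ[𝕜] a : SFun 𝕜 J U q) = dx 𝕜 J U f ⊗ₜ[𝕜] a := rfl

theorem partialXi_tmul (f : Smooth 𝕜 J U) (a : Grassmann 𝕜 q) :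
    partialXi (f ⊗ₜ[𝕜] a : SFun 𝕜 J U q) = f ⊗ₜ[𝕜] contr (LinearMap.proj 0) a := rfl

theorem tmul_mul_tmul' (f g : Smooth 𝕜 J U) (a b : Grassmann 𝕜 q) :
    (f ⊗ₜ[𝕜] a * g ⊗ₜ[𝕜] b : SFun 𝕜 J U q) = (f * g) ⊗ₜ[𝕜] (a * b) :=
  Algebra.TensorProduct.tmul_mul_tmul f g a b

theorem parityInvolution_parityInvolution (f : SFun 𝕜 J U q) :
    sInv 𝕜 J U q (sInv 𝕜 J U q f) = f := by
  induction f using SFun.induction with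
  | h0 => simp
  | ht f a =>
    rw [parityInvolution_tmul, parityInvolution_tmul]
    congr 1
    exact CliffordAlgebra.involute_involute a
  | hadd f g hf hg => rw [map_add, map_add, hf, hg]

/-- The expression `g + P g` is additive in `g`, so pure tensors suffice, whereas a homogeneous `g`
need not be presented by homogeneous tensors. For even `g` one divides by `2` afterwards. -/
theorem mul_even_part (f g : SFun 𝕜 J U q) :
    f * (g + sInv 𝕜 J U q g) = (g + sInv 𝕜 J U q g) * f := by
  induction g using SFun.induction with
  | h0 => simp
  | hadd g h hg hh =>
    rw [map_add, add_add_add_comm, mul_add, hg, hh, ← add_mul]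
  | ht g b =>
    induction f using SFun.induction with
    | h0 => simp
    | hadd f h hf hh => rw [add_mul, hf, hh, ← mul_add]
    | ht f a =>
      rw [parityInvolution_tmul, ← TensorProduct.tmul_add, tmul_mul_tmul', tmul_mul_tmul',
        mul_comm f g, grassmann_comm_of_even]
      rw [map_add, show gradeInv (gradeInv b) = b from CliffordAlgebra.involute_involute b,
        add_comm b]

theorem mul_odd_part (f g : SFun 𝕜 J U q) :
    f * (g - sInv 𝕜 J U q g) = (g - sInv 𝕜 J U q g) * sInv 𝕜 J U q f := by
  induction g using SFun.induction with
  | h0 => simp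
  | hadd g h hg hh =>
    rw [map_add, add_sub_add_comm, mul_add, hg, hh, add_mul]
  | ht g b =>
    induction f using SFun.induction with
    | h0 => simp
    | hadd f h hf hh => rw [map_add, mul_add, add_mul, hf, hh]
    | ht f a =>
      rw [parityInvolution_tmul, parityInvolution_tmul, ← TensorProduct.tmul_sub, tmul_mul_tmul',
        tmul_mul_tmul', mul_comm f g, grassmann_comm_of_odd]
      rw [map_sub, show gradeInv (gradeInv b) = b from CliffordAlgebra.involute_involute b,
        neg_sub]

theorem partialX_mul (f g : SFun 𝕜 J U q) :
    partialX (f * g) = partialX f * g + f * partialX g := by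
  induction f using SFun.induction with
  | h0 => simp
  | hadd f h hf hh => rw [add_mul, map_add, hf, hh, map_add]; noncomm_ring
  | ht f a =>
    induction g using SFun.induction with
    | h0 => simp
    | hadd g h hg hh => rw [mul_add, map_add, hg, hh, map_add]; noncomm_ring
    | ht g b =>
      simp only [tmul_mul_tmul', partialX_tmul, dx_mul, TensorProduct.add_tmul]

theorem partialXi_mul (f g : SFun 𝕜 J U q) :
    partialXi (f * g) = partialXi f * g + sInv 𝕜 J U q f * partialXi g := by
  induction f using SFun.induction with
  | h0 => simp
  | hadd f h hf hh => rw [add_mul, map_add, hf, hh, map_add, map_add]; noncomm_ring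
  | ht f a =>
    induction g using SFun.induction with
    | h0 => simp
    | hadd g h hg hh => rw [mul_add, map_add, hg, hh, map_add]; noncomm_ring
    | ht g b =>
      simp only [tmul_mul_tmul', partialXi_tmul, parityInvolution_tmul, contractLeft_mul,
        TensorProduct.tmul_add]

theorem parityInvolution_partialX (f : SFun 𝕜 J U q) :
    sInv 𝕜 J U q (partialX f) = partialX (sInv 𝕜 J U q f) := by
  induction f using SFun.induction with
  | h0 => simp
  | hadd f h hf hh => simp only [map_add, hf, hh]
  | ht f a => rfl

theorem parityInvolution_partialXi (f : SFun 𝕜 J U q) :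
    sInv 𝕜 J U q (partialXi f) = -partialXi (sInv 𝕜 J U q f) := by
  induction f using SFun.induction with
  | h0 => simp
  | hadd f h hf hh => simp only [map_add, hf, hh, neg_add]
  | ht f a =>
    rw [partialXi_tmul, parityInvolution_tmul, parityInvolution_tmul, partialXi_tmul,
      involute_contractLeft, TensorProduct.tmul_neg]

theorem partialXi_partialXi (f : SFun 𝕜 J U q) : partialXi (partialXi f) = 0 := by
  induction f using SFun.induction with
  | h0 => simp
  | hadd f h hf hh => simp only [map_add, hf, hh, add_zero]
  | ht f a =>
    rw [partialXi_tmul, partialXi_tmul,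
      show contr (LinearMap.proj 0) (contr (LinearMap.proj 0) a) = 0 from
        CliffordAlgebra.contractLeft_contractLeft _ a, TensorProduct.tmul_zero]

theorem partialXi_partialX (f : SFun 𝕜 J U q) :
    partialXi (partialX f) = partialX (partialXi f) := by
  induction f using SFun.induction with
  | h0 => simp
  | hadd f h hf hh => simp only [map_add, hf, hh]
  | ht f a => rfl

theorem partialXi_xi : partialXi (xi : SFun 𝕜 J U q) = 1 := by
  refine (partialXi_tmul _ _).trans ?_
  refine (congrArg (fun a : Grassmann 𝕜 q => (1 : Smooth 𝕜 J U) ⊗ₜ[𝕜] a)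
    (CliffordAlgebra.contractLeft_ι _ _ _)).trans ?_
  simp
  rfl

theorem partialX_xi : partialX (xi : SFun 𝕜 J U q) = 0 := by
  refine (partialX_tmul _ _).trans ?_
  rw [dx_one, TensorProduct.zero_tmul]

theorem parityInvolution_xi : sInv 𝕜 J U q (xi : SFun 𝕜 J U q) = -xi := by
  refine (parityInvolution_tmul _ _).trans ?_
  refine (congrArg (fun a : Grassmann 𝕜 q => (1 : Smooth 𝕜 J U) ⊗ₜ[𝕜] a)
    (CliffordAlgebra.involute_ι _)).trans ?_
  rw [TensorProduct.tmul_neg]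
  rfl

theorem mul_comm_of_odd (f g : SFun 𝕜 J U q) (hg : sInv 𝕜 J U q g = -g) :
    f * g = g * sInv 𝕜 J U q f := by
  have h := mul_odd_part f g
  rw [hg, sub_neg_eq_add, ← two_smul 𝕜 g, mul_smul_comm, smul_mul_assoc] at h
  exact smul_right_injective _ (two_ne_zero' 𝕜) h

theorem mul_comm_of_even (f g : SFun 𝕜 J U q) (hg : sInv 𝕜 J U q g = g) :
    f * g = g * f := by
  have h := mul_even_part f g
  rw [hg, ← two_smul 𝕜 g, mul_smul_comm, smul_mul_assoc] at h
  exact smul_right_injective _ (two_ne_zero' 𝕜) h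

theorem mul_xi (f : SFun 𝕜 J U q) : f * xi = xi * sInv 𝕜 J U q f :=
  mul_comm_of_odd f xi parityInvolution_xi

theorem xi_mul_xi : (xi * xi : SFun 𝕜 J U q) = 0 := by
  refine (tmul_mul_tmul' _ _ _ _).trans ?_
  rw [ExteriorAlgebra.ι_sq_zero, TensorProduct.tmul_zero]

theorem D_apply (f : SFun 𝕜 J U q) : D f = partialXi f + xi * partialX f := rfl

variable (𝕜 J U q) in
/-- The algebra of functions on the superline with the odd derivation `D`. -/
def superD : OddDerivation 𝕜 (SFun 𝕜 J U q) where
  P := parityInvolution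
  D := D
  P_P := parityInvolution_parityInvolution
  comm_of_even := mul_comm_of_even
  comm_of_odd := mul_comm_of_odd
  leibniz a b := by
    have h := mul_xi (sInv 𝕜 J U q a)
    rw [parityInvolution_parityInvolution] at h
    rw [D_apply, D_apply, D_apply, partialXi_mul, partialX_mul, mul_add (sInv 𝕜 J U q a),
      ← mul_assoc (sInv 𝕜 J U q a) xi, h]
    noncomm_ring
  P_D a := by
    rw [D_apply, D_apply, map_add, map_mul, parityInvolution_partialXi, parityInvolution_xi,
      parityInvolution_partialX, neg_mul, neg_add]

/-- Since `∂_ξ (ξ ∂ₓ f) = ∂ₓ f - ξ ∂_ξ ∂ₓ f`, the mixed terms cancel, while `∂_ξ² = 0` and `ξ² = 0`.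
Consequently the constants are exactly the kernel of `D`. -/
theorem D_D (f : SFun 𝕜 J U q) : D (D f) = partialX f := by
  simp only [D_apply, map_add, partialXi_mul, partialX_mul, partialXi_partialXi, partialXi_xi,
    partialX_xi, parityInvolution_xi, partialXi_partialX, mul_add, ← mul_assoc, xi_mul_xi]
  simp

theorem isConst_iff (c : SFun 𝕜 J U q) : IsConst c ↔ D c = 0 := by
  constructor
  · rintro ⟨h1, h2⟩
    rw [D_apply, h1, h2, mul_zero, add_zero]
  · intro h
    have h1 : partialX c = 0 := by rw [← D_D, h, map_zero]
    refine ⟨h1, ?_⟩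
    rwa [D_apply, h1, mul_zero, add_zero] at h

end SFun

/-! ### Linear differential equations over the superline -/

section SmoothODE

variable {𝕜 : Type} [RCLike 𝕜] {p : ℕ} {J : TopologicalSpace.Opens ℝ}
  {U : TopologicalSpace.Opens (Fin p → ℝ)} {κ : Type} [Fintype κ]

/-- The matrix of smooth functions `A` as a family of real linear maps. -/
def matrixCLM (A : κ → κ → Smooth 𝕜 J U) (z : ℝ × (Fin p → ℝ)) : (κ → 𝕜) →L[ℝ] (κ → 𝕜) :=
  LinearMap.toContinuousLinearMap
    { toFun := fun w k => ∑ l, ext0 (A k l).1 z * w l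
      map_add' := fun w w' => by ext k; simp [mul_add, Finset.sum_add_distrib]
      map_smul' := fun c w => by ext k; simp [Finset.smul_sum] }

theorem matrixCLM_apply (A : κ → κ → Smooth 𝕜 J U) (z : ℝ × (Fin p → ℝ)) (w : κ → 𝕜) (k : κ) :
    matrixCLM A z w k = ∑ l, ext0 (A k l).1 z * w l := rfl

theorem contDiffOn_ext0 (f : Smooth 𝕜 J U) : ContDiffOn ℝ ∞ (ext0 f.1) (Body J U) := f.2

theorem contDiffOn_matrixCLM (A : κ → κ → Smooth 𝕜 J U) :
    ContDiffOn ℝ ∞ (matrixCLM A) (Body J U) := by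
  rw [contDiffOn_clm_apply]
  intro w
  rw [contDiffOn_pi]
  intro k
  exact ContDiffOn.sum fun l _ => (contDiffOn_ext0 (A k l)).mul contDiffOn_const

theorem exists_smooth_solution (hJ : (J : Set ℝ).OrdConnected) {x₀ : ℝ} (hx₀ : x₀ ∈ J)
    (A : κ → κ → Smooth 𝕜 J U) (v : κ → 𝕜) :
    ∃ F : κ → Smooth 𝕜 J U, (∀ k, dx 𝕜 J U (F k) = ∑ l, A k l * F l) ∧
      ∀ z : Body J U, z.1.1 = x₀ → ∀ k, (F k).1 z = v k := by
  obtain ⟨F, hF, hF0, hFA⟩ := exists_linearODE_solution J.isOpen hJ U.isOpen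
    (contDiffOn_matrixCLM A) hx₀ v
  have hFk : ∀ k, ContDiffOn ℝ ∞ (fun z => F z k) (Body J U) := fun k => contDiffOn_pi.1 hF k
  let G : κ → Smooth 𝕜 J U := fun k =>
    ⟨fun z => F z k, contDiffOn_ext0_congr (hFk k) fun _ => rfl⟩
  refine ⟨G, fun k => ?_, ?_⟩
  · ext z
    have he : ext0 (G k).1 =ᶠ[nhds (z : ℝ × (Fin p → ℝ))] fun w => F w k := by
      filter_upwards [(isOpen_body J U).mem_nhds z.2] with w hw
      exact ext0_apply _ ⟨w, hw⟩
    have hd : DifferentiableAt ℝ F z :=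
      (hF.contDiffAt ((isOpen_body J U).mem_nhds z.2)).differentiableAt (by simp)
    have h1 : fderiv ℝ (fun w => F w k) z (1, 0) = fderiv ℝ F z (1, 0) k := by
      rw [fderiv_apply hd k]; rfl
    rw [dx_apply, he.fderiv_eq, h1, hFA z z.2, matrixCLM_apply]
    simp [ext0_apply, G]
  · rintro ⟨⟨x, u⟩, hz⟩ hx k
    obtain rfl : x = x₀ := hx
    exact congrFun (hF0 u hz.2) k

theorem smooth_solution_unique (hJ : (J : Set ℝ).OrdConnected) {x₀ : ℝ} (hx₀ : x₀ ∈ J)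
    (A : κ → κ → Smooth 𝕜 J U) {F : κ → Smooth 𝕜 J U}
    (hF : ∀ k, dx 𝕜 J U (F k) = ∑ l, A k l * F l)
    (h0 : ∀ z : Body J U, z.1.1 = x₀ → ∀ k, (F k).1 z = 0) : F = 0 := by
  have hd : ∀ z ∈ Body J U, ∀ k, DifferentiableAt ℝ (ext0 (F k).1) z := fun z hz k =>
    (Smooth.contDiffAt (F k) ⟨z, hz⟩).differentiableAt (by simp)
  have h := linearODE_unique J.isOpen hJ U.isOpen (contDiffOn_matrixCLM A).continuousOn hx₀
    (F := fun z k => ext0 (F k).1 z) ?_ ?_ ?_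
  · funext k
    ext z
    have := congrFun (h z z.2) k
    rwa [ext0_apply] at this
  · exact fun z hz => (differentiableAt_pi.2 fun k => hd z hz k).differentiableWithinAt
  · intro z hz
    funext k
    rw [fderiv_pi fun k => hd z hz k, matrixCLM_apply]
    have h1 := congrArg (fun f : Smooth 𝕜 J U => f.1 ⟨z, hz⟩) (hF k)
    simp only [dx_apply] at h1
    refine h1.trans ?_
    have h2 : ∀ f : Smooth 𝕜 J U, ext0 f.1 z = f.1 ⟨z, hz⟩ := fun f => ext0_apply f.1 ⟨z, hz⟩
    simp [h2]
  · intro u hu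
    funext k
    exact (ext0_apply (F k).1 ⟨(x₀, u), hx₀, hu⟩).trans (h0 _ rfl k)

end SmoothODE

/-! ### Equations `∂ₓ F = T F` in Grassmann coordinates -/

section SuperODE

variable {𝕜 : Type} [RCLike 𝕜] {p : ℕ} {J : TopologicalSpace.Opens ℝ}
  {U : TopologicalSpace.Opens (Fin p → ℝ)} {q : ℕ}

variable (𝕜 q) in
/-- The monomial basis of the Grassmann algebra. -/
def gBasis : Module.Basis (Finset (Fin (q + 1))) 𝕜 (Grassmann 𝕜 q) :=
  (Pi.basisFun 𝕜 (Fin (q + 1))).ExteriorAlgebra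

/-- The coefficient functions of a function on the superline. -/
def coord (s : Finset (Fin (q + 1))) : SFun 𝕜 J U q →ₗ[𝕜] Smooth 𝕜 J U :=
  (TensorProduct.rid 𝕜 (Smooth 𝕜 J U)).toLinearMap ∘ₗ
    TensorProduct.map LinearMap.id ((gBasis 𝕜 q).coord s)

theorem coord_tmul (s : Finset (Fin (q + 1))) (f : Smooth 𝕜 J U) (a : Grassmann 𝕜 q) :
    coord s (f ⊗ₜ[𝕜] a : SFun 𝕜 J U q) = (gBasis 𝕜 q).repr a s • f := rfl

/-- Smooth functions as functions on the superline. -/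
def incl (f : Smooth 𝕜 J U) : SFun 𝕜 J U q := f ⊗ₜ[𝕜] 1

theorem coord_incl_mul (s : Finset (Fin (q + 1))) (g : Smooth 𝕜 J U) (f : SFun 𝕜 J U q) :
    coord s (incl g * f) = g * coord s f := by
  induction f using SFun.induction with
  | h0 => simp
  | hadd f h hf hh => rw [mul_add, map_add, hf, hh, map_add, mul_add]
  | ht f a =>
    rw [incl, tmul_mul_tmul', coord_tmul, coord_tmul, one_mul, mul_smul_comm]

theorem coord_partialX (s : Finset (Fin (q + 1))) (f : SFun 𝕜 J U q) :
    coord s (partialX f) = dx 𝕜 J U (coord s f) := by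
  induction f using SFun.induction with
  | h0 => simp
  | hadd f h hf hh => simp only [map_add, hf, hh]
  | ht f a => rw [partialX_tmul, coord_tmul, coord_tmul, map_smul]

/-- The basis monomials as functions on the superline. -/
def mono (s : Finset (Fin (q + 1))) : SFun 𝕜 J U q := (1 : Smooth 𝕜 J U) ⊗ₜ[𝕜] gBasis 𝕜 q s

theorem sum_coord (f : SFun 𝕜 J U q) : ∑ s, incl (coord s f) * mono s = f := by
  induction f using SFun.induction with
  | h0 => simp [incl]
  | hadd f h hf hh =>
    conv_rhs => rw [← hf, ← hh]
    rw [← Finset.sum_add_distrib]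
    refine Finset.sum_congr rfl fun s _ => ?_
    rw [map_add, incl, TensorProduct.add_tmul, add_mul]
    rfl
  | ht f a =>
    conv_rhs => rw [← (gBasis 𝕜 q).sum_repr a, TensorProduct.tmul_sum]
    refine Finset.sum_congr rfl fun s _ => ?_
    rw [coord_tmul, incl, mono, tmul_mul_tmul', mul_one, one_mul, TensorProduct.smul_tmul]

theorem coord_sum (F : Finset (Fin (q + 1)) → Smooth 𝕜 J U) (s : Finset (Fin (q + 1))) :
    coord s (∑ t, incl (F t) * (mono t : SFun 𝕜 J U q)) = F s := by
  rw [map_sum]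
  simp_rw [coord_incl_mul, mono, coord_tmul]
  rw [Finset.sum_eq_single s]
  · simp
  · intro t _ hts
    simp [hts]
  · simp

theorem SFun.ext_coord {f g : SFun 𝕜 J U q} (h : ∀ s, coord s f = coord s g) : f = g := by
  rw [← sum_coord f, ← sum_coord g]
  simp_rw [h]

variable (𝕜 q) in
/-- Evaluation of the even coordinates at a point. -/
def ev (z : Body J U) : SFun 𝕜 J U q →ₐ[𝕜] Grassmann 𝕜 q :=
  Algebra.TensorProduct.lift
    ((Algebra.ofId 𝕜 (Grassmann 𝕜 q)).comp
      ((Pi.evalAlgHom 𝕜 (fun _ : Body J U => 𝕜) z).comp (Smooth 𝕜 J U).val))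
    (AlgHom.id 𝕜 (Grassmann 𝕜 q)) fun f a =>
      show Commute (algebraMap 𝕜 (Grassmann 𝕜 q) (f.1 z)) a from Algebra.commute_algebraMap_left _ _

theorem ev_tmul (z : Body J U) (f : Smooth 𝕜 J U) (a : Grassmann 𝕜 q) :
    ev 𝕜 q z (f ⊗ₜ[𝕜] a : SFun 𝕜 J U q) = f.1 z • a := by
  rw [Algebra.smul_def]
  rfl

theorem coord_apply (z : Body J U) (s : Finset (Fin (q + 1))) (f : SFun 𝕜 J U q) :
    (coord s f).1 z = (gBasis 𝕜 q).repr (ev 𝕜 q z f) s := by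
  induction f using SFun.induction with
  | h0 => simp
  | hadd f h hf hh =>
    rw [map_add, map_add, map_add, Finsupp.add_apply, ← hf, ← hh]; rfl
  | ht f a =>
    rw [coord_tmul, ev_tmul, map_smul, Finsupp.smul_apply, smul_eq_mul, mul_comm]
    rfl

theorem ev_parityInvolution (z : Body J U) (f : SFun 𝕜 J U q) :
    ev 𝕜 q z (sInv 𝕜 J U q f) = gradeInv (ev 𝕜 q z f) := by
  induction f using SFun.induction with
  | h0 => simp
  | hadd f h hf hh => simp only [map_add, hf, hh]
  | ht f a => rw [parityInvolution_tmul, ev_tmul, ev_tmul, map_smul]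

theorem ev_partialXi (z : Body J U) (f : SFun 𝕜 J U q) :
    ev 𝕜 q z (partialXi f) = contr (LinearMap.proj (0 : Fin (q + 1))) (ev 𝕜 q z f) := by
  induction f using SFun.induction with
  | h0 => simp
  | hadd f h hf hh => simp only [map_add, hf, hh]
  | ht f a => rw [partialXi_tmul, ev_tmul, ev_tmul, map_smul]

variable {k : Type} [Fintype k] [DecidableEq k]

/-- A `C^∞(J × U)`-linear operator in coordinates. -/
def coeffs (T : (k → SFun 𝕜 J U q) →ₗ[𝕜] (k → SFun 𝕜 J U q))
    (a b : k × Finset (Fin (q + 1))) : Smooth 𝕜 J U :=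
  coord a.2 (T (Pi.single b.1 (mono b.2)) a.1)

/-- Since the monomials form a basis over the smooth functions, an operator linear over them is a
matrix of smooth functions. This reduces the super equation to an ordinary one. -/
theorem coord_apply_eq_sum {T : (k → SFun 𝕜 J U q) →ₗ[𝕜] (k → SFun 𝕜 J U q)}
    (hT : ∀ (g : Smooth 𝕜 J U) F, T (fun i => incl g * F i) = fun i => incl g * T F i)
    (F : k → SFun 𝕜 J U q) (a : k × Finset (Fin (q + 1))) :
    coord a.2 (T F a.1) = ∑ b, coeffs T a b * coord b.2 (F b.1) := by
  have h1 : F = ∑ b : k × Finset (Fin (q + 1)),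
      fun i => incl (coord b.2 (F b.1)) * (Pi.single b.1 (mono b.2) : k → SFun 𝕜 J U q) i := by
    funext i
    rw [Finset.sum_apply, Fintype.sum_prod_type, Finset.sum_eq_single i]
    · simp [sum_coord]
    · intro j _ hj
      simp [hj.symm]
    · simp
  conv_lhs => rw [h1]
  rw [map_sum, Finset.sum_apply, map_sum]
  refine Finset.sum_congr rfl fun b _ => ?_
  rw [hT, coord_incl_mul, mul_comm]
  rfl

theorem exists_super_solution (hJ : (J : Set ℝ).OrdConnected) {x₀ : ℝ} (hx₀ : x₀ ∈ J)
    {T : (k → SFun 𝕜 J U q) →ₗ[𝕜] (k → SFun 𝕜 J U q)}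
    (hT : ∀ (g : Smooth 𝕜 J U) F, T (fun i => incl g * F i) = fun i => incl g * T F i)
    (v : k → Grassmann 𝕜 q) :
    ∃ F : k → SFun 𝕜 J U q, (∀ i, partialX (F i) = T F i) ∧
      ∀ z : Body J U, z.1.1 = x₀ → ∀ i, ev 𝕜 q z (F i) = v i := by
  obtain ⟨G, hG, hG0⟩ := exists_smooth_solution hJ hx₀ (coeffs T)
    fun b => (gBasis 𝕜 q).repr (v b.1) b.2
  let F : k → SFun 𝕜 J U q := fun i => ∑ s, incl (G (i, s)) * mono s
  have hFG : ∀ i s, coord s (F i) = G (i, s) := fun i s => coord_sum (fun s => G (i, s)) s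
  refine ⟨F, fun i => SFun.ext_coord fun s => ?_, fun z hz i => ?_⟩
  · rw [coord_partialX, hFG, hG, coord_apply_eq_sum hT F (i, s)]
    simp_rw [hFG]
  · refine (gBasis 𝕜 q).repr.injective (Finsupp.ext fun s => ?_)
    rw [← coord_apply, hFG, hG0 z hz]

theorem super_solution_unique (hJ : (J : Set ℝ).OrdConnected) {x₀ : ℝ} (hx₀ : x₀ ∈ J)
    {T : (k → SFun 𝕜 J U q) →ₗ[𝕜] (k → SFun 𝕜 J U q)}
    (hT : ∀ (g : Smooth 𝕜 J U) F, T (fun i => incl g * F i) = fun i => incl g * T F i)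
    {F : k → SFun 𝕜 J U q} (hF : ∀ i, partialX (F i) = T F i)
    (h0 : ∀ z : Body J U, z.1.1 = x₀ → ∀ i, ev 𝕜 q z (F i) = 0) : F = 0 := by
  have h := smooth_solution_unique hJ hx₀ (coeffs T) (F := fun b => coord b.2 (F b.1))
    (fun a => by rw [← coord_partialX, hF, coord_apply_eq_sum hT])
    (fun z hz b => by rw [coord_apply, h0 z hz]; simp)
  funext i
  exact SFun.ext_coord fun s => (congrFun h (i, s)).trans (by simp)

end SuperODE

/-! ### Fundamental matrix solutions and their parities -/

section Fundamental

variable {𝕜 : Type} [RCLike 𝕜] {p : ℕ} {J : TopologicalSpace.Opens ℝ}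
  {U : TopologicalSpace.Opens (Fin p → ℝ)} {q n : ℕ}

/-- `C^∞(J × U)`-linearity of an operator on matrices of functions. -/
def IsSmoothLinear (T : Matrix (Fin n) (Fin n) (SFun 𝕜 J U q) →ₗ[𝕜]
    Matrix (Fin n) (Fin n) (SFun 𝕜 J U q)) : Prop :=
  ∀ (g : Smooth 𝕜 J U) F, T (F.map (incl g * ·)) = (T F).map (incl g * ·)

theorem mul_incl (f : SFun 𝕜 J U q) (g : Smooth 𝕜 J U) : f * incl g = incl g * f :=
  mul_comm_of_even f _ ((parityInvolution_tmul g 1).trans (by rw [map_one]; rfl))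

theorem isSmoothLinear_mulLeft (A : Matrix (Fin n) (Fin n) (SFun 𝕜 J U q)) :
    IsSmoothLinear (LinearMap.mulLeft 𝕜 A) := by
  intro g F
  ext i j
  simp only [LinearMap.mulLeft_apply, Matrix.mul_apply, Matrix.map_apply, Finset.mul_sum]
  refine Finset.sum_congr rfl fun k _ => ?_
  rw [← mul_assoc, mul_incl, mul_assoc]

theorem isSmoothLinear_mulRight (A : Matrix (Fin n) (Fin n) (SFun 𝕜 J U q)) :
    IsSmoothLinear (LinearMap.mulRight 𝕜 A) := by
  intro g F
  ext i j
  simp only [LinearMap.mulRight_apply, Matrix.mul_apply, Matrix.map_apply, Finset.mul_sum,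
    mul_assoc]

theorem IsSmoothLinear.sub {T T' : Matrix (Fin n) (Fin n) (SFun 𝕜 J U q) →ₗ[𝕜]
    Matrix (Fin n) (Fin n) (SFun 𝕜 J U q)} (h : IsSmoothLinear T) (h' : IsSmoothLinear T') :
    IsSmoothLinear (T - T') := by
  intro g F
  rw [LinearMap.sub_apply, h, h']
  ext i j
  simp [mul_sub]

theorem IsSmoothLinear.neg {T : Matrix (Fin n) (Fin n) (SFun 𝕜 J U q) →ₗ[𝕜]
    Matrix (Fin n) (Fin n) (SFun 𝕜 J U q)} (h : IsSmoothLinear T) : IsSmoothLinear (-T) := by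
  intro g F
  rw [LinearMap.neg_apply, h]
  ext i j
  simp

/-- Operators on matrices as operators on families indexed by pairs. -/
def uncurryOp (T : Matrix (Fin n) (Fin n) (SFun 𝕜 J U q) →ₗ[𝕜]
    Matrix (Fin n) (Fin n) (SFun 𝕜 J U q)) :
    (Fin n × Fin n → SFun 𝕜 J U q) →ₗ[𝕜] (Fin n × Fin n → SFun 𝕜 J U q) where
  toFun F a := T (Matrix.of fun i j => F (i, j)) a.1 a.2
  map_add' F G := by
    funext a
    exact congrFun (congrFun (map_add T (Matrix.of fun i j => F (i, j))
      (Matrix.of fun i j => G (i, j))) a.1) a.2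
  map_smul' c F := by
    funext a
    exact congrFun (congrFun (map_smul T c (Matrix.of fun i j => F (i, j))) a.1) a.2

theorem exists_matrix_solution (hJ : (J : Set ℝ).OrdConnected) {x₀ : ℝ} (hx₀ : x₀ ∈ J)
    {T : Matrix (Fin n) (Fin n) (SFun 𝕜 J U q) →ₗ[𝕜] Matrix (Fin n) (Fin n) (SFun 𝕜 J U q)}
    (hT : IsSmoothLinear T) :
    ∃ F : Matrix (Fin n) (Fin n) (SFun 𝕜 J U q), F.map partialX = T F ∧
      ∀ z : Body J U, z.1.1 = x₀ → F.map (ev 𝕜 q z) = 1 := by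
  obtain ⟨F, hF, hF0⟩ := exists_super_solution hJ hx₀ (T := uncurryOp T)
    (fun g F => funext fun a => congrFun (congrFun (hT g (Matrix.of fun i j => F (i, j))) a.1) a.2)
    fun a => (1 : Matrix (Fin n) (Fin n) (Grassmann 𝕜 q)) a.1 a.2
  refine ⟨Matrix.of fun i j => F (i, j), ?_, fun z hz => ?_⟩
  · ext i j
    exact hF (i, j)
  · ext i j
    exact hF0 z hz (i, j)

theorem matrix_solution_unique (hJ : (J : Set ℝ).OrdConnected) {x₀ : ℝ} (hx₀ : x₀ ∈ J)
    {T : Matrix (Fin n) (Fin n) (SFun 𝕜 J U q) →ₗ[𝕜] Matrix (Fin n) (Fin n) (SFun 𝕜 J U q)}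
    (hT : IsSmoothLinear T) {F : Matrix (Fin n) (Fin n) (SFun 𝕜 J U q)}
    (hF : F.map partialX = T F) (h0 : ∀ z : Body J U, z.1.1 = x₀ → F.map (ev 𝕜 q z) = 0) :
    F = 0 := by
  have h := super_solution_unique hJ hx₀ (T := uncurryOp T)
    (fun g F => funext fun a => congrFun (congrFun (hT g (Matrix.of fun i j => F (i, j))) a.1) a.2)
    (F := fun a => F a.1 a.2) (fun a => congrFun (congrFun hF a.1) a.2)
    (fun z hz a => congrFun (congrFun (h0 z hz) a.1) a.2)
  ext i j
  exact congrFun h (i, j)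

theorem matrix_solution_ext (hJ : (J : Set ℝ).OrdConnected) {x₀ : ℝ} (hx₀ : x₀ ∈ J)
    {T : Matrix (Fin n) (Fin n) (SFun 𝕜 J U q) →ₗ[𝕜] Matrix (Fin n) (Fin n) (SFun 𝕜 J U q)}
    (hT : IsSmoothLinear T) {F G : Matrix (Fin n) (Fin n) (SFun 𝕜 J U q)}
    (hF : F.map partialX = T F) (hG : G.map partialX = T G)
    (h0 : ∀ z : Body J U, z.1.1 = x₀ → F.map (ev 𝕜 q z) = G.map (ev 𝕜 q z)) :
    F = G := by
  refine sub_eq_zero.1 (matrix_solution_unique hJ hx₀ hT ?_ fun z hz => ?_)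
  · rw [map_sub, ← hF, ← hG]
    ext i j
    simp
  · have := h0 z hz
    rw [← sub_eq_zero] at this
    rw [← this]
    ext i j
    simp

theorem map_partialX_mul (A B : Matrix (Fin n) (Fin n) (SFun 𝕜 J U q)) :
    (A * B).map partialX = A.map partialX * B + A * B.map partialX := by
  ext i j
  simp [Matrix.mul_apply, map_sum, partialX_mul, Finset.sum_add_distrib]

theorem map_partialXi_mul (A B : Matrix (Fin n) (Fin n) (SFun 𝕜 J U q)) :
    (A * B).map partialXi = A.map partialXi * B + A.map (sInv 𝕜 J U q) * B.map partialXi := by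
  ext i j
  simp [Matrix.mul_apply, map_sum, partialXi_mul, Finset.sum_add_distrib]

theorem map_partialX_one : (1 : Matrix (Fin n) (Fin n) (SFun 𝕜 J U q)).map partialX = 0 := by
  have := map_partialX_mul (1 : Matrix (Fin n) (Fin n) (SFun 𝕜 J U q)) 1
  simpa using this

theorem map_ev_mul (z : Body J U) (A B : Matrix (Fin n) (Fin n) (SFun 𝕜 J U q)) :
    (A * B).map (ev 𝕜 q z) = A.map (ev 𝕜 q z) * B.map (ev 𝕜 q z) :=
  Matrix.map_mul (f := (ev 𝕜 q z : SFun 𝕜 J U q →+* Grassmann 𝕜 q))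

theorem map_ev_one (z : Body J U) :
    (1 : Matrix (Fin n) (Fin n) (SFun 𝕜 J U q)).map (ev 𝕜 q z) = 1 :=
  Matrix.map_one _ (map_zero _) (map_one _)

/-- Fundamental solutions are invertible. -/
theorem isUnit_of_matrix_solution (hJ : (J : Set ℝ).OrdConnected) {x₀ : ℝ} (hx₀ : x₀ ∈ J)
    {A Φ : Matrix (Fin n) (Fin n) (SFun 𝕜 J U q)} (hΦ : Φ.map partialX = A * Φ)
    (h0 : ∀ z : Body J U, z.1.1 = x₀ → Φ.map (ev 𝕜 q z) = 1) : IsUnit Φ := by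
  -- The candidate inverse solves the adjoint equation `∂ₓ Ψ = -Ψ A`.
  obtain ⟨Ψ, hΨ, hΨ0⟩ := exists_matrix_solution hJ hx₀ (isSmoothLinear_mulRight A).neg
  rw [LinearMap.neg_apply, LinearMap.mulRight_apply] at hΨ
  refine isUnit_iff_exists.2 ⟨Ψ, ?_, ?_⟩
  -- Both `Φ Ψ` and `1` solve `∂ₓ X = A X - X A` with the same initial value.
  · refine matrix_solution_ext hJ hx₀
      ((isSmoothLinear_mulLeft A).sub (isSmoothLinear_mulRight A)) ?_ ?_ fun z hz => ?_
    · rw [map_partialX_mul, hΦ, hΨ, LinearMap.sub_apply, LinearMap.mulLeft_apply,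
        LinearMap.mulRight_apply]
      noncomm_ring
    · rw [map_partialX_one, LinearMap.sub_apply, LinearMap.mulLeft_apply,
        LinearMap.mulRight_apply]
      simp
    · rw [map_ev_mul, h0 z hz, hΨ0 z hz, map_ev_one, one_mul]
  -- In the other order the derivative of `Ψ Φ` vanishes identically.
  · refine matrix_solution_ext hJ hx₀ (isSmoothLinear_mulLeft 0) ?_ ?_ fun z hz => ?_
    · rw [map_partialX_mul, hΦ, hΨ, LinearMap.mulLeft_apply]
      noncomm_ring
    · rw [map_partialX_one, LinearMap.mulLeft_apply, zero_mul]
    · rw [map_ev_mul, h0 z hz, hΨ0 z hz, map_ev_one, one_mul]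

/-- Conjugation of a matrix by the parity of its rows and columns. -/
def signConj (A : Matrix (Fin n) (Fin n) (SFun 𝕜 J U q)) :
    Matrix (Fin n) (Fin n) (SFun 𝕜 J U q) :=
  Matrix.of fun i j => (-1 : 𝕜) ^ ((i : ℕ) + j) • sInv 𝕜 J U q (A i j)

/-- The summation index enters the sign twice. Hence sign conjugation maps solutions of a linear
system to solutions of the conjugated one, and uniqueness yields the parities of the entries. -/
theorem signConj_mul (A B : Matrix (Fin n) (Fin n) (SFun 𝕜 J U q)) :
    signConj (A * B) = signConj A * signConj B := by
  ext i j
  simp only [signConj, Matrix.of_apply, Matrix.mul_apply, map_sum, map_mul, Finset.smul_sum,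
    smul_mul_smul_comm, ← pow_add]
  refine Finset.sum_congr rfl fun k _ => ?_
  congr 1
  rw [neg_one_pow_eq_pow_mod_two, neg_one_pow_eq_pow_mod_two (n := _ + (_ + _))]
  congr 1; omega

theorem hasPar_of_signConj {A : Matrix (Fin n) (Fin n) (SFun 𝕜 J U q)} {e : ℕ}
    (h : signConj A = (-1 : 𝕜) ^ e • A) (i j : Fin n) :
    (superD 𝕜 J U q).HasPar ((i : ℕ) + j + e) (A i j) := by
  have h1 := congrFun (congrFun h i) j
  rw [signConj, Matrix.of_apply, Matrix.smul_apply] at h1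
  have h2 := congrArg (fun f => (-1 : 𝕜) ^ ((i : ℕ) + j) • f) h1
  simp only [smul_smul, ← pow_add] at h2
  rw [← two_mul, pow_mul, neg_one_sq, one_pow, one_smul] at h2
  exact h2

theorem signConj_of_hasPar {A : Matrix (Fin n) (Fin n) (SFun 𝕜 J U q)} {e : ℕ}
    (h : ∀ i j : Fin n, (superD 𝕜 J U q).HasPar ((i : ℕ) + j + e) (A i j)) :
    signConj A = (-1 : 𝕜) ^ e • A := by
  ext i j
  rw [signConj, Matrix.of_apply, Matrix.smul_apply, show sInv 𝕜 J U q (A i j) = _ from h i j,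
    smul_smul, ← pow_add, ← add_assoc, ← two_mul, pow_add, pow_mul, neg_one_sq, one_pow, one_mul]

theorem signConj_map_partialX (A : Matrix (Fin n) (Fin n) (SFun 𝕜 J U q)) :
    signConj (A.map partialX) = (signConj A).map partialX := by
  ext i j
  simp [signConj, parityInvolution_partialX]

end Fundamental

/-! ### First order systems for `D` and solutions of monic operators -/

section SuperSystem

variable {𝕜 : Type} [RCLike 𝕜] {p : ℕ} {J : TopologicalSpace.Opens ℝ}
  {U : TopologicalSpace.Opens (Fin p → ℝ)} {q n : ℕ}

/-- The scalar matrix `ξ`. -/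
def xiMatrix : Matrix (Fin n) (Fin n) (SFun 𝕜 J U q) := Matrix.diagonal fun _ => xi

theorem xiMatrix_mul_apply (C : Matrix (Fin n) (Fin n) (SFun 𝕜 J U q)) (i j : Fin n) :
    (xiMatrix * C : Matrix (Fin n) (Fin n) (SFun 𝕜 J U q)) i j = xi * C i j :=
  Matrix.diagonal_mul _ _ _ _

theorem mul_xiMatrix (C : Matrix (Fin n) (Fin n) (SFun 𝕜 J U q)) :
    C * xiMatrix = xiMatrix * C.map (sInv 𝕜 J U q) := by
  ext i j
  rw [xiMatrix_mul_apply, xiMatrix, Matrix.mul_diagonal, mul_xi, Matrix.map_apply]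

theorem xiMatrix_mul_xiMatrix :
    (xiMatrix * xiMatrix : Matrix (Fin n) (Fin n) (SFun 𝕜 J U q)) = 0 := by
  simp [xiMatrix, xi_mul_xi]

theorem map_partialX_xiMatrix_mul (C : Matrix (Fin n) (Fin n) (SFun 𝕜 J U q)) :
    (xiMatrix * C).map partialX = xiMatrix * C.map partialX := by
  ext i j
  rw [xiMatrix_mul_apply, Matrix.map_apply, xiMatrix_mul_apply, partialX_mul, partialX_xi, zero_mul,
    zero_add, Matrix.map_apply]

theorem map_partialXi_xiMatrix_mul (C : Matrix (Fin n) (Fin n) (SFun 𝕜 J U q)) :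
    (xiMatrix * C).map partialXi = C - xiMatrix * C.map partialXi := by
  ext i j
  rw [Matrix.sub_apply, Matrix.map_apply, xiMatrix_mul_apply, xiMatrix_mul_apply, partialXi_mul,
    partialXi_xi, one_mul, parityInvolution_xi, Matrix.map_apply, neg_mul, sub_eq_add_neg]

theorem map_D (C : Matrix (Fin n) (Fin n) (SFun 𝕜 J U q)) :
    C.map D = C.map partialXi + xiMatrix * C.map partialX := by
  ext i j
  rw [Matrix.add_apply, xiMatrix_mul_apply]
  rfl

theorem hasPar_xi : (superD 𝕜 J U q).HasPar 1 xi := by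
  unfold OddDerivation.HasPar
  rw [pow_one, neg_one_smul]
  exact parityInvolution_xi

theorem HasPar.partialXi {k : ℕ} {f : SFun 𝕜 J U q} (hf : (superD 𝕜 J U q).HasPar k f) :
    (superD 𝕜 J U q).HasPar (k + 1) (partialXi f) := by
  have h : sInv 𝕜 J U q f = (-1 : 𝕜) ^ k • f := hf
  have : sInv 𝕜 J U q (Superline.partialXi f) = (-1 : 𝕜) ^ (k + 1) • Superline.partialXi f := by
    rw [parityInvolution_partialXi, h, map_smul, pow_succ, mul_neg_one, neg_smul]
  exact this

/-- This is the expansion of `B F` for `x = ξ`, `B = b + ξ c` and `F = (1 + ξ b) y`; the primes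
denote the parity twist. -/
theorem mul_add_mul_of_sq_zero {A : Type*} [Ring A] {x b b' c c' : A} (hx : x * x = 0)
    (hb : b * x = x * b') (hc : c * x = x * c') (y : A) :
    (b + x * c) * (y + x * (b * y)) = b * y + x * ((c + b' * b) * y) := by
  have h1 : b * (x * (b * y)) = x * (b' * (b * y)) := by rw [← mul_assoc, hb, mul_assoc]
  have h2 : x * c * (x * (b * y)) = 0 := by
    rw [mul_assoc, ← mul_assoc c, hc, mul_assoc, ← mul_assoc, hx, zero_mul]
  rw [add_mul, mul_add, mul_add, h1, h2, add_mul c, mul_add, mul_assoc, mul_assoc b']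
  abel

-- With `B = B₀ + ξ B₁` and `F = (1 + ξ B₀) Φ`, where `∂_ξ Φ = 0`, one finds `D F = B₀ Φ + ξ ∂ₓ Φ`
-- and `B F = B₀ Φ + ξ A Φ`. So it suffices that `∂ₓ Φ = A Φ`.
set_option maxHeartbeats 1000000 in
theorem exists_D_solution (hJ : (J : Set ℝ).OrdConnected)
    {B : Matrix (Fin n) (Fin n) (SFun 𝕜 J U q)}
    (hB : ∀ i j : Fin n, (superD 𝕜 J U q).HasPar ((i : ℕ) + j + 1) (B i j)) :
    ∃ F : Matrix (Fin n) (Fin n) (SFun 𝕜 J U q), IsUnit F ∧ F.map D = B * F ∧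
      ∀ i j : Fin n, (superD 𝕜 J U q).HasPar ((i : ℕ) + j) (F i j) := by
  -- Without a base point the algebra of functions is zero and everything is trivial.
  rcases (J : Set ℝ).eq_empty_or_nonempty with hJe | ⟨x₀, hx₀⟩
  · have : IsEmpty (Body J U) := ⟨fun z => by
      have := z.2.1
      rw [hJe] at this
      exact this⟩
    have h1 : (1 : Smooth 𝕜 J U) = 0 := by
      ext z
      exact isEmptyElim z
    have : Subsingleton (SFun 𝕜 J U q) := subsingleton_of_zero_eq_one <| by
      rw [Algebra.TensorProduct.one_def, h1, TensorProduct.zero_tmul]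
    exact ⟨1, isUnit_one, Subsingleton.elim _ _, fun i j => Subsingleton.elim _ _⟩
  · set B₁ := B.map partialXi with hB₁
    set B₀ := B - xiMatrix * B₁ with hB₀
    set A := B₁ + B₀.map (sInv 𝕜 J U q) * B₀ with hA
    have dB₁ : B₁.map partialXi = 0 := by
      ext i j; simp [hB₁, partialXi_partialXi]
    have dB₀ : B₀.map partialXi = 0 := by
      have : B₀.map partialXi = B.map partialXi - (xiMatrix * B₁).map partialXi := by
        ext i j; simp [hB₀]
      rw [this, map_partialXi_xiMatrix_mul, dB₁, mul_zero, sub_zero, sub_self]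
    have dPB₀ : (B₀.map (sInv 𝕜 J U q)).map partialXi = 0 := by
      ext i j
      have h : partialXi (B₀ i j) = 0 := congrFun (congrFun dB₀ i) j
      have h2 := parityInvolution_partialXi (B₀ i j)
      rw [h, map_zero] at h2
      exact neg_eq_zero.1 h2.symm
    have dA : A.map partialXi = 0 := by
      have : A.map partialXi = B₁.map partialXi + (B₀.map (sInv 𝕜 J U q) * B₀).map partialXi := by
        ext i j; simp [hA]
      rw [this, map_partialXi_mul, dB₁, dPB₀, dB₀, zero_mul, mul_zero, add_zero, add_zero]
    obtain ⟨Φ, hΦ, hΦ0⟩ := exists_matrix_solution hJ hx₀ (isSmoothLinear_mulLeft A)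
    rw [LinearMap.mulLeft_apply] at hΦ
    -- As `∂_ξ A = 0`, the matrix `∂_ξ Φ` solves the linear equation with coefficient `P(A)`, and
    -- its initial value is `∂_ξ 1 = 0`.
    have dΦ : Φ.map partialXi = 0 := by
      refine matrix_solution_unique hJ hx₀ (isSmoothLinear_mulLeft (A.map (sInv 𝕜 J U q))) ?_
        fun z hz => ?_
      · have h1 : (Φ.map partialXi).map partialX = (Φ.map partialX).map partialXi := by
          ext i j; simp [partialXi_partialX]
        rw [h1, hΦ, map_partialXi_mul, dA, zero_mul, zero_add, LinearMap.mulLeft_apply]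
      · ext i j
        have h1 : ev 𝕜 q z (Φ i j) = (1 : Matrix (Fin n) (Fin n) (Grassmann 𝕜 q)) i j :=
          congrFun (congrFun (hΦ0 z hz) i) j
        rw [Matrix.map_apply, Matrix.map_apply, ev_partialXi, h1, Matrix.one_apply]
        split_ifs
        · exact CliffordAlgebra.contractLeft_one _ _
        · exact map_zero _
    have pB₁ : ∀ i j : Fin n, (superD 𝕜 J U q).HasPar ((i : ℕ) + j) (B₁ i j) := fun i j =>
      (HasPar.partialXi (hB i j)).congr (by omega)
    have pXB : ∀ i j : Fin n, (superD 𝕜 J U q).HasPar ((i : ℕ) + j + 1)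
        ((xiMatrix * B₁ : Matrix (Fin n) (Fin n) (SFun 𝕜 J U q)) i j) :=
      fun i j => by
        rw [xiMatrix_mul_apply]
        exact (hasPar_xi.mul (pB₁ i j)).congr (by omega)
    have pB₀ : ∀ i j : Fin n, (superD 𝕜 J U q).HasPar ((i : ℕ) + j + 1) (B₀ i j) :=
      fun i j => (hB i j).sub (pXB i j)
    have pA : ∀ i j : Fin n, (superD 𝕜 J U q).HasPar ((i : ℕ) + j) (A i j) := fun i j => by
      refine (pB₁ i j).add ?_
      rw [Matrix.mul_apply]
      exact .sum fun k _ => ((pB₀ i k).map_P.mul (pB₀ k j)).congr (by omega)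
    -- The coefficient matrix and the initial value `1` are fixed by sign conjugation, so the
    -- solution is as well.
    have pΦ : signConj Φ = Φ := by
      refine matrix_solution_ext hJ hx₀ (isSmoothLinear_mulLeft A) ?_ hΦ fun z hz => ?_
      · have h1 : signConj A = A := by
          have := signConj_of_hasPar (e := 0) pA
          rwa [pow_zero, one_smul] at this
        rw [← signConj_map_partialX, hΦ, signConj_mul, h1, LinearMap.mulLeft_apply]
      · rw [hΦ0 z hz]
        ext i j
        have h1 : ev 𝕜 q z (Φ i j) = (1 : Matrix (Fin n) (Fin n) (Grassmann 𝕜 q)) i j :=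
          congrFun (congrFun (hΦ0 z hz) i) j
        rw [Matrix.map_apply, signConj, Matrix.of_apply, map_smul, ev_parityInvolution, h1,
          Matrix.one_apply]
        split_ifs with hij
        · subst hij
          rw [map_one, ← two_mul, pow_mul, neg_one_sq, one_pow, one_smul]
        · rw [map_zero, smul_zero]
    have pΦ' : ∀ i j : Fin n, (superD 𝕜 J U q).HasPar ((i : ℕ) + j) (Φ i j) := fun i j => by
      have := hasPar_of_signConj (A := Φ) (e := 0) (by rw [pΦ, pow_zero, one_smul]) i j
      exact this
    refine ⟨(1 + xiMatrix * B₀) * Φ, IsUnit.mul ?_ (isUnit_of_matrix_solution hJ hx₀ hΦ hΦ0),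
      ?_, fun i j => ?_⟩
    · have hsq : xiMatrix * B₀ * (xiMatrix * B₀) = 0 := by
        rw [mul_assoc, ← mul_assoc B₀, mul_xiMatrix, mul_assoc, ← mul_assoc xiMatrix xiMatrix,
          xiMatrix_mul_xiMatrix, zero_mul]
      refine isUnit_iff_exists.2 ⟨1 - xiMatrix * B₀, ?_, ?_⟩
      · rw [mul_sub, add_mul, add_mul, hsq]; simp
      · rw [sub_mul, mul_add, mul_add, hsq]; simp
    · have e1 : (1 + xiMatrix * B₀) * Φ = Φ + xiMatrix * (B₀ * Φ) := by
        rw [add_mul, one_mul, mul_assoc]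
      have e2 : (Φ + xiMatrix * (B₀ * Φ)).map D = B₀ * Φ + xiMatrix * (A * Φ) := by
        have s1 : (Φ + xiMatrix * (B₀ * Φ)).map partialXi
            = Φ.map partialXi + (xiMatrix * (B₀ * Φ)).map partialXi := by ext i j; simp
        have s2 : (Φ + xiMatrix * (B₀ * Φ)).map partialX
            = Φ.map partialX + (xiMatrix * (B₀ * Φ)).map partialX := by ext i j; simp
        rw [map_D, s1, s2, map_partialXi_xiMatrix_mul, map_partialX_xiMatrix_mul,
          map_partialXi_mul, dΦ, dB₀, hΦ, mul_add _ (A * Φ), ← mul_assoc xiMatrix xiMatrix,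
          xiMatrix_mul_xiMatrix]
        simp
      have e3 : B = B₀ + xiMatrix * B₁ := by rw [hB₀, sub_add_cancel]
      rw [e1, e2, hA]
      conv_rhs => rw [e3]
      exact (mul_add_mul_of_sq_zero xiMatrix_mul_xiMatrix (mul_xiMatrix B₀) (mul_xiMatrix B₁)
        Φ).symm
    · rw [add_mul, one_mul, mul_assoc, Matrix.add_apply, xiMatrix_mul_apply, Matrix.mul_apply]
      refine (pΦ' i j).add ?_
      refine (hasPar_xi.mul (k := 1) (l := (i : ℕ) + j + 1)
        (.sum fun k _ => ((pB₀ i k).mul (pΦ' k j)).congr ?_)).congr ?_ <;> omega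

/-- A monic operator has a full system of homogeneous solutions. -/
theorem exists_solutions (hJ : (J : Set ℝ).OrdConnected) {M : Module.End 𝕜 (SFun 𝕜 J U q)}
    (hM : (superD 𝕜 J U q).IsMonic n M) :
    ∃ φ : Fin n → SFun 𝕜 J U q, (∀ j : Fin n, (superD 𝕜 J U q).HasPar j (φ j)) ∧
      (∀ j, M (φ j) = 0) ∧ IsUnit ((superD 𝕜 J U q).wronski φ) := by
  obtain ⟨_, ⟨b, hb, rfl⟩, rfl⟩ := hM
  rcases Nat.eq_zero_or_pos n with rfl | hn
  · exact ⟨Fin.elim0, fun j => j.elim0, fun j => j.elim0,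
      ⟨1, Subsingleton.elim _ _⟩⟩
  -- In the companion system each row of `F` is `D` of the previous one, so `F` is the Wroński
  -- matrix of its first row, and the last row encodes `M`.
  let B : Matrix (Fin n) (Fin n) (SFun 𝕜 J U q) := Matrix.of fun i j =>
    if (i : ℕ) + 1 < n then (if (j : ℕ) = i + 1 then 1 else 0) else -b j
  obtain ⟨F, hFu, hF, hFp⟩ := exists_D_solution hJ (B := B) fun i j => by
    simp only [B, Matrix.of_apply]
    split_ifs with h1 h2
    · exact OddDerivation.HasPar.one.congr (by omega)
    · exact .zero
    · exact (hb j).neg.congr (by omega)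
  have hDF : ∀ i j : Fin n, D (F i j) = ∑ k, B i k * F k j := fun i j =>
    congrFun (congrFun hF i) j
  have hpow : ∀ (i : ℕ) (hi : i < n) (j : Fin n), (D ^ i) (F ⟨0, hn⟩ j) = F ⟨i, hi⟩ j := by
    intro i
    induction i with
    | zero => intro hi j; rfl
    | succ i ih =>
      intro hi j
      rw [pow_succ', Module.End.mul_apply, ih (by omega), hDF,
        Finset.sum_eq_single (⟨i + 1, hi⟩ : Fin n)]
      · simp [B, hi]
      · intro k _ hk
        have : (k : ℕ) ≠ i + 1 := fun h => hk (Fin.ext h)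
        simp [B, hi, this]
      · simp
  refine ⟨F ⟨0, hn⟩, fun j => ?_, fun j => ?_, ?_⟩
  · simpa using hFp ⟨0, hn⟩ j
  · have h1 : (D ^ n) (F ⟨0, hn⟩ j) = -∑ k : Fin n, b k * F k j := by
      obtain ⟨n, rfl⟩ : ∃ k, n = k + 1 := ⟨n - 1, by omega⟩
      rw [pow_succ', Module.End.mul_apply, hpow n (by omega), hDF, ← Finset.sum_neg_distrib]
      refine Finset.sum_congr rfl fun k _ => ?_
      simp [B]
    have h2 : (∑ k ∈ Finset.range n, LinearMap.mulLeft 𝕜 (b k) * (superD 𝕜 J U q).D ^ k)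
        (F ⟨0, hn⟩ j) = ∑ k : Fin n, b k * F k j := by
      rw [Finset.sum_range, LinearMap.sum_apply]
      refine Finset.sum_congr rfl fun k _ => ?_
      exact congrArg (b k * ·) (hpow k k.2 j)
    rw [LinearMap.add_apply, h2]
    exact (congrArg (· + _) h1).trans (neg_add_cancel _)
  · convert hFu
    ext i j
    exact hpow i i.2 j

end SuperSystem

/-! ### Wronskian quotients -/

namespace OddDerivation

variable {𝕜 R : Type} [Field 𝕜] [Ring R] [Algebra 𝕜 R] {S : OddDerivation 𝕜 R}

/-- A monic operator is a quotient of Berezinians of Wroński matrices of its solutions. -/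
theorem IsMonic.ber_wronski_snoc [NeZero (2 : 𝕜)] {r : ℕ} {φ : Fin r → R}
    (hφ : IsUnit (S.wronski φ)) (hφp : ∀ i : Fin r, S.HasPar i (φ i)) {M : Module.End 𝕜 R}
    (hM : S.IsMonic r M) (h : ∀ j, M (φ j) = 0) {par : Fin (r + 1) → ZMod 2}
    (hpar : ∀ i j : Fin (r + 1), ((i : ℕ) + j) % 2 = ((par i).val + (par j).val) % 2)
    (hlast : par (Fin.last r) = 0) (ψ : R) :
    ber par (S.wronski (Fin.snoc φ ψ : Fin (r + 1) → R))
      = ber (par ∘ Fin.castSucc) (S.wronski φ) * M ψ := by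
  obtain ⟨A, hA⟩ := hφ
  -- These coefficients fit the first `r` rows of the `ψ` column; in row `r` the defect is `M ψ`,
  -- because `M` kills every `φ j`.
  set c : Fin r → R :=
    (↑A⁻¹ : Matrix (Fin r) (Fin r) R).mulVec fun i : Fin r => (S.D ^ (i : ℕ)) ψ with hc
  have hAc : ∀ i : Fin r, (S.D ^ (i : ℕ)) ψ = ∑ j, (S.D ^ (i : ℕ)) (φ j) * c j := by
    have : (S.wronski φ).mulVec c = fun i : Fin r => (S.D ^ (i : ℕ)) ψ := by
      rw [hc, Matrix.mulVec_mulVec, ← hA, Units.mul_inv, Matrix.one_mulVec]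
    exact fun i => (congrFun this i).symm
  have hsub : (S.wronski (Fin.snoc φ ψ : Fin (r + 1) → R)).submatrix Fin.castSucc Fin.castSucc
      = S.wronski φ := by
    ext i j
    simp [wronski]
  have hber := ber_eq_mul (S := S) (f := (Fin.castSucc : Fin r → Fin (r + 1)))
    (Fin.castSucc_injective r) (t := Fin.last r) Fin.le_last (fun i => (Fin.castSucc_lt_last i).ne)
    (fun i hi => ⟨i.castPred hi, Fin.castSucc_castPred i hi⟩) (par := par) hlast
    (X := S.wronski (Fin.snoc φ ψ : Fin (r + 1) → R)) ?_ (by rw [hsub]; exact ⟨A, hA⟩)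
    (c := Fin.snoc c 0) (by simp) (w := M ψ) ?_
  · rw [hber, hsub]
  · intro i j hj
    obtain ⟨j, rfl⟩ : ∃ j', Fin.castSucc j' = j := ⟨j.castPred hj, Fin.castSucc_castPred j hj⟩
    have : S.wronski (Fin.snoc φ ψ : Fin (r + 1) → R) i j.castSucc = (S.D ^ (i : ℕ)) (φ j) := by
      simp [wronski]
    rw [this]
    refine ((hφp j).map_D_pow i).congr ?_
    rw [← hpar, Fin.val_castSucc, add_comm]
  · have hmul : ∀ i : Fin (r + 1), (S.wronski (Fin.snoc φ ψ : Fin (r + 1) → R)).mulVec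
        (Fin.snoc c 0 : Fin (r + 1) → R) i = ∑ j, (S.D ^ (i : ℕ)) (φ j) * c j := by
      intro i
      rw [Matrix.mulVec, dotProduct, Fin.sum_univ_castSucc]
      simp [wronski]
    have hval : ∀ i : Fin (r + 1), S.wronski (Fin.snoc φ ψ : Fin (r + 1) → R) i (Fin.last r)
        = (S.D ^ (i : ℕ)) ψ := by
      intro i
      simp [wronski]
    intro i
    rw [hmul, hval]
    induction i using Fin.lastCases with
    | cast i =>
      rw [Pi.single_eq_of_ne (Fin.castSucc_lt_last i).ne, add_zero]
      exact hAc i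
    | last =>
      rw [Pi.single_eq_same, Fin.val_last]
      obtain ⟨_, ⟨b, hb, rfl⟩, rfl⟩ := hM
      have hexp : ∀ g, (S.D ^ r + ∑ k ∈ Finset.range r, LinearMap.mulLeft 𝕜 (b k) * S.D ^ k) g
          = (S.D ^ r) g + ∑ k : Fin r, b k * (S.D ^ (k : ℕ)) g := by
        intro g
        rw [LinearMap.add_apply, LinearMap.sum_apply, Finset.sum_range]
        rfl
      simp only [hexp] at h ⊢
      have h1 : ∀ j, (S.D ^ r) (φ j) = -∑ k : Fin r, b k * (S.D ^ (k : ℕ)) (φ j) := fun j =>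
        eq_neg_of_add_eq_zero_left (h j)
      have h2 : ∑ k : Fin r, b k * (S.D ^ (k : ℕ)) ψ
          = ∑ j, (∑ k : Fin r, b k * (S.D ^ (k : ℕ)) (φ j)) * c j := by
        simp_rw [hAc, Finset.mul_sum, Finset.sum_mul, mul_assoc]
        exact Finset.sum_comm
      simp only [h1, neg_mul, Finset.sum_neg_distrib, h2]
      abel

end OddDerivation

/-! ### The correspondence and the Wronskian formulas -/

section Main

variable {𝕜 : Type} [RCLike 𝕜] {p : ℕ} {J : TopologicalSpace.Opens ℝ}
  {U : TopologicalSpace.Opens (Fin p → ℝ)} {q : ℕ}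

theorem isNondegenerateOp_iff {a : SFun 𝕜 J U q} {m : ℕ} {L : Module.End 𝕜 (SFun 𝕜 J U q)} :
    IsNondegenerateOp a m L ↔ IsUnit a ∧ (superD 𝕜 J U q).HasPar 0 a ∧
      (superD 𝕜 J U q).IsNondegenerate a m L := by
  refine and_congr_right fun _ => and_congr_right fun _ => ⟨?_, ?_⟩
  · rintro ⟨b, hb, rfl⟩
    exact ⟨_, Submodule.sum_mem _ fun j _ =>
      OddDerivation.mulLeft_mul_D_pow_mem_Op (S := superD 𝕜 J U q) (hb j) j.2, rfl⟩
  · rintro ⟨_, ⟨b, hb, rfl⟩, rfl⟩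
    exact ⟨fun j => b j, fun j => hb j, by rw [Finset.sum_range]; rfl⟩

theorem isMonicOp_iff {m : ℕ} {L : Module.End 𝕜 (SFun 𝕜 J U q)} :
    IsMonicOp m L ↔ (superD 𝕜 J U q).IsMonic m L := by
  have h1 : (LinearMap.mulLeft 𝕜 (1 : SFun 𝕜 J U q)) = 1 := LinearMap.mulLeft_one 𝕜 _
  rw [IsMonicOp, isNondegenerateOp_iff, OddDerivation.IsNondegenerate, h1, one_mul]
  exact ⟨fun h => h.2.2, fun h => ⟨isUnit_one, .one, h⟩⟩

/-- Solutions with invertible Wroński matrix form a basis of the kernel. -/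
theorem isAlternatingBasis_ker {r : ℕ} {φ : Fin r → SFun 𝕜 J U q}
    (hφ : IsUnit (wronskiMatrix φ)) (hp : ∀ i : Fin r, HasParity i (φ i))
    {M : Module.End 𝕜 (SFun 𝕜 J U q)} (hM : (superD 𝕜 J U q).IsMonic r M)
    (h : ∀ j, M (φ j) = 0) : IsAlternatingBasis φ (LinearMap.ker M) := by
  refine ⟨hp, fun f => ?_, fun c hc h0 => ?_⟩
  · rw [LinearMap.mem_ker, OddDerivation.IsMonic.ker_iff (S := superD 𝕜 J U q) hφ hM h f]
    simp only [isConst_iff]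
    rfl
  · exact OddDerivation.const_independent_of_isUnit_wronski (S := superD 𝕜 J U q) hφ
      (fun i => (isConst_iff _).1 (hc i)) h0

theorem IsBasisOver.mem {ι : Type} [Fintype ι] {φ : ι → SFun 𝕜 J U q}
    {V : Submodule 𝕜 (SFun 𝕜 J U q)} (h : IsBasisOver φ V) (i : ι) : φ i ∈ V := by
  classical
  refine (h.1 _).2 ⟨Pi.single i 1, fun j => ?_, ?_⟩
  · rw [isConst_iff]
    by_cases hj : j = i
    · subst hj
      rw [Pi.single_eq_same]
      have h2 := (superD 𝕜 J U q).leibniz 1 1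
      rw [map_one (superD 𝕜 J U q).P, mul_one, one_mul, mul_one, left_eq_add] at h2
      exact h2
    · rw [Pi.single_eq_of_ne hj, map_zero]
  · rw [Finset.sum_eq_single i] <;> simp +contextual

theorem IsBasisOver.reindex {ι κ : Type} [Fintype ι] [Fintype κ] {φ : ι → SFun 𝕜 J U q}
    {V : Submodule 𝕜 (SFun 𝕜 J U q)} (h : IsBasisOver φ V) (e : κ ≃ ι) :
    IsBasisOver (φ ∘ e) V := by
  refine ⟨fun f => (h.1 f).trans ⟨?_, ?_⟩, fun c hc h0 => ?_⟩
  · rintro ⟨c, hc, rfl⟩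
    exact ⟨c ∘ e, fun i => hc _, (e.sum_comp fun i => φ i * c i).symm⟩
  · rintro ⟨c, hc, rfl⟩
    refine ⟨c ∘ e.symm, fun i => hc _, ?_⟩
    rw [← e.sum_comp]
    simp
  · have := h.2 (c ∘ e.symm) (fun i => hc _) (by rw [← h0, ← e.sum_comp]; simp)
    funext i
    simpa using congrFun this (e i)

theorem isUnit_wronskiMatrix {r : ℕ} {φ ψ : Fin r → SFun 𝕜 J U q}
    {V : Submodule 𝕜 (SFun 𝕜 J U q)} (hφ : IsUnit (wronskiMatrix φ)) (hφV : IsBasisOver φ V)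
    (hψV : IsBasisOver ψ V) : IsUnit (wronskiMatrix ψ) := by
  have key : ∀ {χ : Fin r → SFun 𝕜 J U q}, IsBasisOver χ V → ∀ f ∈ V,
      ∃ c : Fin r → SFun 𝕜 J U q, (∀ i, (superD 𝕜 J U q).D (c i) = 0) ∧ f = ∑ i, χ i * c i := by
    intro χ hχ f hf
    obtain ⟨c, hc, hf⟩ := (hχ.1 f).1 hf
    exact ⟨c, fun i => (isConst_iff _).1 (hc i), hf⟩
  exact OddDerivation.isUnit_wronski_of_span (S := superD 𝕜 J U q) hφ
    (fun j => key hφV _ (hψV.mem j)) (fun j => key hψV _ (hφV.mem j))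
    fun c hc h0 => hψV.2 c (fun i => (isConst_iff _).2 (hc i)) h0

/-- The differential equation supplies one basis with invertible Wroński matrix, and any other basis
differs from it by an invertible constant matrix. -/
theorem isUnit_wronskiMatrix_of_ker (hJ : (J : Set ℝ).OrdConnected) {r : ℕ}
    {M : Module.End 𝕜 (SFun 𝕜 J U q)} (hM : (superD 𝕜 J U q).IsMonic r M)
    {φ : Fin r → SFun 𝕜 J U q} (hφ : IsBasisOver φ (LinearMap.ker M)) :
    IsUnit (wronskiMatrix φ) := by
  obtain ⟨χ, hχp, hχM, hχ⟩ := exists_solutions hJ hM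
  exact isUnit_wronskiMatrix hχ (isAlternatingBasis_ker hχ hχp hM hχM).2 hφ

theorem isMonic_D_pow (n : ℕ) : (superD 𝕜 J U q).IsMonic n ((superD 𝕜 J U q).D ^ n) :=
  ⟨0, zero_mem _, (add_zero _).symm⟩

/-- Darboux transformations correspond to invariant non-degenerate subspaces. -/
theorem bijOn_ker (hJ : (J : Set ℝ).OrdConnected) {a₀ : SFun 𝕜 J U q} {m : ℕ}
    {L₀ : Module.End 𝕜 (SFun 𝕜 J U q)} (hL₀ : IsNondegenerateOp a₀ m L₀) (r : ℕ) :
    Set.BijOn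
      (fun T : Module.End 𝕜 (SFun 𝕜 J U q) × Module.End 𝕜 (SFun 𝕜 J U q) => LinearMap.ker T.2)
      {T | IsDarboux a₀ m r L₀ T.1 T.2}
      {V | V ∈ Module.End.invtSubmodule L₀ ∧ IsNondegenerateSpace r V} := by
  refine ⟨?_, ?_, ?_⟩
  · rintro ⟨L₁, M⟩ ⟨-, -, hM, hML⟩
    rw [isMonicOp_iff] at hM
    obtain ⟨φ, hφp, hφM, hφ⟩ := exists_solutions hJ hM
    refine ⟨fun f hf => ?_, φ, isAlternatingBasis_ker hφ hφp hM hφM, hφ⟩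
    have h1 : M (L₀ f) = L₁ (M f) := LinearMap.congr_fun hML f
    rw [Submodule.mem_comap, LinearMap.mem_ker, h1, LinearMap.mem_ker.1 hf, map_zero]
  · rintro ⟨L₁, M⟩ ⟨-, hL₁, hM, hML⟩ ⟨L₁', M'⟩ ⟨-, hL₁', hM', hML'⟩ hker
    dsimp only at *
    rw [isMonicOp_iff] at hM hM'
    obtain ⟨φ, hφp, hφM, hφ⟩ := exists_solutions hJ hM
    -- Equal kernels contain the same full system of solutions, which determines a monic operator of
    -- this order.
    have hMM : M = M' := hM.eq_of_isUnit_wronski hφ hM' hφM fun j => by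
      rw [← LinearMap.mem_ker, ← hker]
      exact hφM j
    subst hMM
    obtain ⟨-, -, N, hN, rfl⟩ := isNondegenerateOp_iff.1 hL₁
    obtain ⟨-, -, N', hN', rfl⟩ := isNondegenerateOp_iff.1 hL₁'
    -- The solutions of `D^n` provide invertible Wroński matrices of every size.
    have h0 : N - N' = 0 := hM.eq_zero_of_mul_eq_zero
      (fun n => (exists_solutions hJ (isMonic_D_pow n)).imp fun _ h => h.2.2) (sub_mem hN hN') (by
        have := hML.symm.trans hML'
        rw [add_mul, add_mul] at this
        rw [sub_mul, sub_eq_zero]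
        exact add_left_cancel this)
    rw [sub_eq_zero.1 h0]
  · rintro V ⟨hV, φ, ⟨hφp, hφV⟩, hφ⟩
    obtain ⟨hau, ha, hL⟩ := isNondegenerateOp_iff.1 hL₀
    obtain ⟨M, hM, hφM⟩ := OddDerivation.exists_isMonic_of_isUnit_wronski
      (S := superD 𝕜 J U q) hφ hφp
    have hker : LinearMap.ker M = V := by
      ext f
      rw [(isAlternatingBasis_ker hφ hφp hM hφM).2.1 f, hφV.1 f]
    obtain ⟨L₁, hL₁, hML⟩ := OddDerivation.IsMonic.exists_intertwining
      (S := superD 𝕜 J U q) hφ hM hφM ha hL fun j => by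
      have := hV (hφV.mem j)
      rwa [Submodule.mem_comap, ← hker] at this
    exact ⟨(L₁, M), ⟨hL₀, isNondegenerateOp_iff.2 ⟨hau, ha, hL₁⟩, isMonicOp_iff.2 hM, hML⟩, hker⟩

/-- Both orders are treated at once: `par` may be the parity of the index or its shift, as only the
parity of sums `par i + par j` matters for the entries. The function `ψ` is arbitrary, since the
coefficients of the last column stay on the right. -/
theorem wronskian_formula (hJ : (J : Set ℝ).OrdConnected) {r : ℕ}
    {M : Module.End 𝕜 (SFun 𝕜 J U q)} (hM : IsMonicOp r M) {φ : Fin r → SFun 𝕜 J U q}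
    (hφ : IsAlternatingBasis φ (LinearMap.ker M)) {par : Fin (r + 1) → ZMod 2}
    (hpar : ∀ i j : Fin (r + 1), ((i : ℕ) + j) % 2 = ((par i).val + (par j).val) % 2)
    (hlast : par (Fin.last r) = 0) :
    IsUnit (wronskiMatrix φ) ∧ IsUnit (ber (par ∘ Fin.castSucc) (wronskiMatrix φ)) ∧
      ∀ ψ, M ψ = Ring.inverse (ber (par ∘ Fin.castSucc) (wronskiMatrix φ)) *
        ber par (wronskiMatrix (Fin.snoc φ ψ : Fin (r + 1) → SFun 𝕜 J U q)) := by
  rw [isMonicOp_iff] at hM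
  have hu := isUnit_wronskiMatrix_of_ker hJ hM hφ.2
  have hb : IsUnit (ber (par ∘ Fin.castSucc) (wronskiMatrix φ)) :=
    OddDerivation.isUnit_ber (S := superD 𝕜 J U q) (fun i j =>
      OddDerivation.HasPar.congr
        (OddDerivation.HasPar.map_D_pow (S := superD 𝕜 J U q) (hφ.1 j) i) (by
        rw [add_comm]
        exact hpar i.castSucc j.castSucc)) hu
  refine ⟨hu, hb, fun ψ => ?_⟩
  have h1 := OddDerivation.IsMonic.ber_wronski_snoc (S := superD 𝕜 J U q) hu hφ.1 hM
    (fun j => hφ.2.mem j) hpar hlast ψ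
  have h2 : ber par (wronskiMatrix (Fin.snoc φ ψ : Fin (r + 1) → SFun 𝕜 J U q))
      = ber (par ∘ Fin.castSucc) (wronskiMatrix φ) * M ψ := h1
  rw [h2, Ring.inverse_mul_cancel_left _ _ hb]

/-- Splitting `0, …, 2s` into even and odd numbers. -/
def oddSplit (s : ℕ) : Fin (s + 1) ⊕ Fin s ≃ Fin (2 * s + 1) where
  toFun := Sum.elim (fun i => ⟨2 * i, by omega⟩) fun i => ⟨2 * i + 1, by omega⟩
  invFun k := if h : (k : ℕ) % 2 = 0 then .inl ⟨k / 2, by omega⟩ else .inr ⟨k / 2, by omega⟩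
  left_inv := by
    rintro (i | i)
    · simp
    · have : (2 * (i : ℕ) + 1) % 2 ≠ 0 := by omega
      exact (dif_neg this).trans (congrArg Sum.inr (Fin.ext (by simp; omega)))
  right_inv k := by
    by_cases h : (k : ℕ) % 2 = 0
    · simp only [h, dif_pos, Sum.elim_inl]; ext; simp; omega
    · simp only [h, dif_neg, not_false_eq_true, Sum.elim_inr]; ext; simp; omega

/-- Splitting `0, …, 2s - 1` into even and odd numbers. -/
def evenSplit (s : ℕ) : Fin s ⊕ Fin s ≃ Fin (2 * s) where
  toFun := Sum.elim (fun i => ⟨2 * i, by omega⟩) fun i => ⟨2 * i + 1, by omega⟩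
  invFun k := if (k : ℕ) % 2 = 0 then .inl ⟨k / 2, by omega⟩ else .inr ⟨k / 2, by omega⟩
  left_inv := by
    rintro (i | i)
    · simp
    · have : (2 * (i : ℕ) + 1) % 2 ≠ 0 := by omega
      simp only [Sum.elim_inr, this, if_false, Sum.inr.injEq]
      ext; simp; omega
  right_inv k := by
    by_cases h : (k : ℕ) % 2 = 0
    · simp only [h, if_pos, Sum.elim_inl]; ext; simp; omega
    · simp only [h, if_neg, not_false_eq_true, Sum.elim_inr]; ext; simp; omega

theorem IsAlternatingBasis.hasSuperdim {a b n : ℕ} {φ : Fin n → SFun 𝕜 J U q}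
    {V : Submodule 𝕜 (SFun 𝕜 J U q)} (h : IsAlternatingBasis φ V) (e : Fin a ⊕ Fin b ≃ Fin n)
    (h0 : ∀ i, (e (.inl i) : ℕ) % 2 = 0) (h1 : ∀ i, (e (.inr i) : ℕ) % 2 = 1) :
    HasSuperdim V a b := by
  refine ⟨fun i => φ (e (.inl i)), fun i => φ (e (.inr i)), fun i => ?_, fun i => ?_, ?_⟩
  · exact OddDerivation.HasPar.congr (S := superD 𝕜 J U q) (h.1 _) (h0 i)
  · exact OddDerivation.HasPar.congr (S := superD 𝕜 J U q) (h.1 _) (h1 i)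
  · convert h.2.reindex e using 1
    funext i
    rcases i with i | i <;> rfl

end Main

end Superline

end

theorem mainTheorem2 {𝕜 : Type} [RCLike 𝕜] {p q : ℕ}
    (J : TopologicalSpace.Opens ℝ) (hJ : (J : Set ℝ).OrdConnected)
    (U : TopologicalSpace.Opens (Fin p → ℝ))
    (a₀ : Superline.SFun 𝕜 J U q) (m : ℕ) (L₀ : Module.End 𝕜 (Superline.SFun 𝕜 J U q))
    (hL₀ : Superline.IsNondegenerateOp a₀ m L₀) (s : ℕ) :
    -- order `r = 2s + 1`
    (Set.BijOn
        (fun T : Module.End 𝕜 (Superline.SFun 𝕜 J U q) × Module.End 𝕜 (Superline.SFun 𝕜 J U q) =>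
          LinearMap.ker T.2)
        {T | Superline.IsDarboux a₀ m (2 * s + 1) L₀ T.1 T.2}
        {V | V ∈ Module.End.invtSubmodule L₀ ∧ Superline.HasSuperdim V (s + 1) s ∧
          Superline.IsNondegenerateSpace (2 * s + 1) V} ∧
      ∀ L₁ M : Module.End 𝕜 (Superline.SFun 𝕜 J U q),
        Superline.IsDarboux a₀ m (2 * s + 1) L₀ L₁ M →
        ∀ φ : Fin (2 * s + 1) → Superline.SFun 𝕜 J U q,
          Superline.IsAlternatingBasis φ (LinearMap.ker M) →
          IsUnit (Superline.wronskiMatrix φ) ∧ IsUnit (Superline.WStar φ) ∧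
          ∀ ψ, M ψ = Ring.inverse (Superline.WStar φ) * Superline.WStar (Fin.snoc φ ψ)) ∧
    -- order `r = 2s`
    (Set.BijOn
        (fun T : Module.End 𝕜 (Superline.SFun 𝕜 J U q) × Module.End 𝕜 (Superline.SFun 𝕜 J U q) =>
          LinearMap.ker T.2)
        {T | Superline.IsDarboux a₀ m (2 * s) L₀ T.1 T.2}
        {V | V ∈ Module.End.invtSubmodule L₀ ∧ Superline.HasSuperdim V s s ∧
          Superline.IsNondegenerateSpace (2 * s) V} ∧
      ∀ L₁ M : Module.End 𝕜 (Superline.SFun 𝕜 J U q),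
        Superline.IsDarboux a₀ m (2 * s) L₀ L₁ M →
        ∀ φ : Fin (2 * s) → Superline.SFun 𝕜 J U q,
          Superline.IsAlternatingBasis φ (LinearMap.ker M) →
          IsUnit (Superline.wronskiMatrix φ) ∧ IsUnit (Superline.W φ) ∧
          ∀ ψ, M ψ = Ring.inverse (Superline.W φ) * Superline.W (Fin.snoc φ ψ)) := by
  refine ⟨⟨?_, fun L₁ M hD φ hφ => ?_⟩, ?_, fun L₁ M hD φ hφ => ?_⟩
  · convert Superline.bijOn_ker hJ hL₀ (2 * s + 1) using 1
    ext V
    -- The dimension condition is implied by non-degeneracy: an alternating basis splits into its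
    -- even and odd members.
    refine and_congr_right fun _ => and_iff_right_of_imp ?_
    rintro ⟨φ, hφ, -⟩
    exact hφ.hasSuperdim (Superline.oddSplit s) (fun i => by simp [Superline.oddSplit])
      fun i => by simp [Superline.oddSplit]
  · refine Superline.wronskian_formula hJ hD.2.2.1 hφ
      -- The last index `2s + 1` is odd, so the format is shifted to make it even; this shift turns
      -- the Berezinian into its starred version.
      (par := fun i => Superline.altFormat (2 * s + 1 + 1) i + 1) (fun i j => ?_) ?_
    · simp only [Superline.altFormat, ZMod.val_add, ZMod.val_natCast, ZMod.val_one]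
      omega
    · simp only [Superline.altFormat, Fin.val_last]
      have h2 : (2 : ZMod 2) = 0 := rfl
      push_cast
      rw [h2, zero_mul, zero_add]
      rfl
  · convert Superline.bijOn_ker hJ hL₀ (2 * s) using 1
    ext V
    refine and_congr_right fun _ => and_iff_right_of_imp ?_
    rintro ⟨φ, hφ, -⟩
    exact hφ.hasSuperdim (Superline.evenSplit s) (fun i => by simp [Superline.evenSplit])
      fun i => by simp [Superline.evenSplit]
  · refine Superline.wronskian_formula hJ hD.2.2.1 hφ
      (par := Superline.altFormat (2 * s + 1)) (fun i j => ?_) ?_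
    · simp only [Superline.altFormat, ZMod.val_natCast]
      omega
    · simp only [Superline.altFormat, Fin.val_last]
      have h2 : (2 : ZMod 2) = 0 := rfl
      push_cast
      rw [h2, zero_mul]
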